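/- Work over $\mathbb{C}$. Let $(Z,\mathcal{L})$ be one of the following pairs: (a) $(\mathbb{P}^3,\mathcal{O}(a))$ with $a\in\{2,3,4\}$; (b) $(\mathbb{P}^1\times\mathbb{P}^2,\ \mathcal{O}(1)\boxtimes\mathcal{O}(b))$ with $b\in\{1,2\}$; (c) $(\mathbb{P}^1\times\mathbb{P}^1\times\mathbb{P}^1,\ \mathcal{O}(1)\boxtimes\mathcal{O}(1)\boxtimes\mathcal{O}(1))$. Then there are nonempty Zariski open subsets $U\subset H^0(Z\times\mathbb{P}^1,\mathcal{L}\boxtimes\mathcal{O}(2))$ and $V\subset H^0(Z,\mathcal{L}^{\otimes 2})$ such that for all $s\in U$ and $t\in V$ the following hold. The zero scheme $Y$ of $s$ in $Z\times\mathbb{P}^1$ is smooth; the zero scheme $B$ of $t$ in $Z$ is smooth; $Y$ and the double cover $X=\{w^2=t\}\subset\mathrm{Tot}(\mathcal{L})$ of $Z$ branched along $B$ are connected complex manifolds of dimension $3$; and there is a conifold transition $X\nearrow Y$. Here a conifold transition $X\nearrow Y$ consists of a projective flat morphism $\pi\colon\mathfrak{X}\to\Delta$ from a (connected) smooth complex fourfold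 $\mathfrak{X}$ to the unit disk $\Delta\subset\mathbb{C}$, smooth over $\Delta\setminus\{0\}$, one of whose fibres over $\Delta\setminus\{0\}$ is isomorphic to $X$ and whose central fibre $\overline{X}=\pi^{-1}(0)$ has finitely many, and at least one, singular points, all of them ordinary double points, together with a projective small resolution $\psi\colon Y\to\overline{X}$. That is, $\psi$ is a projective surjective holomorphic map that is an isomorphism over the smooth locus of $\overline{X}$ and whose exceptional locus has codimension at least $2$ in $Y$. -/

import Mathlib

open scoped Manifold ContDiff Topology LinearAlgebra.Projectivization

noncomputable section

/-- Complex projective space `ℙⁿ`, with homogeneous coordinates indexed by `Fin (n + 1)`. -/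
abbrev ProjSpace (n : ℕ) : Type := ℙ ℂ (Fin (n + 1) → ℂ)

namespace ProjSpace

variable {n : ℕ}

/-- The quotient topology of `ℂⁿ⁺¹ ∖ {0} → ℙⁿ`. -/
instance : TopologicalSpace (ProjSpace n) :=
  inferInstanceAs (TopologicalSpace (Quotient (projectivizationSetoid ℂ (Fin (n + 1) → ℂ))))

lemma continuous_mk' :
    Continuous (fun v : {v : Fin (n + 1) → ℂ // v ≠ 0} => (Projectivization.mk' ℂ v : ProjSpace n)) :=
  continuous_quotient_mk'

lemma isQuotientMap_mk' : Topology.IsQuotientMap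
    (fun v : {v : Fin (n + 1) → ℂ // v ≠ 0} => (Projectivization.mk' ℂ v : ProjSpace n)) :=
  isQuotientMap_quotient_mk'

/-- The affine coordinates `v_k / v_j` on `ℙⁿ`. -/
def ratio (j k : Fin (n + 1)) (p : ProjSpace n) : ℂ := p.rep k / p.rep j

lemma ratio_mk (j k : Fin (n + 1)) (v : Fin (n + 1) → ℂ) (hv : v ≠ 0) :
    ratio j k (Projectivization.mk ℂ v hv) = v k / v j := by
  obtain ⟨a, ha⟩ := Projectivization.exists_smul_eq_mk_rep ℂ v hv
  have h : ∀ l, (Projectivization.mk ℂ v hv).rep l = (a : ℂ) * v l := fun l => by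
    rw [← ha]; rfl
  simp only [ratio, h]
  exact mul_div_mul_left _ _ a.ne_zero

/-- The standard affine open set `{v_j ≠ 0}`. -/
def affineOpen (j : Fin (n + 1)) : Set (ProjSpace n) := {p | p.rep j ≠ 0}

lemma mk_mem_affineOpen (j : Fin (n + 1)) (v : Fin (n + 1) → ℂ) (hv : v ≠ 0) :
    Projectivization.mk ℂ v hv ∈ affineOpen j ↔ v j ≠ 0 := by
  obtain ⟨a, ha⟩ := Projectivization.exists_smul_eq_mk_rep ℂ v hv
  have h : (Projectivization.mk ℂ v hv).rep j = (a : ℂ) * v j := by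
    rw [← ha]; rfl
  simp [affineOpen, h]

lemma isOpen_affineOpen (j : Fin (n + 1)) : IsOpen (affineOpen j : Set (ProjSpace n)) := by
  rw [← isQuotientMap_mk'.isOpen_preimage]
  have : (fun v : {v : Fin (n + 1) → ℂ // v ≠ 0} => (Projectivization.mk' ℂ v : ProjSpace n)) ⁻¹'
      affineOpen j = {v | v.1 j ≠ 0} := by
    ext v; exact mk_mem_affineOpen j v.1 v.2
  rw [this]
  exact isOpen_ne_fun ((continuous_apply j).comp continuous_subtype_val) continuous_const

lemma continuousOn_ratio (j k : Fin (n + 1)) :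
    ContinuousOn (ratio j k : ProjSpace n → ℂ) (affineOpen j) := by
  rw [isQuotientMap_mk'.continuousOn_isOpen_iff (isOpen_affineOpen j)]
  have : ContinuousOn (fun v : {v : Fin (n + 1) → ℂ // v ≠ 0} => v.1 k / v.1 j) {v | v.1 j ≠ 0} :=
    ContinuousOn.div ((continuous_apply k).comp continuous_subtype_val).continuousOn
      ((continuous_apply j).comp continuous_subtype_val).continuousOn (fun v hv => hv)
  refine (this.mono ?_).congr ?_
  · intro v hv; exact (mk_mem_affineOpen j v.1 v.2).1 hv
  · intro v _; exact ratio_mk j k v.1 v.2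

lemma insertNth_one_ne_zero (j : Fin (n + 1)) (u : Fin n → ℂ) :
    (j.insertNth (1 : ℂ) u : Fin (n + 1) → ℂ) ≠ 0 := fun h => by
  have := congrFun h j
  simp at this

/-- The standard affine chart `[v] ↦ (v_k / v_j)_{k ≠ j}` of `ℙⁿ`. -/
def affineChart (j : Fin (n + 1)) : OpenPartialHomeomorph (ProjSpace n) (Fin n → ℂ) where
  toFun p := fun k => ratio j (j.succAbove k) p
  invFun u := Projectivization.mk ℂ (j.insertNth (1 : ℂ) u) (insertNth_one_ne_zero j u)
  source := affineOpen j
  target := Set.univ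
  map_source' _ _ := trivial
  map_target' u _ := by simp [mk_mem_affineOpen]
  left_inv' p hp := by
    induction p using Projectivization.ind with
    | h v hv =>
      rw [mk_mem_affineOpen] at hp
      rw [Projectivization.mk_eq_mk_iff']
      refine ⟨(v j)⁻¹, ?_⟩
      ext k
      refine Fin.succAboveCases j ?_ (fun k => ?_) k
      · simp [hp]
      · simp [ratio_mk, div_eq_inv_mul]
  right_inv' u _ := by
    ext k
    simp [ratio_mk]
  open_source := isOpen_affineOpen j
  open_target := isOpen_univ
  continuousOn_toFun := continuousOn_pi.2 fun k => continuousOn_ratio j _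
  continuousOn_invFun := by
    refine Continuous.continuousOn (continuous_mk'.comp (Continuous.subtype_mk ?_ _))
    exact Continuous.finInsertNth j continuous_const continuous_id

lemma exists_mem_affineOpen (p : ProjSpace n) : ∃ j, p ∈ affineOpen j :=
  Function.ne_iff.1 p.rep_nonzero

/-- An index of a nonvanishing homogeneous coordinate. -/
def idx (p : ProjSpace n) : Fin (n + 1) := (exists_mem_affineOpen p).choose

lemma mem_affineOpen_idx (p : ProjSpace n) : p ∈ affineOpen (idx p) :=
  (exists_mem_affineOpen p).choose_spec

instance : ChartedSpace (Fin n → ℂ) (ProjSpace n) where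
  atlas := Set.range affineChart
  chartAt p := affineChart (idx p)
  mem_chart_source := mem_affineOpen_idx
  chart_mem_atlas _ := ⟨_, rfl⟩

lemma contDiffOn_transition (i j : Fin (n + 1)) :
    ContDiffOn ℂ ω (affineChart j ∘ (affineChart i).symm : (Fin n → ℂ) → (Fin n → ℂ))
      ((affineChart i).symm.trans (affineChart j)).source := by
  have key : ∀ k, ContDiff ℂ ω (fun u : Fin n → ℂ => (i.insertNth (1 : ℂ) u : Fin (n + 1) → ℂ) k) := by
    intro k
    refine Fin.succAboveCases i ?_ (fun k => ?_) k
    · simpa using contDiff_const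
    · simpa using contDiff_apply ℂ ℂ k
  refine contDiffOn_pi.2 fun k => ?_
  have h : ∀ u : Fin n → ℂ, (affineChart j ∘ (affineChart i).symm : (Fin n → ℂ) → (Fin n → ℂ)) u k =
      (i.insertNth (1 : ℂ) u : Fin (n + 1) → ℂ) (j.succAbove k) /
        (i.insertNth (1 : ℂ) u : Fin (n + 1) → ℂ) j := fun u => ratio_mk _ _ _ _
  simp only [h]
  refine (key _).contDiffOn.div (key _).contDiffOn fun u hu => ?_
  have h2 := hu.2
  exact (mk_mem_affineOpen j _ (insertNth_one_ne_zero i u)).1 h2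

instance : IsManifold 𝓘(ℂ, Fin n → ℂ) ω (ProjSpace n) := by
  refine isManifold_of_contDiffOn _ _ _ ?_
  rintro _ _ ⟨i, rfl⟩ ⟨j, rfl⟩
  simpa using contDiffOn_transition i j

end ProjSpace

/-- The product of projective spaces `ℙ^(n 0) × ⋯ × ℙ^(n (r - 1))`. -/
abbrev MultiProj {r : ℕ} (n : Fin r → ℕ) : Type := ∀ i, ProjSpace (n i)

namespace MultiProj

variable {r : ℕ} {n : Fin r → ℕ}

/-- The product of standard affine charts, one for each factor. -/
def affineChart (J : ∀ i, Fin (n i + 1)) :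
    OpenPartialHomeomorph (MultiProj n) (∀ i, Fin (n i) → ℂ) :=
  OpenPartialHomeomorph.pi fun i => ProjSpace.affineChart (J i)

/-- The product of standard affine open sets. -/
def affineOpen (J : ∀ i, Fin (n i + 1)) : Set (MultiProj n) :=
  {z | ∀ i, z i ∈ ProjSpace.affineOpen (J i)}

lemma affineChart_source (J : ∀ i, Fin (n i + 1)) :
    (affineChart J).source = affineOpen J := by
  ext z
  simp [affineChart, affineOpen, ProjSpace.affineChart]

lemma isOpen_affineOpen (J : ∀ i, Fin (n i + 1)) : IsOpen (affineOpen J) :=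
  affineChart_source J ▸ (affineChart J).open_source

instance : ChartedSpace (∀ i, Fin (n i) → ℂ) (MultiProj n) where
  atlas := Set.range affineChart
  chartAt z := affineChart fun i => ProjSpace.idx (z i)
  mem_chart_source z := by
    rw [affineChart_source]
    exact fun i => ProjSpace.mem_affineOpen_idx (z i)
  chart_mem_atlas _ := ⟨_, rfl⟩

instance : IsManifold 𝓘(ℂ, ∀ i, Fin (n i) → ℂ) ω (MultiProj n) := by
  refine isManifold_of_contDiffOn _ _ _ ?_
  rintro _ _ ⟨I, rfl⟩ ⟨J, rfl⟩
  suffices h : ContDiffOn ℂ ω (affineChart J ∘ (affineChart I).symm :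
      (∀ i, Fin (n i) → ℂ) → ∀ i, Fin (n i) → ℂ)
      ((affineChart I).symm.trans (affineChart J)).source by simpa using h
  refine contDiffOn_pi.2 fun i => ?_
  refine (ProjSpace.contDiffOn_transition (I i) (J i)).comp
    (ContinuousLinearMap.proj (R := ℂ) (φ := fun i => Fin (n i) → ℂ) i).contDiff.contDiffOn fun u hu => ?_
  have h2 := hu.2
  rw [Set.mem_preimage, affineChart_source] at h2
  exact ⟨trivial, h2 i⟩

lemma contMDiffOn_ratio (J : ∀ i, Fin (n i + 1)) (i : Fin r) (k : Fin (n i + 1)) :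
    ContMDiffOn 𝓘(ℂ, ∀ i, Fin (n i) → ℂ) 𝓘(ℂ) ω
      (fun z : MultiProj n => ProjSpace.ratio (J i) k (z i)) (affineOpen J) := by
  refine Fin.succAboveCases (J i) ?_ (fun l => ?_) k
  · refine contMDiffOn_const (c := (1 : ℂ)).congr fun z hz => ?_
    exact div_self (hz i)
  · have h := contMDiffOn_of_mem_maximalAtlas (I := 𝓘(ℂ, ∀ i, Fin (n i) → ℂ)) (n := ω)
      (IsManifold.subset_maximalAtlas (show affineChart J ∈ atlas _ (MultiProj n) from ⟨J, rfl⟩))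
    rw [affineChart_source] at h
    have hp : ContDiff ℂ ω (fun u : (∀ i, Fin (n i) → ℂ) => u i l) :=
      (contDiff_apply ℂ ℂ l).comp
        (ContinuousLinearMap.proj (R := ℂ) (φ := fun i => Fin (n i) → ℂ) i).contDiff
    exact hp.contMDiff.comp_contMDiffOn h

/-- The transition function `∏ (v_(I i) / v_(J i)) ^ (d i)` of the line bundle `𝒪(d)`. -/
def transition (d : Fin r → ℕ) (I J : ∀ i, Fin (n i + 1)) (z : MultiProj n) : ℂ :=
  ∏ i, ProjSpace.ratio (J i) (I i) (z i) ^ d i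

lemma contMDiffOn_transition (d : Fin r → ℕ) (I J : ∀ i, Fin (n i + 1)) :
    ContMDiffOn 𝓘(ℂ, ∀ i, Fin (n i) → ℂ) 𝓘(ℂ) ω
      (transition d I J : MultiProj n → ℂ) (affineOpen J) := by
  unfold transition
  exact contMDiffOn_finsetProd fun i _ => (contMDiffOn_ratio J i (I i)).pow (d i)

lemma contMDiffOn_transition_smul (d : Fin r → ℕ) (I J : ∀ i, Fin (n i + 1)) :
    ContMDiffOn 𝓘(ℂ, ∀ i, Fin (n i) → ℂ) 𝓘(ℂ, ℂ →L[ℂ] ℂ) ω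
      (fun z : MultiProj n => transition d I J z • ContinuousLinearMap.id ℂ ℂ)
      (affineOpen I ∩ affineOpen J) :=
  ((contMDiffOn_transition d I J).mono Set.inter_subset_right).smul contMDiffOn_const

/-- The holomorphic line bundle `𝒪(d) = 𝒪(d 0) ⊠ ⋯ ⊠ 𝒪(d (r - 1))`.  On the affine open set of
index `J` it is trivialised by the monomial `∏ v_(J i) ^ (d i)`. -/
def lineBundle (n d : Fin r → ℕ) :
    VectorBundleCore ℂ (MultiProj n) ℂ (∀ i, Fin (n i + 1)) where
  baseSet := affineOpen
  isOpen_baseSet := isOpen_affineOpen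
  indexAt z := fun i => ProjSpace.idx (z i)
  mem_baseSet_at z := fun i => ProjSpace.mem_affineOpen_idx (z i)
  coordChange I J z := transition d I J z • ContinuousLinearMap.id ℂ ℂ
  coordChange_self I z hz a := by
    have : ∀ i, ProjSpace.ratio (I i) (I i) (z i) = 1 := fun i => div_self (hz i)
    simp [transition, this]
  continuousOn_coordChange I J := (contMDiffOn_transition_smul d I J).continuousOn
  coordChange_comp I J K z hz a := by
    have : transition d J K z * transition d I J z = transition d I K z := by
      simp only [transition, ← Finset.prod_mul_distrib, ← mul_pow]
      refine Finset.prod_congr rfl fun i _ => ?_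
      have hJ : (z i).rep (J i) ≠ 0 := hz.1.2 i
      rw [ProjSpace.ratio, ProjSpace.ratio, ProjSpace.ratio, mul_comm, div_mul_div_cancel₀ hJ]
    simp [← this, mul_assoc]

instance (d : Fin r → ℕ) :
    (lineBundle n d).IsContMDiff 𝓘(ℂ, ∀ i, Fin (n i) → ℂ) ω where
  contMDiffOn_coordChange I J := contMDiffOn_transition_smul d I J

/-- The homogeneous coordinates of (a representative of) a point. -/
def coords (z : MultiProj n) : (Σ i, Fin (n i + 1)) → ℂ := fun k => (z k.1).rep k.2

/-- The multidegree of the homogeneous coordinates: those of the `i`-th factor have degree `eᵢ`. -/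
def weight (n : Fin r → ℕ) (k : Σ i, Fin (n i + 1)) : Fin r → ℕ := Pi.single k.1 1

/-- `H⁰(𝒪(d))`, the space of multihomogeneous polynomials of multidegree `d`. -/
abbrev sections (n d : Fin r → ℕ) : Submodule ℂ (MvPolynomial (Σ i, Fin (n i + 1)) ℂ) :=
  MvPolynomial.weightedHomogeneousSubmodule ℂ (weight n) d

/-- The divisor of the section `t` is smooth (as a scheme): Jacobian criterion in homogeneous
coordinates. -/
def IsSmoothDivisor (t : MvPolynomial (Σ i, Fin (n i + 1)) ℂ) : Prop :=
  ∀ z : MultiProj n, MvPolynomial.eval (coords z) t = 0 →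
    ∃ k, MvPolynomial.eval (coords z) (MvPolynomial.pderiv k t) ≠ 0

/-- The double cover `{w² = t}` in the total space of `𝒪(d)`, for a section `t` of `𝒪(d)^{⊗ 2}`.
In the trivialisation of index `J`, the section `t` is the function
`t(v) / (∏ v_(J i) ^ (d i)) ^ 2`. -/
def doubleCover (d : Fin r → ℕ) (t : MvPolynomial (Σ i, Fin (n i + 1)) ℂ) :
    Set (lineBundle n d).TotalSpace :=
  {e | ∀ J, e.proj ∈ affineOpen J →
    ((lineBundle n d).localTriv J e).2 ^ 2 =
      MvPolynomial.eval (coords e.proj) t / (∏ i, (e.proj i).rep (J i) ^ d i) ^ 2}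

/-- The homogeneous coordinates of (a representative of) a point of `Z × ℙ¹`. -/
def coordsProd (p : MultiProj n × ProjSpace 1) : (Σ i, Fin (n i + 1)) ⊕ Fin 2 → ℂ :=
  Sum.elim (coords p.1) p.2.rep

/-- The multidegree of the homogeneous coordinates of `Z × ℙ¹`. -/
def weightProd (n : Fin r → ℕ) : (Σ i, Fin (n i + 1)) ⊕ Fin 2 → (Fin r → ℕ) × ℕ :=
  Sum.elim (fun k => (weight n k, 0)) (fun _ => (0, 1))

/-- `H⁰(Z × ℙ¹, 𝒪(d) ⊠ 𝒪(m))`, the space of multihomogeneous polynomials of multidegree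
`(d, m)`. -/
abbrev sectionsProd (n d : Fin r → ℕ) (m : ℕ) :
    Submodule ℂ (MvPolynomial ((Σ i, Fin (n i + 1)) ⊕ Fin 2) ℂ) :=
  MvPolynomial.weightedHomogeneousSubmodule ℂ (weightProd n) (d, m)

/-- The zero locus in `Z × ℙ¹` of a section. -/
def zeroLocusProd (s : MvPolynomial ((Σ i, Fin (n i + 1)) ⊕ Fin 2) ℂ) :
    Set (MultiProj n × ProjSpace 1) :=
  {p | MvPolynomial.eval (coordsProd p) s = 0}

/-- The divisor in `Z × ℙ¹` of the section `s` is smooth (as a scheme). -/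
def IsSmoothDivisorProd (s : MvPolynomial ((Σ i, Fin (n i + 1)) ⊕ Fin 2) ℂ) : Prop :=
  ∀ p : MultiProj n × ProjSpace 1, MvPolynomial.eval (coordsProd p) s = 0 →
    ∃ k, MvPolynomial.eval (coordsProd p) (MvPolynomial.pderiv k s) ≠ 0

end MultiProj

/-- Zariski open subsets of a complex vector space: unions of nonvanishing loci of polynomials in
the linear coordinates. -/
def IsZariskiOpen {W : Type*} [AddCommGroup W] [Module ℂ W] (U : Set W) : Prop :=
  ∃ A : Set (MvPolynomial (Module.Dual ℂ W) ℂ),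
    U = {x | ∃ G ∈ A, MvPolynomial.eval (fun φ : Module.Dual ℂ W => φ x) G ≠ 0}

/-- A connected complex manifold of dimension `m`. -/
structure ComplexManifold (m : ℕ) where
  carrier : Type
  [topologicalSpace : TopologicalSpace carrier]
  [t2Space : T2Space carrier]
  [secondCountable : SecondCountableTopology carrier]
  [connectedSpace : ConnectedSpace carrier]
  [chartedSpace : ChartedSpace (Fin m → ℂ) carrier]
  [isManifold : IsManifold 𝓘(ℂ, Fin m → ℂ) ω carrier]

namespace ComplexManifold

instance (m : ℕ) : CoeSort (ComplexManifold m) Type := ⟨carrier⟩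

attribute [instance] topologicalSpace t2Space secondCountable connectedSpace chartedSpace isManifold

end ComplexManifold

section Holomorphic

variable {E₁ H₁ M₁ E₂ H₂ M₂ : Type*}
  [NormedAddCommGroup E₁] [NormedSpace ℂ E₁] [TopologicalSpace H₁]
  [NormedAddCommGroup E₂] [NormedSpace ℂ E₂] [TopologicalSpace H₂]
  (I₁ : ModelWithCorners ℂ E₁ H₁) (I₂ : ModelWithCorners ℂ E₂ H₂)
  [TopologicalSpace M₁] [ChartedSpace H₁ M₁] [TopologicalSpace M₂] [ChartedSpace H₂ M₂]

/-- A closed holomorphic embedding: a holomorphic immersion that is a homeomorphism onto a closed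
subset. -/
structure IsClosedHolEmbedding (f : M₁ → M₂) : Prop where
  holomorphic : ContMDiff I₁ I₂ ω f
  isClosedEmbedding : Topology.IsClosedEmbedding f
  immersion : ∀ x, Function.Injective (mfderiv I₁ I₂ f x)

/-- A projective morphism: it factors as a closed embedding `M₁ → M₂ × ℙᴺ` followed by the
projection. -/
def IsProjectiveMorphism (f : M₁ → M₂) : Prop :=
  ∃ (N : ℕ) (g : M₁ → ProjSpace N),
    IsClosedHolEmbedding I₁ (I₂.prod 𝓘(ℂ, Fin N → ℂ)) (fun x => (f x, g x))

/-- The local ring `𝒪_{M, x}` of germs of holomorphic functions. -/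
def holGerms (x : M₁) : Subring (Filter.Germ (𝓝 x) ℂ) where
  carrier := {φ | ∃ f : M₁ → ℂ, ContMDiffAt I₁ 𝓘(ℂ) ω f x ∧ (f : Filter.Germ (𝓝 x) ℂ) = φ}
  mul_mem' := by
    rintro _ _ ⟨f, hf, rfl⟩ ⟨g, hg, rfl⟩
    exact ⟨f * g, hf.mul hg, rfl⟩
  one_mem' := ⟨1, contMDiffAt_const, rfl⟩
  add_mem' := by
    rintro _ _ ⟨f, hf, rfl⟩ ⟨g, hg, rfl⟩
    exact ⟨f + g, hf.add hg, rfl⟩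
  zero_mem' := ⟨0, contMDiffAt_const, rfl⟩
  neg_mem' := by
    rintro _ ⟨f, hf, rfl⟩
    exact ⟨-f, hf.neg, rfl⟩

/-- The pull-back `𝒪_{M₂, f x} → 𝒪_{M₁, x}` of germs along a holomorphic map. -/
def holGermsMap {f : M₁ → M₂} {x : M₁} (hf : ContMDiffAt I₁ I₂ ω f x) :
    holGerms I₂ (f x) →+* holGerms I₁ x where
  toFun φ := ⟨φ.1.compTendsto f hf.continuousAt, by
    obtain ⟨_, g, hg, rfl⟩ := φ
    exact ⟨g ∘ f, hg.comp x hf, rfl⟩⟩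
  map_one' := rfl
  map_zero' := rfl
  map_mul' := by
    rintro ⟨_, g, hg, rfl⟩ ⟨_, h, hh, rfl⟩
    rfl
  map_add' := by
    rintro ⟨_, g, hg, rfl⟩ ⟨_, h, hh, rfl⟩
    rfl

/-- A flat holomorphic map: all the maps of local rings are flat. -/
def IsFlatHol {f : M₁ → M₂} (hf : ContMDiff I₁ I₂ ω f) : Prop :=
  ∀ x, (holGermsMap I₁ I₂ (hf x)).Flat

end Holomorphic

/-- The unit disk in `ℂ`. -/
def unitDisk : TopologicalSpace.Opens ℂ := ⟨Metric.ball 0 1, Metric.isOpen_ball⟩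

/-- The centre of the unit disk. -/
def unitDisk.center : unitDisk := ⟨0, Metric.mem_ball_self one_pos⟩

/-- The singular points of the fibres of `π : 𝔛 → Δ`, for `𝔛` smooth: the critical points. -/
def IsCriticalPt {m : ℕ} {T : ComplexManifold m} (π : T → unitDisk) (x : T) : Prop :=
  mfderiv 𝓘(ℂ, Fin m → ℂ) 𝓘(ℂ) π x = 0

/-- The fibre of `π` through `x` has an ordinary double point at `x`: the point is critical and the
Hessian of the local equation `π - π x` of the fibre, in local coordinates at `x`, is
nondegenerate. -/
def IsOrdinaryDoublePt {m : ℕ} {T : ComplexManifold m} (π : T → unitDisk) (x : T) : Prop :=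
  IsCriticalPt π x ∧
    ∀ u : Fin m → ℂ,
      (∀ v : Fin m → ℂ,
        fderiv ℂ (fderiv ℂ fun a => (π ((chartAt (Fin m → ℂ) x).symm a) : ℂ))
          (chartAt (Fin m → ℂ) x x) u v = 0) → u = 0

/-- The set `E` (an analytic subset) has dimension less than `k`: it contains no germ of a
`k`-dimensional complex submanifold. -/
def HasDimLT {m : ℕ} {M : ComplexManifold m} (k : ℕ) (E : Set M) : Prop :=
  ∀ g : (Fin k → ℂ) → M, ContMDiffAt 𝓘(ℂ, Fin k → ℂ) 𝓘(ℂ, Fin m → ℂ) ω g 0 →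
    (∀ᶠ u in 𝓝 0, g u ∈ E) →
      ¬ Function.Injective (mfderiv 𝓘(ℂ, Fin k → ℂ) 𝓘(ℂ, Fin m → ℂ) g 0)

/-- A projective small resolution `ψ : Y → X̄` of the central fibre `X̄ = π⁻¹(0)`, given as a
holomorphic map to `𝔛` with image `X̄`.  It is biholomorphic over the smooth locus of `X̄` (there it
is a bijective immersion of threefolds), and its exceptional locus has codimension at least two. -/
structure IsSmallResolution {T : ComplexManifold 4} (π : T → unitDisk) {Y : ComplexManifold 3}
    (ψ : Y → T) : Prop where
  holomorphic : ContMDiff 𝓘(ℂ, Fin 3 → ℂ) 𝓘(ℂ, Fin 4 → ℂ) ω ψ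
  projective : IsProjectiveMorphism 𝓘(ℂ, Fin 3 → ℂ) 𝓘(ℂ, Fin 4 → ℂ) ψ
  range_eq : Set.range ψ = π ⁻¹' {unitDisk.center}
  injective_of_regular : ∀ y y', ¬ IsCriticalPt π (ψ y) → ψ y' = ψ y → y' = y
  immersion_of_regular : ∀ y, ¬ IsCriticalPt π (ψ y) →
    Function.Injective (mfderiv 𝓘(ℂ, Fin 3 → ℂ) 𝓘(ℂ, Fin 4 → ℂ) ψ y)
  small : HasDimLT 2 {y | IsCriticalPt π (ψ y)}

/-- `X ↗ Y`: there is a projective flat morphism `π : 𝔛 → Δ` from a smooth fourfold to the unit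
disk, smooth away from the central fibre, such that the singularities of the central fibre are
ordinary double points `p₁, …, pₖ` (`k ≥ 1`), `X` is isomorphic to a fibre over a point of
`Δ ∖ {0}`, and `Y` is a projective small resolution of the central fibre. -/
def ConifoldTransition (X Y : ComplexManifold 3) : Prop :=
  ∃ (T : ComplexManifold 4) (π : T → unitDisk)
    (hπ : ContMDiff 𝓘(ℂ, Fin 4 → ℂ) 𝓘(ℂ) ω π),
    IsProjectiveMorphism 𝓘(ℂ, Fin 4 → ℂ) 𝓘(ℂ) π ∧
    IsFlatHol 𝓘(ℂ, Fin 4 → ℂ) 𝓘(ℂ) hπ ∧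
    (∀ x, π x ≠ unitDisk.center → ¬ IsCriticalPt π x) ∧
    {x | π x = unitDisk.center ∧ IsCriticalPt π x}.Finite ∧
    {x | π x = unitDisk.center ∧ IsCriticalPt π x}.Nonempty ∧
    (∀ x, π x = unitDisk.center → IsCriticalPt π x → IsOrdinaryDoublePt π x) ∧
    (∃ (c : unitDisk) (j : X → T), c ≠ unitDisk.center ∧
      IsClosedHolEmbedding 𝓘(ℂ, Fin 3 → ℂ) 𝓘(ℂ, Fin 4 → ℂ) j ∧ Set.range j = π ⁻¹' {c}) ∧
    ∃ ψ : Y → T, IsSmallResolution π ψ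

/-- The pairs `(Z, 𝓛)`, where `Z = ∏ ℙ^(n i)` and `𝓛 = 𝒪(d)`:
`(ℙ³, 𝒪(a))` with `a = 2, 3, 4`, `(ℙ¹ × ℙ², 𝒪(1) ⊠ 𝒪(b))` with `b = 1, 2`, and
`(ℙ¹ × ℙ¹ × ℙ¹, 𝒪(1) ⊠ 𝒪(1) ⊠ 𝒪(1))`. -/
inductive IsDoubleSolidPair : (r : ℕ) → (n d : Fin r → ℕ) → Prop
  | projThree (a : ℕ) (ha : a = 2 ∨ a = 3 ∨ a = 4) : IsDoubleSolidPair 1 ![3] ![a]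
  | projOneTwo (b : ℕ) (hb : b = 1 ∨ b = 2) : IsDoubleSolidPair 2 ![1, 2] ![1, b]
  | projOneOneOne : IsDoubleSolidPair 3 ![1, 1, 1] ![1, 1, 1]

end

/-! A section of `𝓛 ⊠ 𝒪(2)` is a binary quadratic form `A x² + B x y + C y²` with `A, B, C` in
`H⁰(𝓛)`. The equations `w y = 2 A x + B y` and `w x = -(B x + 2 C y)` send its zero locus `Y ⊂ Z ×
ℙ¹` onto the double cover `w² = B² - 4 A C` of `Z`. This map is bijective except over the nodes `A =
B = C = 0`, where a whole `ℙ¹` is contracted to a point. For general `s` the three divisors meet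
transversally, so `A, B, C` are local coordinates at each node and `w² = B² - 4 A C` is an ordinary
double point there. Smoothness of `Y` forces the discriminant divisor to be smooth at its other
points (`eq_zero_of_fderiv_discr`). The nodes are finite in number because `Z` is compact, and there
is at least one because three divisors of positive multidegree on a threefold meet
(`exists_common_zero`).

Both the discriminant and `t` are sections of `𝓛²`, so the nodal double cover can be deformed to
`X`. Since `t` may vanish at a node, a straight path could have a singular total space. The path
used is quadratic: it starts in the direction of an auxiliary section `R` that vanishes at no node,
and reaches `t` at parameter `1`. Singular sections occur at finitely many parameters, and the path
is composed with a holomorphic map from the disk that meets these at most at the centre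
(`exists_disk_avoiding`, `exists_smoothingFamily`). On the total space `w² = B² - 4 A C + ζ K` with
`K ≠ 0` at the nodes, `(A, B, C, w)` are coordinates near a node, and `ζ` is a nondegenerate
quadratic form in them divided by a unit (`SmoothingFamily.isOrdinaryDoublePt`). The total space
embeds in the disk times a projective cone over the Segre-Veronese variety, and flatness is
torsion-freeness over a valuation ring (`isFlatHol_of_finite`).

Genericity has two ingredients. Having no common zero is a Zariski open condition
(`exists_elimination_polynomial`), and one smooth member exists because the singular ones have
smaller Hausdorff dimension (`exists_smooth_divisor`). Transversality of `A = B = C = 0` is the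
smoothness of `λ A + μ B + ν C = 0` in `Z × ℙ²`, so the same two results cover it. Of the list of
pairs only `∑ i, n i = 3` and `1 ≤ d i` matter. -/

noncomputable section

/-! ### Multihomogeneous polynomials -/

section MultiHomogeneous

open MvPolynomial

variable {σ B : Type*} [DecidableEq B]

/-- The multidegree of variables that are grouped into blocks by `β`. -/
def blockWeight (β : σ → B) (k : σ) : B → ℕ := Pi.single (β k) 1

/-- The point `v` has a nonvanishing coordinate in every block. -/
def BlockNonzero (β : σ → B) (v : σ → ℂ) : Prop := ∀ b, ∃ k, β k = b ∧ v k ≠ 0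

lemma weight_blockWeight_apply [Fintype σ] (β : σ → B) (c : σ →₀ ℕ) (b : B) :
    Finsupp.weight (blockWeight β) c b = ∑ k with β k = b, c k := by
  rw [Finsupp.weight_apply, Finsupp.sum_fintype _ _ (by simp), Finset.sum_apply, Finset.sum_filter]
  refine Finset.sum_congr rfl fun k _ => ?_
  by_cases h : β k = b
  · subst h; simp [blockWeight]
  · simp [blockWeight, h, Ne.symm h]

lemma exponent_le_of_weight [Fintype σ] (β : σ → B) {c : σ →₀ ℕ} {D : B → ℕ}
    (hc : Finsupp.weight (blockWeight β) c = D) (k : σ) : c k ≤ D (β k) := by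
  rw [← hc, weight_blockWeight_apply]
  exact Finset.single_le_sum (f := fun k => c k) (fun _ _ => Nat.zero_le _) (by simp)

lemma finite_exponents [Fintype σ] (β : σ → B) (D : B → ℕ) :
    {c : σ →₀ ℕ | Finsupp.weight (blockWeight β) c = D}.Finite := by
  classical
  refine (Set.finite_Icc 0 (Finsupp.equivFunOnFinite.symm fun k => D (β k))).subset fun c hc => ?_
  exact ⟨zero_le, fun k => exponent_le_of_weight β hc k⟩

/-- The exponents of the monomials of multidegree `D`. -/
abbrev Exponents (β : σ → B) (D : B → ℕ) : Type _ :=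
  {c : σ →₀ ℕ // Finsupp.weight (blockWeight β) c = D}

instance [Fintype σ] (β : σ → B) (D : B → ℕ) : Finite (Exponents β D) :=
  finite_exponents β D

instance [Fintype σ] (β : σ → B) (D : B → ℕ) : Fintype (Exponents β D) :=
  Fintype.ofFinite _

/-- The exponent `∑ b, D b • J b` of the monomial `∏ b, X_(J b) ^ D b`. -/
def cornerExponent [Fintype B] (J : B → σ) (D : B → ℕ) : σ →₀ ℕ := ∑ b, Finsupp.single (J b) (D b)

lemma weight_cornerExponent [Fintype B] {β : σ → B} {J : B → σ} (hJ : ∀ b, β (J b) = b)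
    (D : B → ℕ) : Finsupp.weight (blockWeight β) (cornerExponent J D) = D := by
  simp only [cornerExponent, map_sum, Finsupp.weight_single, blockWeight, hJ]
  ext b
  simp [Finset.sum_apply, Pi.single_apply]

omit [DecidableEq B] in
lemma monomial_cornerExponent [Fintype B] (J : B → σ) (D : B → ℕ) :
    monomial (cornerExponent J D) (1 : ℂ) = ∏ b, X (J b) ^ D b := by
  rw [cornerExponent, monomial_sum_one]
  exact Finset.prod_congr rfl fun b _ => (X_pow_eq_monomial).symm

lemma eval_smul_of_multihomogeneous [Fintype σ] [Fintype B] {β : σ → B} {D : B → ℕ}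
    {t : MvPolynomial σ ℂ} (ht : IsWeightedHomogeneous (blockWeight β) t D) (a : B → ℂ)
    (v : σ → ℂ) : eval (fun k => a (β k) * v k) t = (∏ b, a b ^ D b) * eval v t := by
  rw [eval_eq', eval_eq', Finset.mul_sum]
  refine Finset.sum_congr rfl fun c hc => ?_
  have h := ht (mem_support_iff.1 hc)
  have : ∏ k, (a (β k) * v k) ^ c k = (∏ b, a b ^ D b) * ∏ k, v k ^ c k := by
    simp only [mul_pow, Finset.prod_mul_distrib]
    congr 1
    rw [← Finset.prod_fiberwise (s := Finset.univ) (g := β)]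
    refine Finset.prod_congr rfl fun b _ => ?_
    rw [← h, weight_blockWeight_apply, ← Finset.prod_pow_eq_pow_sum]
    refine Finset.prod_congr rfl fun k hk => ?_
    rw [(Finset.mem_filter.1 hk).2]
  rw [this]; ring

/-- Evaluation at a point of the polynomial `G` in the linear coordinates of `W`. -/
abbrev evalDual {W : Type*} [AddCommGroup W] [Module ℂ W]
    (G : MvPolynomial (Module.Dual ℂ W) ℂ) (w : W) : ℂ :=
  eval (fun φ : Module.Dual ℂ W => φ w) G

/-- Polynomials on a vector space restrict to polynomials on quadratic curves. -/
lemma exists_polynomial_curve {W : Type*} [AddCommGroup W] [Module ℂ W]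
    (G : MvPolynomial (Module.Dual ℂ W) ℂ) (w₀ w₁ w₂ : W) :
    ∃ P : Polynomial ℂ, ∀ x : ℂ, P.eval x = evalDual G (w₀ + x • w₁ + x ^ 2 • w₂) := by
  refine ⟨aeval (fun φ : Module.Dual ℂ W => Polynomial.C (φ w₀) + Polynomial.X * Polynomial.C (φ w₁)
    + Polynomial.X ^ 2 * Polynomial.C (φ w₂)) G, fun x => ?_⟩
  rw [← Polynomial.coe_aeval_eq_eval, MvPolynomial.comp_aeval_apply]
  simp only [MvPolynomial.aeval_eq_eval, map_add, map_mul, map_pow, Polynomial.aeval_X,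
    Polynomial.aeval_C, evalDual, map_smul, smul_eq_mul, Algebra.algebraMap_self, RingHom.id_apply]

/-- A monomial of high multidegree belongs to every ideal whose zeros have a vanishing block. -/
lemma exists_monomial_mem [Fintype σ] [Fintype B] (β : σ → B) (I : Ideal (MvPolynomial σ ℂ))
    (hI : ∀ v, BlockNonzero β v → ∃ f ∈ I, eval v f ≠ 0) :
    ∃ N : B → ℕ, ∀ c : σ →₀ ℕ, Finsupp.weight (blockWeight β) c = N → monomial c (1 : ℂ) ∈ I := by
  classical
  -- Nullstellensatz: a zero of `I` vanishes on some block, hence so does the product of one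
  -- variable per block. A power of every such product lies in `I`.
  have hrad : ∀ J : {J : B → σ // ∀ b, β (J b) = b}, ∃ p : ℕ, (∏ b, X (J.1 b)) ^ p ∈ I := by
    intro J
    change ∏ b, X (J.1 b) ∈ I.radical
    rw [← vanishingIdeal_zeroLocus_eq_radical (K := ℂ), mem_vanishingIdeal_iff]
    intro v hv
    have hb : ¬ BlockNonzero β v := fun h => by
      obtain ⟨f, hf, hne⟩ := hI v h
      exact hne (by simpa [aeval_eq_eval] using hv f hf)
    unfold BlockNonzero at hb
    push Not at hb
    obtain ⟨b, hb⟩ := hb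
    rw [map_prod]
    exact Finset.prod_eq_zero (Finset.mem_univ b) (by simpa using hb _ (J.2 b))
  choose p hp using hrad
  set q := ∑ J, p J with hq
  -- Pigeonhole: in a block of degree greater than `card σ * q`, some variable has exponent at least
  -- `q`, and `q` dominates every `p J`.
  refine ⟨fun _ => Fintype.card σ * q + 1, fun c hc => ?_⟩
  have hex : ∀ b, ∃ k, β k = b ∧ q ≤ c k := by
    intro b
    by_contra! h
    have h1 := congrFun hc b
    rw [weight_blockWeight_apply] at h1
    have h2 : ∑ k with β k = b, c k ≤ ∑ k : σ, q := by
      refine (Finset.sum_le_sum fun k hk => (h k (Finset.mem_filter.1 hk).2).le).trans ?_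
      exact Finset.sum_le_sum_of_subset (Finset.subset_univ _)
    simp at h2
    omega
  choose J hJ hJq using hex
  have hle : p ⟨J, hJ⟩ ≤ q := Finset.single_le_sum (f := p) (fun _ _ => Nat.zero_le _)
    (Finset.mem_univ _)
  have hc' : cornerExponent J (fun _ => q) ≤ c := by
    intro k
    rw [cornerExponent, Finsupp.finsetSum_apply]
    by_cases hk : J (β k) = k
    · rw [Finset.sum_eq_single (β k)]
      · rw [hk, Finsupp.single_eq_same]
        have := hJq (β k)
        rwa [hk] at this
      · intro b _ hb
        refine Finsupp.single_eq_of_ne fun h => hb ?_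
        rw [h, hJ]
      · simp
    · rw [Finset.sum_eq_zero]
      · exact Nat.zero_le _
      · intro b _
        refine Finsupp.single_eq_of_ne fun h => hk ?_
        rw [h, hJ]
  have hmul : monomial c (1 : ℂ) =
      monomial (c - cornerExponent J (fun _ => q)) 1 * (∏ b, X (J b)) ^ q := by
    rw [← Finset.prod_pow, ← monomial_cornerExponent J (fun _ => q), monomial_mul, one_mul,
      tsub_add_cancel_of_le hc']
  rw [hmul]
  exact Ideal.mul_mem_left _ _ (Ideal.pow_mem_of_pow_mem _ (hp ⟨J, hJ⟩) hle)

/-- Elimination: having no common zero is a Zariski open condition on a family of multihomogeneous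
polynomials that depend linearly on parameters. -/
theorem exists_elimination_polynomial [Fintype σ] [Fintype B] (β : σ → B) {W κ : Type*}
    [AddCommGroup W] [Module ℂ W] [Fintype κ] (L : κ → W →ₗ[ℂ] MvPolynomial σ ℂ) (e : κ → B → ℕ)
    (hL : ∀ k w, IsWeightedHomogeneous (blockWeight β) (L k w) (e k)) (w₀ : W)
    (h₀ : ∀ v, BlockNonzero β v → ∃ k, eval v (L k w₀) ≠ 0) :
    ∃ G : MvPolynomial (Module.Dual ℂ W) ℂ, evalDual G w₀ ≠ 0 ∧
      ∀ w, evalDual G w ≠ 0 → ∀ v, BlockNonzero β v → ∃ k, eval v (L k w) ≠ 0 := by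
  classical
  let _ : GradedAlgebra (weightedHomogeneousSubmodule ℂ (blockWeight β)) :=
    weightedGradedAlgebra ℂ (blockWeight β)
  let I : W → Ideal (MvPolynomial σ ℂ) := fun w => Ideal.span (Set.range fun k => L k w)
  have hmem : ∀ w k, L k w ∈ I w := fun w k => Ideal.subset_span ⟨k, rfl⟩
  obtain ⟨N, hN⟩ := exists_monomial_mem β (I w₀) fun v hv => by
    obtain ⟨k, hk⟩ := h₀ v hv
    exact ⟨_, hmem w₀ k, hk⟩
  have hrep : ∀ c : Exponents β N, ∃ a : κ → MvPolynomial σ ℂ,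
      ∑ k, a k * L k w₀ = monomial c.1 1 := fun c =>
    (Ideal.mem_span_range_iff_exists_fun).1 (hN c.1 c.2)
  choose a ha using hrep
  -- The multipliers `a` are frozen at `w₀`. The resulting square matrix of coefficients is linear
  -- in `w` and is the identity at `w₀`, so its determinant is the polynomial sought.
  let φ : Exponents β N → Exponents β N → Module.Dual ℂ W := fun c c' =>
    lcoeff ℂ c'.1 ∘ₗ ∑ k, LinearMap.mulLeft ℂ (a c k) ∘ₗ L k
  have hφ : ∀ c c' w, φ c c' w = coeff c'.1 (∑ k, a c k * L k w) := fun c c' w => by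
    simp [φ, coeff_sum]
  refine ⟨(Matrix.of fun c c' => X (φ c c')).det, ?_, fun w hw v hv => ?_⟩
  · have : (Matrix.of fun c c' => φ c c' w₀) = (1 : Matrix (Exponents β N) (Exponents β N) ℂ) := by
      ext c c'
      simp [hφ, ha, coeff_monomial, Matrix.one_apply, Subtype.ext_iff]
    rw [evalDual, RingHom.map_det]
    have h2 : (eval fun ψ : Module.Dual ℂ W => ψ w₀).mapMatrix (Matrix.of fun c c' => X (φ c c')) =
        Matrix.of fun c c' => φ c c' w₀ := by ext; simp
    rw [h2, this, Matrix.det_one]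
    exact one_ne_zero
  · by_contra! hzero
    choose J hJ hvJ using hv
    let M : Matrix (Exponents β N) (Exponents β N) ℂ := Matrix.of fun c c' => φ c c' w
    have hdet : IsUnit M.det := by
      rw [evalDual, RingHom.map_det] at hw
      refine isUnit_iff_ne_zero.2 ?_
      convert hw using 2
      ext; simp [M]
    -- For an invertible matrix some combination of its rows is the unit vector of `c₀`, the
    -- monomial in the coordinates `J b` that do not vanish at `v`. That monomial then lies in `I
    -- w`, so it cannot vanish at `v` unless some generator is nonzero there.
    let c₀ : Exponents β N := ⟨cornerExponent J N, weight_cornerExponent hJ N⟩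
    let x : Exponents β N → ℂ := Matrix.vecMul (Pi.single c₀ 1) M⁻¹
    have hx : Matrix.vecMul x M = Pi.single c₀ 1 := by
      rw [Matrix.vecMul_vecMul, Matrix.nonsing_inv_mul _ hdet, Matrix.vecMul_one]
    let Q : MvPolynomial σ ℂ := ∑ c, C (x c) * ∑ k, a c k * L k w
    have hQ : Q ∈ I w := Ideal.sum_mem _ fun c _ => Ideal.mul_mem_left _ _ <|
      Ideal.sum_mem _ fun k _ => Ideal.mul_mem_left _ _ (hmem w k)
    -- The `a c k` need not be homogeneous, so `Q` can have terms of other multidegrees. Only its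
    -- component of degree `N` is controlled, and homogeneity of `I w` puts that component in the
    -- ideal.
    have hcomp : weightedHomogeneousComponent (blockWeight β) N Q = monomial c₀.1 1 := by
      ext c
      rw [coeff_weightedHomogeneousComponent, coeff_monomial]
      split_ifs with h1 h2 h2
      · have := congrFun hx ⟨c, h1⟩
        rw [Pi.single_apply, if_pos (Subtype.ext h2.symm)] at this
        rw [← this]
        simp only [Q, coeff_sum, coeff_C_mul, Matrix.vecMul, dotProduct, M, Matrix.of_apply, hφ]
      · have := congrFun hx ⟨c, h1⟩
        rw [Pi.single_apply, if_neg (fun h => h2 (congrArg Subtype.val h).symm)] at this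
        rw [← this]
        simp only [Q, coeff_sum, coeff_C_mul, Matrix.vecMul, dotProduct, M, Matrix.of_apply, hφ]
      · exact absurd (h2 ▸ c₀.2) h1
      · rfl
    have hhom : (I w).IsHomogeneous (weightedHomogeneousSubmodule ℂ (blockWeight β)) := by
      refine Ideal.homogeneous_span _ _ ?_
      rintro _ ⟨k, rfl⟩
      exact ⟨e k, hL k w⟩
    have hm : monomial c₀.1 (1 : ℂ) ∈ I w := by
      rw [← hcomp]
      exact weightedHomogeneousComponent_mem_of_mem ℂ _ hhom hQ N
    have hle : I w ≤ RingHom.ker (eval v) := by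
      refine Ideal.span_le.2 ?_
      rintro _ ⟨k, rfl⟩
      exact hzero k
    have := hle hm
    rw [RingHom.mem_ker, monomial_cornerExponent, map_prod] at this
    obtain ⟨b, -, hb⟩ := Finset.prod_eq_zero_iff.1 this
    rw [map_pow, eval_X] at hb
    exact hvJ b (eq_zero_of_pow_eq_zero hb)

end MultiHomogeneous

/-! ### Generic smoothness of divisors -/

section Bertini

open MvPolynomial

variable {σ B : Type*} [DecidableEq B]

lemma contDiff_eval {E : Type*} [NormedAddCommGroup E] [NormedSpace ℂ E] [Fintype σ]
    {v : E → σ → ℂ} (hv : ∀ k, ContDiff ℂ ω fun u => v u k) (p : MvPolynomial σ ℂ) :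
    ContDiff ℂ ω fun u => eval (v u) p := by
  simp only [eval_eq']
  exact ContDiff.sum fun c _ => contDiff_const.mul (contDiff_prod fun k _ => (hv k).pow _)

/-- The subtraction of multidegrees is truncated. This is harmless: if the block of `k` has degree
`0`, the variable `k` does not occur and the derivative is `0`, homogeneous of every degree. -/
lemma isWeightedHomogeneous_pderiv [Fintype σ] {β : σ → B} {D : B → ℕ}
    {t : MvPolynomial σ ℂ} (ht : IsWeightedHomogeneous (blockWeight β) t D) (k : σ) :
    IsWeightedHomogeneous (blockWeight β) (pderiv k t) (D - blockWeight β k) := by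
  by_cases hk : D (β k) = 0
  · have : pderiv k t = 0 := by
      refine pderiv_eq_zero_of_notMem_vars fun hmem => ?_
      obtain ⟨c, hc, hkc⟩ := (mem_vars_iff_mem_support k).1 hmem
      have := exponent_le_of_weight β (ht (mem_support_iff.1 hc)) k
      exact (Finsupp.mem_support_iff.1 hkc) (by omega)
    rw [this]
    exact isWeightedHomogeneous_zero _ _ _
  · refine ht.pderiv ?_
    ext b
    by_cases hb : b = β k
    · subst hb; simp [blockWeight]; omega
    · simp [blockWeight, hb]

/-- Euler's identity for one block of variables. -/
lemma sum_block_mul_pderiv [Fintype σ] {β : σ → B} {D : B → ℕ}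
    {t : MvPolynomial σ ℂ} (ht : IsWeightedHomogeneous (blockWeight β) t D) (b : B) (v : σ → ℂ) :
    ∑ k with β k = b, v k * eval v (pderiv k t) = D b * eval v t := by
  have h : IsWeightedHomogeneous (fun k => if β k = b then 1 else 0) t (D b) := by
    intro c hc
    rw [← ht hc, weight_blockWeight_apply, Finsupp.weight_apply, Finsupp.sum_fintype _ _ (by simp),
      Finset.sum_filter]
    simp
  have := congrArg (eval v) h.sum_weight_X_mul_pderiv
  simp only [map_sum, nsmul_eq_mul, map_mul, map_natCast, eval_X] at this
  rw [← this, Finset.sum_filter]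
  refine Finset.sum_congr rfl fun k _ => ?_
  split_ifs <;> simp

/-- The indices of the affine coordinates on the chart where the variables `J b` are nonzero. -/
abbrev AffineIndex (β : σ → B) (J : B → σ) : Type _ := {k // J (β k) ≠ k}

instance [Finite σ] (β : σ → B) (J : B → σ) : Fintype (AffineIndex β J) := Fintype.ofFinite _

open Classical in
/-- The point with affine coordinates `u`. -/
def cornerPoint (β : σ → B) (J : B → σ) (u : AffineIndex β J → ℂ) (k : σ) : ℂ :=
  if h : J (β k) = k then 1 else u ⟨k, h⟩

omit [DecidableEq B] in
lemma contDiff_cornerPoint [Fintype σ] (β : σ → B) (J : B → σ) (k : σ) :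
    ContDiff ℂ ω fun u => cornerPoint β J u k := by
  unfold cornerPoint
  split_ifs
  · exact contDiff_const
  · exact contDiff_apply _ _ _

omit [DecidableEq B] in
lemma BlockNonzero.exists_normalization {β : σ → B} {v : σ → ℂ} (hv : BlockNonzero β v) :
    ∃ (J : B → σ) (a : B → ℂ) (u : AffineIndex β J → ℂ), (∀ b, β (J b) = b) ∧ (∀ b, a b ≠ 0) ∧
      v = fun k => a (β k) * cornerPoint β J u k := by
  choose J hJ hvJ using hv
  refine ⟨J, fun b => v (J b), fun k => v k.1 / v (J (β k.1)), hJ, hvJ, ?_⟩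
  ext k
  unfold cornerPoint
  split_ifs with h
  · simp [h]
  · exact (mul_div_cancel₀ _ (hvJ _)).symm

/-- The exponents of the monomials that restrict to `1` (for `none`) and to the affine
coordinates. -/
def linearExponent [Fintype B] (β : σ → B) (J : B → σ) (D : B → ℕ) :
    Option (AffineIndex β J) → σ →₀ ℕ
  | none => cornerExponent J D
  | some k => cornerExponent J (D - blockWeight β k.1) + Finsupp.single k.1 1

lemma weight_linearExponent [Fintype B] {β : σ → B} {J : B → σ} (hJ : ∀ b, β (J b) = b)
    {D : B → ℕ} (hD : ∀ b, 1 ≤ D b) (k : Option (AffineIndex β J)) :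
    Finsupp.weight (blockWeight β) (linearExponent β J D k) = D := by
  cases k with
  | none => exact weight_cornerExponent hJ D
  | some k =>
    rw [linearExponent, map_add, weight_cornerExponent hJ, Finsupp.weight_single, one_smul]
    ext b
    have := hD b
    by_cases hb : b = β k.1
    · subst hb; simp [blockWeight]; omega
    · simp [blockWeight, hb]

omit [DecidableEq B] in
lemma cornerExponent_apply_of_affineIndex [Fintype B] {β : σ → B} {J : B → σ}
    (hJ : ∀ b, β (J b) = b) (D : B → ℕ) (k : AffineIndex β J) : cornerExponent J D k.1 = 0 := by
  rw [cornerExponent, Finsupp.finsetSum_apply]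
  refine Finset.sum_eq_zero fun b _ => Finsupp.single_eq_of_ne fun h => k.2 ?_
  rw [h, hJ]

lemma linearExponent_some_apply [Fintype B] {β : σ → B} {J : B → σ}
    (hJ : ∀ b, β (J b) = b) (D : B → ℕ) (k l : AffineIndex β J) [Decidable (l = k)] :
    linearExponent β J D (some k) l.1 = if l = k then 1 else 0 := by
  rw [linearExponent, Finsupp.add_apply, cornerExponent_apply_of_affineIndex hJ, zero_add]
  split_ifs with h
  · simp [h]
  · exact Finsupp.single_eq_of_ne fun h' => h (Subtype.ext h')

lemma linearExponent_injective [Fintype B] {β : σ → B} {J : B → σ}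
    (hJ : ∀ b, β (J b) = b) (D : B → ℕ) : Function.Injective (linearExponent β J D) := by
  classical
  rintro (_ | k) (_ | l) h
  · rfl
  · have := DFunLike.congr_fun h l.1
    rw [linearExponent_some_apply hJ] at this
    simp [linearExponent, cornerExponent_apply_of_affineIndex hJ] at this
  · have := DFunLike.congr_fun h k.1
    rw [linearExponent_some_apply hJ] at this
    simp [linearExponent, cornerExponent_apply_of_affineIndex hJ] at this
  · have := DFunLike.congr_fun h k.1
    rw [linearExponent_some_apply hJ, linearExponent_some_apply hJ] at this
    by_contra hne
    have hkl : k ≠ l := fun h => hne (by rw [h])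
    simp [hkl] at this

omit [DecidableEq B] in
lemma eval_cornerPoint_corner [Fintype B] {β : σ → B} {J : B → σ} (hJ : ∀ b, β (J b) = b)
    (D : B → ℕ) (u : AffineIndex β J → ℂ) :
    eval (cornerPoint β J u) (monomial (cornerExponent J D) 1) = 1 := by
  rw [monomial_cornerExponent, map_prod]
  refine Finset.prod_eq_one fun b _ => ?_
  simp [cornerPoint, hJ]

lemma eval_cornerPoint_linear [Fintype B] {β : σ → B} {J : B → σ} (hJ : ∀ b, β (J b) = b)
    (D : B → ℕ) (u : AffineIndex β J → ℂ) (k : AffineIndex β J) :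
    eval (cornerPoint β J u) (monomial (linearExponent β J D (some k)) 1) = u k := by
  rw [linearExponent, ← one_mul (1 : ℂ), ← monomial_mul, map_mul, eval_cornerPoint_corner hJ]
  simp [cornerPoint, eval_monomial, k.2]

/-- With the two evaluations above, this makes the 1-jets of the monomials `linearExponent` a
triangular system at every point of the chart. The equations of a singular point can therefore be
solved for the coefficients of these monomials. -/
lemma eval_cornerPoint_pderiv [Fintype B] {β : σ → B} {J : B → σ} (hJ : ∀ b, β (J b) = b)
    (D : B → ℕ) (u : AffineIndex β J → ℂ) (k : Option (AffineIndex β J)) (l : AffineIndex β J)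
    [Decidable (some l = k)] :
    eval (cornerPoint β J u) (pderiv l.1 (monomial (linearExponent β J D k) 1)) =
      if some l = k then 1 else 0 := by
  classical
  rw [pderiv_monomial]
  cases k with
  | none =>
    rw [linearExponent, cornerExponent_apply_of_affineIndex hJ]
    simp
  | some k =>
    rw [linearExponent_some_apply hJ]
    by_cases h : l = k
    · subst h
      simp only [if_true, Nat.cast_one, mul_one, linearExponent, add_tsub_cancel_right]
      exact eval_cornerPoint_corner hJ _ u
    · simp [h]

/-- The polynomial with given coefficients. -/
def polyOfCoeff [Fintype σ] (β : σ → B) (D : B → ℕ) (x : Exponents β D → ℂ) : MvPolynomial σ ℂ :=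
  ∑ c, C (x c) * monomial c.1 1

lemma isWeightedHomogeneous_polyOfCoeff [Fintype σ] (β : σ → B) (D : B → ℕ)
    (x : Exponents β D → ℂ) : IsWeightedHomogeneous (blockWeight β) (polyOfCoeff β D x) D :=
  IsWeightedHomogeneous.sum _ _ _ fun c _ =>
    (isWeightedHomogeneous_monomial _ _ _ c.2).C_mul _

lemma eval_polyOfCoeff [Fintype σ] (β : σ → B) (D : B → ℕ) (x : Exponents β D → ℂ) (v : σ → ℂ) :
    eval v (polyOfCoeff β D x) = ∑ c, x c * eval v (monomial c.1 1) := by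
  simp [polyOfCoeff]

lemma eval_pderiv_polyOfCoeff [Fintype σ] (β : σ → B) (D : B → ℕ) (x : Exponents β D → ℂ)
    (v : σ → ℂ) (k : σ) :
    eval v (pderiv k (polyOfCoeff β D x)) = ∑ c, x c * eval v (pderiv k (monomial c.1 1)) := by
  simp only [polyOfCoeff, map_sum, pderiv_C_mul, map_mul, eval_C]

lemma finrank_real_pi_complex (ι : Type*) [Fintype ι] :
    Module.finrank ℝ (ι → ℂ) = 2 * Fintype.card ι := by
  rw [finrank_real_of_complex, Module.finrank_fintype_fun_eq_card]

/-- The vectors that are annihilated by some member of a smooth family of jets form a set of smaller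
Hausdorff dimension. -/
lemma dimH_annihilated_le {K N : Type*} [Fintype K] [Fintype N] [DecidableEq K]
    (jet : (K → ℂ) → Option K → N → ℂ) (hjet : ∀ k c, ContDiff ℂ ω fun u => jet u k c)
    (ρ : Option K → N) (hρ : Function.Injective ρ) (h₀₀ : ∀ u, jet u none (ρ none) = 1)
    (h₀ : ∀ u k, jet u none (ρ (some k)) = u k)
    (h₁ : ∀ u k l, jet u (some k) (ρ l) = if some k = l then 1 else 0) :
    dimH {x : N → ℂ | ∃ u, ∀ k, ∑ c, x c * jet u k c = 0} ≤
      ((2 * (Fintype.card N - 1) : ℕ) : ENNReal) := by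
  classical
  let R := {c : N // c ∉ Set.range ρ}
  let g : (K → ℂ) × (R → ℂ) → Option K → ℂ := fun p k => -∑ c : R, p.2 c * jet p.1 k c.1
  have hg : ∀ k, ContDiff ℂ ω fun p => g p k := by
    intro k
    refine ContDiff.neg (ContDiff.sum fun c _ => ContDiff.mul ?_ ?_)
    · exact (contDiff_apply ℂ ℂ c).comp contDiff_snd
    · exact (hjet k c.1).comp contDiff_fst
  -- Parametrisation of the annihilated vectors by the point `u` and the coefficients outside the
  -- range of `ρ`. The derivative equations give the coefficients at `ρ (some k)`, and the value
  -- equation then gives the one at `ρ none`.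
  let f : (K → ℂ) × (R → ℂ) → N → ℂ := fun p c =>
    (if h : c ∉ Set.range ρ then p.2 ⟨c, h⟩ else 0) +
      ∑ k : K, g p (some k) * (if c = ρ (some k) then 1 else 0) +
      (g p none - ∑ k : K, p.1 k * g p (some k)) * (if c = ρ none then 1 else 0)
  have hf : ContDiff ℂ ω f := by
    refine contDiff_pi.2 fun c => ?_
    refine ContDiff.add (ContDiff.add ?_ ?_) ?_
    · by_cases h : c ∉ Set.range ρ
      · simp only [dif_pos h]
        exact (contDiff_apply ℂ ℂ (⟨c, h⟩ : R)).comp contDiff_snd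
      · simp only [dif_neg h]
        exact contDiff_const
    · exact ContDiff.sum fun k _ => (hg _).mul contDiff_const
    · refine ContDiff.mul ((hg _).sub (ContDiff.sum fun k _ => ContDiff.mul ?_ (hg _)))
        contDiff_const
      exact (contDiff_apply ℂ ℂ k).comp contDiff_fst
  have hf1 : ContDiff ℝ 1 f := (hf.restrict_scalars ℝ).of_le le_top
  have hsub : {x : N → ℂ | ∃ u, ∀ k, ∑ c, x c * jet u k c = 0} ⊆ Set.range f := by
    rintro x ⟨u, h⟩
    have hsplit : ∀ F : N → ℂ,
        ∑ c, F c = ∑ c : R, F c.1 + (F (ρ none) + ∑ k, F (ρ (some k))) := by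
      intro F
      rw [← Fintype.sum_option (f := fun k => F (ρ k)),
        ← Finset.sum_image (f := F) (s := Finset.univ) (g := ρ) (fun _ _ _ _ h => hρ h),
        ← Finset.sum_subtype (s := (Finset.univ.image ρ)ᶜ) (f := F) (by intro c; simp)]
      rw [Finset.sum_compl_add_sum]
    have e1 : ∀ k, x (ρ (some k)) = g (u, fun c => x c.1) (some k) := by
      intro k
      have := h (some k)
      rw [hsplit] at this
      simp only [h₁, mul_ite, mul_one, mul_zero, Option.some.injEq,
        reduceCtorEq, if_false, Finset.sum_ite_eq, Finset.mem_univ, if_true, zero_add] at this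
      exact eq_neg_of_add_eq_zero_right this
    have e0 : x (ρ none) = g (u, fun c => x c.1) none -
        ∑ k, u k * g (u, fun c => x c.1) (some k) := by
      have h0 := h none
      rw [hsplit] at h0
      simp only [h₀, h₀₀, mul_one] at h0
      have e1' : ∀ k, u k * g (u, fun c => x c.1) (some k) = x (ρ (some k)) * u k := fun k => by
        rw [e1, mul_comm]
      simp only [e1']
      rw [eq_sub_iff_add_eq]
      exact eq_neg_of_add_eq_zero_right h0
    refine ⟨(u, fun c => x c.1), ?_⟩
    ext c
    simp only [f]
    by_cases hc : c ∈ Set.range ρ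
    · obtain ⟨k, rfl⟩ := hc
      rw [dif_neg (by simp), zero_add]
      cases k with
      | none =>
        simp only [hρ.eq_iff, reduceCtorEq, if_false, mul_zero, Finset.sum_const_zero, zero_add,
          if_true, mul_one]
        exact e0.symm
      | some k =>
        simp only [hρ.eq_iff, reduceCtorEq, if_false, mul_zero, add_zero, Option.some.injEq,
          mul_ite, mul_one, Finset.sum_ite_eq, Finset.mem_univ, if_true]
        exact (e1 k).symm
    · rw [dif_pos hc]
      have hne : ∀ k, c ≠ ρ k := fun k h => hc ⟨k, h.symm⟩
      simp [hne]
  -- A `C¹` map does not raise dimension. The source has complex dimension `|K| + (|N| - (|K| + 1))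
  -- = |N| - 1`: the `|K| + 1` conditions outnumber by one the parameters of the point.
  refine (dimH_mono hsub).trans (hf1.dimH_range_le.trans (Nat.cast_le.2 ?_))
  rw [Module.finrank_prod, finrank_real_pi_complex, finrank_real_pi_complex]
  have hR : Fintype.card R = Fintype.card N - Fintype.card (Option K) := by
    rw [Fintype.card_subtype_compl, ← Set.card_range_of_injective hρ]
  have hle := Fintype.card_le_of_injective ρ hρ
  rw [Fintype.card_option] at hR hle
  omega

/-- The divisors that are singular at a point of one affine chart form a set of smaller Hausdorff
dimension. -/
lemma dimH_singular_le [Fintype σ] [Fintype B] {β : σ → B} {J : B → σ} (hJ : ∀ b, β (J b) = b)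
    {D : B → ℕ} (hD : ∀ b, 1 ≤ D b) :
    dimH {x : Exponents β D → ℂ | ∃ u, eval (cornerPoint β J u) (polyOfCoeff β D x) = 0 ∧
      ∀ k : AffineIndex β J, eval (cornerPoint β J u) (pderiv k.1 (polyOfCoeff β D x)) = 0} ≤
      ((2 * (Fintype.card (Exponents β D) - 1) : ℕ) : ENNReal) := by
  classical
  let jet : (AffineIndex β J → ℂ) → Option (AffineIndex β J) → Exponents β D → ℂ := fun u k c =>
    k.elim (eval (cornerPoint β J u) (monomial c.1 1))
      (fun k => eval (cornerPoint β J u) (pderiv k.1 (monomial c.1 1)))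
  refine (dimH_mono ?_).trans (dimH_annihilated_le jet ?_
    (fun k => ⟨linearExponent β J D k, weight_linearExponent hJ hD k⟩)
    (fun k l h => linearExponent_injective hJ D (congrArg Subtype.val h))
    (fun u => eval_cornerPoint_corner hJ D u) (fun u k => eval_cornerPoint_linear hJ D u k)
    (fun u k l => eval_cornerPoint_pderiv hJ D u l k))
  · rintro x ⟨u, h0, h1⟩
    refine ⟨u, ?_⟩
    rintro (_ | k)
    · exact (eval_polyOfCoeff β D x _).symm.trans h0
    · exact (eval_pderiv_polyOfCoeff β D x _ _).symm.trans (h1 k)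
  · rintro (_ | k) c <;> exact contDiff_eval (contDiff_cornerPoint β J) _

/-- A general divisor of positive multidegree is smooth. -/
theorem exists_smooth_divisor [Fintype σ] [Fintype B] [Nonempty B] {β : σ → B}
    (hβ : Function.Surjective β) {D : B → ℕ} (hD : ∀ b, 1 ≤ D b) :
    ∃ t : MvPolynomial σ ℂ, IsWeightedHomogeneous (blockWeight β) t D ∧
      ∀ v, BlockNonzero β v → ∃ k, eval v (pderiv k t) ≠ 0 := by
  classical
  let S : {J : B → σ // ∀ b, β (J b) = b} → Set (Exponents β D → ℂ) := fun J =>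
    {x | ∃ u, eval (cornerPoint β J.1 u) (polyOfCoeff β D x) = 0 ∧
      ∀ k : AffineIndex β J.1, eval (cornerPoint β J.1 u) (pderiv k.1 (polyOfCoeff β D x)) = 0}
  -- Without a monomial, the truncated `card - 1` would not be strictly smaller than `card`.
  have hne : 0 < Fintype.card (Exponents β D) := by
    obtain ⟨J, hJ⟩ := hβ.hasRightInverse
    exact Fintype.card_pos_iff.2 ⟨⟨cornerExponent J D, weight_cornerExponent hJ D⟩⟩
  have hdim : dimH (⋃ J, S J) < Module.finrank ℝ (Exponents β D → ℂ) := by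
    rw [dimH_iUnion, finrank_real_pi_complex]
    refine (iSup_le fun J => dimH_singular_le J.2 hD).trans_lt (Nat.cast_lt.2 ?_)
    omega
  obtain ⟨x, hx⟩ := (dense_compl_of_dimH_lt_finrank hdim).nonempty
  have ht := isWeightedHomogeneous_polyOfCoeff β D x
  refine ⟨_, ht, fun v hv => ?_⟩
  by_contra! hzero
  obtain ⟨J, a, u, hJ, ha, rfl⟩ := hv.exists_normalization
  have hz : ∀ k, eval (cornerPoint β J u) (pderiv k (polyOfCoeff β D x)) = 0 := by
    intro k
    have := hzero k
    rw [eval_smul_of_multihomogeneous (isWeightedHomogeneous_pderiv ht k)] at this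
    exact (mul_eq_zero.1 this).resolve_left (Finset.prod_ne_zero_iff.2 fun b _ => pow_ne_zero _ (ha b))
  refine hx (Set.mem_iUnion.2 ⟨⟨J, hJ⟩, u, ?_, fun k => hz k.1⟩)
  -- Vanishing of the partial derivatives implies vanishing of the polynomial itself, by Euler's
  -- identity in any block and `D b ≠ 0` in `ℂ`.
  obtain ⟨b⟩ := ‹Nonempty B›
  have := sum_block_mul_pderiv ht b (cornerPoint β J u)
  simp only [hz, mul_zero, Finset.sum_const_zero] at this
  have hDb : (D b : ℂ) ≠ 0 := Nat.cast_ne_zero.2 (by have := hD b; omega)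
  exact (mul_eq_zero.1 this.symm).resolve_left hDb

/-- A small perturbation of the system of equations `u = 0` has a solution. -/
lemma eventually_exists_zero_perturbation {K : Type*} [Fintype K] {h : (K → ℂ) → K → ℂ}
    (hh : ContDiff ℂ ω h) : ∀ᶠ ε : ℂ in 𝓝 0, ∃ u : K → ℂ, u + ε • h u = 0 := by
  -- The parameter `ε` is carried along as a coordinate. The derivative of `Φ` at the origin is
  -- triangular, hence surjective, so the range of `Φ` is a neighbourhood of `(0, 0)` and contains
  -- `(ε, 0)` for small `ε`.
  let Φ : ℂ × (K → ℂ) → ℂ × (K → ℂ) := fun p => (p.1, p.2 + p.1 • h p.2)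
  have hΦ : ContDiff ℂ ω Φ := contDiff_fst.prodMk
    (contDiff_snd.add (contDiff_fst.smul (hh.comp contDiff_snd)))
  have hs : HasStrictFDerivAt Φ (fderiv ℂ Φ (0, 0)) (0, 0) :=
    hΦ.contDiffAt.hasStrictFDerivAt (by simp)
  have hd : HasFDerivAt Φ ((ContinuousLinearMap.fst ℂ ℂ (K → ℂ)).prod
      (ContinuousLinearMap.snd ℂ ℂ (K → ℂ) +
        ((0 : ℂ) • (fderiv ℂ h 0 ∘L ContinuousLinearMap.snd ℂ ℂ (K → ℂ)) +
          (ContinuousLinearMap.fst ℂ ℂ (K → ℂ)).smulRight (h 0)))) (0, 0) := by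
    have h1 : HasFDerivAt h (fderiv ℂ h 0) ((0, 0) : ℂ × (K → ℂ)).2 :=
      (hh.differentiable (by simp) 0).hasFDerivAt
    have h2 := h1.comp ((0, 0) : ℂ × (K → ℂ)) hasFDerivAt_snd
    have h3 := (hasFDerivAt_fst (𝕜 := ℂ) (p := ((0, 0) : ℂ × (K → ℂ)))).fun_smul h2
    exact hasFDerivAt_fst.prodMk (hasFDerivAt_snd.fun_add h3)
  have hsurj : (fderiv ℂ Φ (0, 0)).range = ⊤ := by
    rw [hd.fderiv, LinearMap.range_eq_top]
    rintro ⟨a, c⟩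
    exact ⟨(a, c - a • h 0), by simp⟩
  have hmap := hs.map_nhds_eq_of_surj hsurj
  have h0 : Φ (0, 0) = (0, 0) := by simp [Φ]
  have hmem : Set.range Φ ∈ 𝓝 (0, 0) := by
    rw [← h0, ← hmap]
    exact Filter.range_mem_map
  have hcont : Filter.Tendsto (fun ε : ℂ => ((ε, 0) : ℂ × (K → ℂ))) (𝓝 0) (𝓝 (0, 0)) :=
    (Continuous.prodMk_left (0 : K → ℂ)).tendsto' _ _ rfl
  filter_upwards [hcont hmem] with ε hε
  obtain ⟨⟨ε', u⟩, hu⟩ := hε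
  obtain ⟨h1, h2⟩ := Prod.ext_iff.1 hu
  exact ⟨u, by rw [← show ε' = ε from h1]; exact h2⟩

/-- As many divisors as the dimension have a common point. -/
theorem exists_common_zero [Fintype σ] [Fintype B] {β : σ → B} {J : B → σ}
    (hJ : ∀ b, β (J b) = b) {D : B → ℕ} (hD : ∀ b, 1 ≤ D b) (f : AffineIndex β J → MvPolynomial σ ℂ)
    (hf : ∀ k, IsWeightedHomogeneous (blockWeight β) (f k) D) :
    ∃ v, BlockNonzero β v ∧ ∀ k, eval v (f k) = 0 := by
  classical
  by_contra! hno
  let W := AffineIndex β J → weightedHomogeneousSubmodule ℂ (blockWeight β) D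
  let L : AffineIndex β J → W →ₗ[ℂ] MvPolynomial σ ℂ := fun k =>
    Submodule.subtype _ ∘ₗ LinearMap.proj k
  obtain ⟨G, hG₀, hG⟩ := exists_elimination_polynomial β L (fun _ => D) (fun k w => (w k).2)
    (fun k => ⟨f k, hf k⟩) hno
  -- `w₁` is a system whose equations on the chart are `u k = 0`. If `f` had no common zero, the
  -- elimination polynomial would be nonzero at `f`, the endpoint `1` of the line from `w₁` to `f`.
  -- Near the endpoint `0` the equations are a small perturbation of `u = 0` and have a zero, so the
  -- polynomial vanishes at infinitely many points of the line.
  let w₁ : W := fun k => ⟨monomial (linearExponent β J D (some k)) 1,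
    isWeightedHomogeneous_monomial _ _ _ (weight_linearExponent hJ hD _)⟩
  obtain ⟨P, hP⟩ := exists_polynomial_curve G w₁ ((fun k => ⟨f k, hf k⟩ : W) - w₁) 0
  have hP1 : P.eval 1 ≠ 0 := by
    rw [hP]
    simpa using hG₀
  refine hP1 ?_
  suffices hzero : P = 0 by rw [hzero, Polynomial.eval_zero]
  refine Polynomial.eq_zero_of_infinite_isRoot _ (infinite_of_mem_nhds (0 : ℂ) ?_)
  have hsmooth : ContDiff ℂ ω fun (u : AffineIndex β J → ℂ) k =>
      eval (cornerPoint β J u) (f k) - u k := contDiff_pi.2 fun k =>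
    (contDiff_eval (contDiff_cornerPoint β J) _).sub (contDiff_apply _ _ _)
  filter_upwards [eventually_exists_zero_perturbation hsmooth] with ε hε
  obtain ⟨u, hu⟩ := hε
  rw [Polynomial.IsRoot, hP]
  by_contra hne
  obtain ⟨k, hk⟩ := hG _ hne (cornerPoint β J u) fun b => ⟨J b, hJ b, by simp [cornerPoint, hJ]⟩
  have := congrFun hu k
  simp only [Pi.add_apply, Pi.smul_apply, smul_eq_mul, Pi.zero_apply] at this
  refine hk ?_
  have hLk : L k (w₁ + ε • ((fun k => ⟨f k, hf k⟩ : W) - w₁) + ε ^ 2 • (0 : W)) =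
      monomial (linearExponent β J D (some k)) 1 +
        ε • (f k - monomial (linearExponent β J D (some k)) 1) + ε ^ 2 • 0 := rfl
  rw [hLk, ← this]
  simp [eval_cornerPoint_linear hJ]

end Bertini

/-! ### Smooth hypersurfaces of complex manifolds -/

section Hypersurface

/-- A nonzero functional on an `(m + 1)`-dimensional space is the first coordinate of a linear
isomorphism with `ℂ × ℂᵐ`. -/
lemma exists_equiv_fst_eq {E : Type*} [NormedAddCommGroup E] [NormedSpace ℂ E]
    [FiniteDimensional ℂ E] {m : ℕ} (hm : Module.finrank ℂ E = m + 1) (L : E →L[ℂ] ℂ) (hL : L ≠ 0) :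
    ∃ P : E →L[ℂ] (Fin m → ℂ), ∃ e : E ≃L[ℂ] ℂ × (Fin m → ℂ), (e : E →L[ℂ] _) = L.prod P := by
  have hL' : (L : E →ₗ[ℂ] ℂ) ≠ 0 := fun h => hL (by ext x; exact DFunLike.congr_fun h x)
  have hker : Module.finrank ℂ (LinearMap.ker (L : E →ₗ[ℂ] ℂ)) = m := by
    have h1 := LinearMap.finrank_range_add_finrank_ker (L : E →ₗ[ℂ] ℂ)
    rw [LinearMap.range_eq_top.2 (LinearMap.surjective hL'), finrank_top, hm,
      Module.finrank_self] at h1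
    omega
  obtain ⟨K', hK'⟩ := Submodule.exists_isCompl (LinearMap.ker (L : E →ₗ[ℂ] ℂ))
  let φ : LinearMap.ker (L : E →ₗ[ℂ] ℂ) ≃ₗ[ℂ] (Fin m → ℂ) :=
    LinearEquiv.ofFinrankEq _ _ (by simp [hker])
  let P : E →ₗ[ℂ] (Fin m → ℂ) := φ.toLinearMap ∘ₗ Submodule.projectionOnto _ _ hK'
  have hinj : Function.Injective ((L : E →ₗ[ℂ] ℂ).prod P) := by
    rw [← LinearMap.ker_eq_bot, LinearMap.ker_eq_bot']
    intro x hx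
    obtain ⟨h1, h2⟩ := Prod.ext_iff.1 hx
    have h3 : Submodule.projectionOnto _ _ hK' x = 0 := φ.map_eq_zero_iff.1 h2
    have h4 : x ∈ K' := (Submodule.projectionOnto_apply_eq_zero_iff hK').1 h3
    exact (Submodule.mem_bot ℂ).1 (hK'.disjoint.le_bot ⟨h1, h4⟩)
  let e := LinearEquiv.ofInjectiveOfFinrankEq ((L : E →ₗ[ℂ] ℂ).prod P) hinj (by simp [hm, add_comm])
  refine ⟨P.toContinuousLinearMap, e.toContinuousLinearEquiv, ?_⟩
  ext x <;> rfl

/-- A holomorphic function with nonvanishing derivative is the first coordinate of a holomorphic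
coordinate system. -/
lemma exists_straightening {E : Type*} [NormedAddCommGroup E] [NormedSpace ℂ E]
    [FiniteDimensional ℂ E] {m : ℕ} (hm : Module.finrank ℂ E = m + 1) {Ω : Set E} (hΩ : IsOpen Ω)
    {f : E → ℂ} (hf : ContDiffOn ℂ ω f Ω) {a : E} (ha : a ∈ Ω) (hfa : fderiv ℂ f a ≠ 0) :
    ∃ Φ : OpenPartialHomeomorph E (ℂ × (Fin m → ℂ)), a ∈ Φ.source ∧ Φ.source ⊆ Ω ∧
      (∀ y ∈ Φ.source, (Φ y).1 = f y) ∧ ContDiffOn ℂ ω Φ Φ.source ∧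
      ContDiffOn ℂ ω Φ.symm Φ.target := by
  have : CompleteSpace E := FiniteDimensional.complete ℂ E
  obtain ⟨P, e, he⟩ := exists_equiv_fst_eq hm _ hfa
  let F : E → ℂ × (Fin m → ℂ) := fun y => (f y, P y)
  have hF : ContDiffOn ℂ ω F Ω := hf.prodMk P.contDiff.contDiffOn
  have hFat : ∀ y ∈ Ω, ContDiffAt ℂ ω F y := fun y hy => hF.contDiffAt (hΩ.mem_nhds hy)
  have hFa : HasFDerivAt F (e : E →L[ℂ] ℂ × (Fin m → ℂ)) a := by
    rw [he]
    exact (((hf.contDiffAt (hΩ.mem_nhds ha)).differentiableAt (by simp)).hasFDerivAt).prodMk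
      P.hasFDerivAt
  let Φ₀ := (hFat a ha).toOpenPartialHomeomorph F hFa (by simp)
  -- Restriction to the points where the derivative of `F` is invertible makes the inverse analytic
  -- on the whole target, not only near the image of `a`.
  let O : Set E := Ω ∩ fderiv ℂ F ⁻¹' Set.range ((↑) : (E ≃L[ℂ] ℂ × (Fin m → ℂ)) → _)
  have hO : IsOpen O := (hF.continuousOn_fderiv_of_isOpen hΩ (by simp)).isOpen_inter_preimage hΩ
    ContinuousLinearEquiv.isOpen
  let Φ := Φ₀.restrOpen O hO
  have hsrc : ∀ y ∈ Φ.source, y ∈ O := fun y hy => hy.2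
  refine ⟨Φ, ⟨(hFat a ha).mem_toOpenPartialHomeomorph_source hFa (by simp), ha, e, hFa.fderiv.symm⟩,
    fun y hy => (hsrc y hy).1, fun y _ => rfl, hF.mono fun y hy => (hsrc y hy).1, fun z hz => ?_⟩
  obtain ⟨hy, e', he'⟩ := hsrc _ (Φ.map_target hz)
  refine (Φ.contDiffAt_symm (f₀' := e') hz ?_ (hFat _ hy)).contDiffWithinAt
  rw [he']
  exact ((hFat _ hy).differentiableAt (by simp)).hasFDerivAt

variable {M : Type} [TopologicalSpace M]

/-- The chart of a subset `S` that is given by `S = {Ψ₁ = 0}` in the coordinates `Ψ = (Ψ₁, Ψ₂)`. -/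
def sliceChart {F : Type*} [TopologicalSpace F] (S : Set M) (x : S)
    (Ψ : OpenPartialHomeomorph M (ℂ × F)) (hΨ : ∀ y ∈ Ψ.source, y ∈ S ↔ (Ψ y).1 = 0) :
    OpenPartialHomeomorph S F := by
  classical
  have hmem : ∀ w : F, ((0, w) : ℂ × F) ∈ Ψ.target → Ψ.symm (0, w) ∈ S := fun w hw =>
    (hΨ _ (Ψ.map_target hw)).2 (by rw [Ψ.right_inv hw])
  have hpt : ∀ y : S, y.1 ∈ Ψ.source → Ψ y.1 = (0, (Ψ y.1).2) := fun y hy =>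
    Prod.ext ((hΨ _ hy).1 y.2) rfl
  exact {
    toFun := fun y => (Ψ y.1).2
    -- Outside the slice the inverse takes the default value `x`.
    invFun := fun w => if h : ((0, w) : ℂ × F) ∈ Ψ.target then ⟨Ψ.symm (0, w), hmem w h⟩ else x
    source := Subtype.val ⁻¹' Ψ.source
    target := {w | ((0, w) : ℂ × F) ∈ Ψ.target}
    map_source' := fun y hy => by
      change (0, (Ψ y.1).2) ∈ Ψ.target
      rw [← hpt y hy]
      exact Ψ.map_source hy
    map_target' := fun w hw => by
      rw [dif_pos (show ((0, w) : ℂ × F) ∈ Ψ.target from hw)]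
      exact Ψ.map_target hw
    left_inv' := fun y hy => by
      have h : ((0, (Ψ y.1).2) : ℂ × F) ∈ Ψ.target := by
        rw [← hpt y hy]
        exact Ψ.map_source hy
      rw [dif_pos h]
      refine Subtype.ext ?_
      change Ψ.symm (0, (Ψ y.1).2) = y.1
      rw [← hpt y hy, Ψ.left_inv hy]
    right_inv' := fun w hw => by
      rw [dif_pos (show ((0, w) : ℂ × F) ∈ Ψ.target from hw)]
      change (Ψ (Ψ.symm (0, w))).2 = w
      rw [Ψ.right_inv hw]
    open_source := Ψ.open_source.preimage continuous_subtype_val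
    open_target := Ψ.open_target.preimage (Continuous.prodMk_right 0)
    continuousOn_toFun := continuous_snd.comp_continuousOn
      (Ψ.continuousOn.comp continuous_subtype_val.continuousOn fun y hy => hy)
    continuousOn_invFun := by
      rw [Topology.IsInducing.subtypeVal.continuousOn_iff]
      refine (Ψ.continuousOn_symm.comp (Continuous.prodMk_right (0 : ℂ)).continuousOn
        (fun w hw => hw)).congr fun w hw => ?_
      simp only [Function.comp_apply]
      rw [dif_pos (show ((0, w) : ℂ × F) ∈ Ψ.target from hw)] }

lemma sliceChart_symm_apply {F : Type*} [TopologicalSpace F] (S : Set M) (x : S)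
    (Ψ : OpenPartialHomeomorph M (ℂ × F)) (hΨ : ∀ y ∈ Ψ.source, y ∈ S ↔ (Ψ y).1 = 0) {w : F}
    (hw : w ∈ (sliceChart S x Ψ hΨ).target) :
    ((sliceChart S x Ψ hΨ).symm w : M) = Ψ.symm (0, w) := by
  classical
  have : ((0, w) : ℂ × F) ∈ Ψ.target := hw
  change ((if h : ((0, w) : ℂ × F) ∈ Ψ.target then _ else _ : S) : M) = _
  rw [dif_pos this]

variable {E₀ H : Type*} [NormedAddCommGroup E₀] [NormedSpace ℂ E₀] [TopologicalSpace H]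
  (I : ModelWithCorners ℂ E₀ H) [ChartedSpace H M]

/-- A coordinate system is holomorphic together with its inverse. -/
structure IsHolCoord {E : Type*} [NormedAddCommGroup E] [NormedSpace ℂ E]
    (κ : OpenPartialHomeomorph M E) : Prop where
  contMDiffOn : ContMDiffOn I 𝓘(ℂ, E) ω κ κ.source
  contMDiffOn_symm : ContMDiffOn 𝓘(ℂ, E) I ω κ.symm κ.target

/-- Coordinate systems, one at each point of `S`, in which `S` is a coordinate hyperplane. -/
structure SliceAtlas (S : Set M) (m : ℕ) where
  coord : S → OpenPartialHomeomorph M (ℂ × (Fin m → ℂ))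
  isHolCoord : ∀ x, IsHolCoord I (coord x)
  mem_source : ∀ x, x.1 ∈ (coord x).source
  mem_iff : ∀ x, ∀ y ∈ (coord x).source, y ∈ S ↔ (coord x y).1 = 0

namespace SliceAtlas

variable {I} {S : Set M} {m : ℕ} (A : SliceAtlas I S m)

/-- The chart of a hypersurface. -/
def chart (x : S) : OpenPartialHomeomorph S (Fin m → ℂ) :=
  sliceChart S x (A.coord x) (A.mem_iff x)

lemma contMDiffOn_val_chart_symm (x : S) :
    ContMDiffOn 𝓘(ℂ, Fin m → ℂ) I ω (fun w => ((A.chart x).symm w : M)) (A.chart x).target := by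
  have h : ContMDiff 𝓘(ℂ, Fin m → ℂ) 𝓘(ℂ, ℂ × (Fin m → ℂ)) ω
      (fun w : Fin m → ℂ => ((0, w) : ℂ × (Fin m → ℂ))) :=
    (contDiff_const.prodMk contDiff_id).contMDiff
  refine (((A.isHolCoord x).contMDiffOn_symm.comp h.contMDiffOn fun w hw => hw)).congr
    fun w hw => ?_
  exact sliceChart_symm_apply S x (A.coord x) (A.mem_iff x) hw

lemma contMDiffOn_snd_coord (x : S) : ContMDiffOn I 𝓘(ℂ, Fin m → ℂ) ω
    (fun y => (A.coord x y).2) (A.coord x).source :=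
  (contDiff_snd.contMDiff (𝕜 := ℂ) (E := ℂ × (Fin m → ℂ))).comp_contMDiffOn
    (A.isHolCoord x).contMDiffOn

/-- The atlas of a hypersurface. -/
@[reducible] def chartedSpace : ChartedSpace (Fin m → ℂ) S where
  atlas := Set.range A.chart
  chartAt := A.chart
  mem_chart_source := A.mem_source
  chart_mem_atlas x := ⟨x, rfl⟩

lemma isManifold : @IsManifold ℂ _ (Fin m → ℂ) _ _ _ _ 𝓘(ℂ, Fin m → ℂ) ω S _ A.chartedSpace := by
  let _ := A.chartedSpace
  refine isManifold_of_contDiffOn _ _ _ ?_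
  rintro _ _ ⟨x, rfl⟩ ⟨y, rfl⟩
  suffices h : ContDiffOn ℂ ω (A.chart y ∘ (A.chart x).symm)
      ((A.chart x).symm.trans (A.chart y)).source by simpa using h
  rw [← contMDiffOn_iff_contDiffOn]
  exact (A.contMDiffOn_snd_coord y).comp ((A.contMDiffOn_val_chart_symm x).mono fun w hw => hw.1)
    fun w hw => hw.2

/-- A connected subset with a slice atlas, as a complex manifold. -/
def toComplexManifold [T2Space M] [SecondCountableTopology M] (hS : IsConnected S) :
    ComplexManifold m :=
  have : ConnectedSpace S := isConnected_iff_connectedSpace.1 hS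
  { carrier := S, chartedSpace := A.chartedSpace, isManifold := A.isManifold }

end SliceAtlas

/-- `ι` identifies the complex manifold `N` with the subset `S`, and the charts of `N` extend to
holomorphic functions on the ambient manifold. -/
structure IsSubmanifoldEmbedding (S : Set M) {m : ℕ} (N : ComplexManifold m) (ι : N → M) : Prop where
  isEmbedding : Topology.IsEmbedding ι
  range_eq : Set.range ι = S
  holomorphic : ContMDiff 𝓘(ℂ, Fin m → ℂ) I ω ι
  exists_extension : ∀ x, ∃ C : M → (Fin m → ℂ), ContMDiffAt I 𝓘(ℂ, Fin m → ℂ) ω C (ι x) ∧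
    ∀ᶠ y in 𝓝 x, chartAt (Fin m → ℂ) x y = C (ι y)

/-- The inclusion of a connected subset with a slice atlas. -/
lemma SliceAtlas.isSubmanifoldEmbedding [T2Space M] [SecondCountableTopology M] {S : Set M} {m : ℕ}
    (A : SliceAtlas I S m) (hS : IsConnected S) :
    IsSubmanifoldEmbedding I S (A.toComplexManifold hS) Subtype.val where
  isEmbedding := Topology.IsEmbedding.subtypeVal
  range_eq := Subtype.range_val
  holomorphic x := by
    have h1 : ContMDiffAt 𝓘(ℂ, Fin m → ℂ) 𝓘(ℂ, Fin m → ℂ) ω (chartAt (Fin m → ℂ) x) x :=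
      contMDiffAt_of_mem_maximalAtlas (IsManifold.chart_mem_maximalAtlas x) (mem_chart_source _ x)
    have h2 : ContMDiffAt 𝓘(ℂ, Fin m → ℂ) I ω (fun w => ((A.chart x).symm w : M))
        (chartAt (Fin m → ℂ) x x) :=
      (A.contMDiffOn_val_chart_symm x).contMDiffAt
        ((A.chart x).open_target.mem_nhds ((A.chart x).map_source (A.mem_source x)))
    refine (h2.comp x h1).congr_of_eventuallyEq ?_
    filter_upwards [(A.chart x).open_source.mem_nhds (A.mem_source x)] with y hy
    exact (congrArg Subtype.val ((A.chart x).left_inv hy)).symm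
  exists_extension x := ⟨fun y => (A.coord x y).2, (A.contMDiffOn_snd_coord x).contMDiffAt
      ((A.coord x).open_source.mem_nhds (A.mem_source x)), Filter.Eventually.of_forall fun y => rfl⟩

/-- A connected subset with regular local equations is a complex manifold. -/
theorem exists_submanifold_of_regular_equations [T2Space M] [SecondCountableTopology M] {S : Set M}
    {m : ℕ} {E : Type*} [NormedAddCommGroup E] [NormedSpace ℂ E] [FiniteDimensional ℂ E]
    (hm : Module.finrank ℂ E = m + 1) (hS : IsConnected S) {Λ : Type*}
    (κ : Λ → OpenPartialHomeomorph M E) (hκ : ∀ a, IsHolCoord I (κ a)) (f : Λ → E → ℂ)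
    (hf : ∀ a, ContDiffOn ℂ ω (f a) (κ a).target) (hcover : ∀ x ∈ S, ∃ a, x ∈ (κ a).source)
    (hSf : ∀ a, ∀ x ∈ (κ a).source, x ∈ S ↔ f a (κ a x) = 0)
    (hreg : ∀ a, ∀ y ∈ (κ a).target, f a y = 0 → fderiv ℂ (f a) y ≠ 0) :
    ∃ (N : ComplexManifold m) (ι : N → M), IsSubmanifoldEmbedding I S N ι := by
  -- The chart `κ a` followed by a coordinate system whose first coordinate is the local equation
  -- turns `S` into a coordinate hyperplane near `x`.
  have key : ∀ x : S, ∃ Ψ : OpenPartialHomeomorph M (ℂ × (Fin m → ℂ)), IsHolCoord I Ψ ∧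
      x.1 ∈ Ψ.source ∧ ∀ y ∈ Ψ.source, y ∈ S ↔ (Ψ y).1 = 0 := by
    intro x
    obtain ⟨a, ha⟩ := hcover x.1 x.2
    obtain ⟨Φ, hx, hΦ, hΦf, h1, h2⟩ := exists_straightening hm (κ a).open_target (hf a)
      ((κ a).map_source ha) (hreg a _ ((κ a).map_source ha) ((hSf a _ ha).1 x.2))
    refine ⟨(κ a).trans Φ, ⟨?_, ?_⟩, ⟨ha, hx⟩, fun y hy => ?_⟩
    · exact h1.contMDiffOn.comp ((hκ a).contMDiffOn.mono fun y hy => hy.1) fun y hy => hy.2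
    · exact (hκ a).contMDiffOn_symm.comp (h2.contMDiffOn.mono fun y hy => hy.1)
        fun y hy => hΦ (Φ.map_target hy.1)
    · rw [hSf a y hy.1]
      exact (hΦf _ hy.2).symm ▸ Iff.rfl
  choose Ψ h1 h2 h3 using key
  exact ⟨_, _, SliceAtlas.isSubmanifoldEmbedding I ⟨Ψ, h1, h2, h3⟩ hS⟩

/-! ### Immersions and composition. -/

section MFDeriv

variable {E₁ H₁ M₁ E₂ H₂ M₂ E₃ H₃ M₃ : Type*}
  [NormedAddCommGroup E₁] [NormedSpace ℂ E₁] [TopologicalSpace H₁]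
  [NormedAddCommGroup E₂] [NormedSpace ℂ E₂] [TopologicalSpace H₂]
  [NormedAddCommGroup E₃] [NormedSpace ℂ E₃] [TopologicalSpace H₃]
  {I₁ : ModelWithCorners ℂ E₁ H₁} {I₂ : ModelWithCorners ℂ E₂ H₂} {I₃ : ModelWithCorners ℂ E₃ H₃}
  [TopologicalSpace M₁] [ChartedSpace H₁ M₁] [TopologicalSpace M₂] [ChartedSpace H₂ M₂]
  [TopologicalSpace M₃] [ChartedSpace H₃ M₃]

/-- The first factor of an immersion is an immersion. -/
lemma injective_mfderiv_of_comp {g : M₁ → M₂} {h : M₂ → M₃} {φ : M₁ → M₃} {x : M₁}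
    (hg : ContMDiffAt I₁ I₂ ω g x) (hh : ContMDiffAt I₂ I₃ ω h (g x))
    (hφ : ∀ᶠ y in 𝓝 x, h (g y) = φ y) (hinj : Function.Injective (mfderiv I₁ I₃ φ x)) :
    Function.Injective (mfderiv I₁ I₂ g x) := by
  have h1 : mfderiv I₁ I₃ (h ∘ g) x = (mfderiv I₂ I₃ h (g x)).comp (mfderiv I₁ I₂ g x) :=
    mfderiv_comp x (hh.mdifferentiableAt (by simp)) (hg.mdifferentiableAt (by simp))
  have h2 : mfderiv I₁ I₃ (h ∘ g) x = mfderiv I₁ I₃ φ x := Filter.EventuallyEq.mfderiv_eq hφ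
  intro u v huv
  apply hinj
  rw [← h2, h1]
  exact congrArg (mfderiv I₂ I₃ h (g x)) huv

/-- A composition of immersions is an immersion. -/
lemma injective_mfderiv_comp {g : M₁ → M₂} {h : M₂ → M₃} {x : M₁}
    (hg : ContMDiffAt I₁ I₂ ω g x) (hh : ContMDiffAt I₂ I₃ ω h (g x))
    (hgi : Function.Injective (mfderiv I₁ I₂ g x)) (hhi : Function.Injective (mfderiv I₂ I₃ h (g x))) :
    Function.Injective (mfderiv I₁ I₃ (fun y => h (g y)) x) := by
  have h1 : mfderiv I₁ I₃ (h ∘ g) x = (mfderiv I₂ I₃ h (g x)).comp (mfderiv I₁ I₂ g x) :=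
    mfderiv_comp x (hh.mdifferentiableAt (by simp)) (hg.mdifferentiableAt (by simp))
  change Function.Injective (mfderiv I₁ I₃ (h ∘ g) x)
  rw [h1]
  exact hhi.comp hgi

end MFDeriv

variable {I}

lemma IsHolCoord.contMDiffAt {E : Type*} [NormedAddCommGroup E] [NormedSpace ℂ E]
    {κ : OpenPartialHomeomorph M E} (hκ : IsHolCoord I κ) {x : M} (hx : x ∈ κ.source) :
    ContMDiffAt I 𝓘(ℂ, E) ω κ x :=
  hκ.contMDiffOn.contMDiffAt (κ.open_source.mem_nhds hx)

lemma IsHolCoord.injective_mfderiv {E : Type*} [NormedAddCommGroup E] [NormedSpace ℂ E]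
    {κ : OpenPartialHomeomorph M E} (hκ : IsHolCoord I κ) {x : M} (hx : x ∈ κ.source) :
    Function.Injective (mfderiv I 𝓘(ℂ, E) κ x) := by
  refine injective_mfderiv_of_comp (h := κ.symm) (φ := id) (I₃ := I) (hκ.contMDiffAt hx)
    (hκ.contMDiffOn_symm.contMDiffAt (κ.open_target.mem_nhds (κ.map_source hx))) ?_ ?_
  · filter_upwards [κ.open_source.mem_nhds hx] with y hy using κ.left_inv hy
  · rw [mfderiv_id]
    exact Function.injective_id

namespace IsSubmanifoldEmbedding

variable {S : Set M} {m : ℕ} {N : ComplexManifold m} {ι : N → M}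
  (hι : IsSubmanifoldEmbedding I S N ι)

include hι

lemma mem (x : N) : ι x ∈ S := hι.range_eq ▸ Set.mem_range_self x

/-- Near `x` the chart factors as an ambient holomorphic map after `ι`, and a chart is an immersion.
-/
lemma injective_mfderiv (x : N) : Function.Injective (mfderiv 𝓘(ℂ, Fin m → ℂ) I ι x) := by
  obtain ⟨C, hC, hCx⟩ := hι.exists_extension x
  refine injective_mfderiv_of_comp (hι.holomorphic x) hC (φ := chartAt (Fin m → ℂ) x) ?_ ?_
  · filter_upwards [hCx] with y hy using hy.symm
  · exact (mdifferentiable_chart (I := 𝓘(ℂ, Fin m → ℂ)) x).mfderiv_injective (mem_chart_source _ x)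

lemma isClosedHolEmbedding (hS : IsClosed S) : IsClosedHolEmbedding 𝓘(ℂ, Fin m → ℂ) I ι where
  holomorphic := hι.holomorphic
  isClosedEmbedding := ⟨hι.isEmbedding, hι.range_eq.symm ▸ hS⟩
  immersion := hι.injective_mfderiv

lemma compactSpace (hS : IsCompact S) : CompactSpace N := by
  rw [← isCompact_univ_iff, hι.isEmbedding.isCompact_iff, Set.image_univ, hι.range_eq]
  exact hS

/-- A map to a submanifold is holomorphic if it is holomorphic as a map to the ambient manifold. -/
lemma contMDiffAt_of_comp {E₁ H₁ P : Type*} [NormedAddCommGroup E₁] [NormedSpace ℂ E₁]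
    [TopologicalSpace H₁] {I₁ : ModelWithCorners ℂ E₁ H₁} [TopologicalSpace P] [ChartedSpace H₁ P]
    {g : P → N} {p : P} (hg : ContMDiffAt I₁ I ω (fun q => ι (g q)) p) :
    ContMDiffAt I₁ 𝓘(ℂ, Fin m → ℂ) ω g p := by
  have hcont : ContinuousAt g p := hι.isEmbedding.toIsInducing.continuousAt_iff.2 hg.continuousAt
  obtain ⟨C, hC, hCx⟩ := hι.exists_extension (g p)
  have h1 : ContMDiffAt I₁ 𝓘(ℂ, Fin m → ℂ) ω (fun q => chartAt (Fin m → ℂ) (g p) (g q)) p :=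
    (ContMDiffAt.comp p hC hg).congr_of_eventuallyEq (hcont.eventually hCx)
  have h2 : ContMDiffAt 𝓘(ℂ, Fin m → ℂ) 𝓘(ℂ, Fin m → ℂ) ω (chartAt (Fin m → ℂ) (g p)).symm
      (chartAt (Fin m → ℂ) (g p) (g p)) :=
    contMDiffAt_symm_of_mem_maximalAtlas (IsManifold.chart_mem_maximalAtlas _)
      (mem_chart_target _ (g p))
  refine (ContMDiffAt.comp p h2 h1).congr_of_eventuallyEq ?_
  filter_upwards [hcont.preimage_mem_nhds (chart_source_mem_nhds (Fin m → ℂ) (g p))] with q hq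
  exact ((chartAt (Fin m → ℂ) (g p)).left_inv hq).symm

end IsSubmanifoldEmbedding

/-! ### Holomorphic functions in the preferred chart of a manifold. -/

section LocalCoordinates

variable {m : ℕ} {N : ComplexManifold m}

lemma ComplexManifold.contMDiffAt_chart_symm (x : N) :
    ContMDiffAt 𝓘(ℂ, Fin m → ℂ) 𝓘(ℂ, Fin m → ℂ) ω (chartAt (Fin m → ℂ) x).symm
      (chartAt (Fin m → ℂ) x x) :=
  contMDiffAt_symm_of_mem_maximalAtlas (IsManifold.chart_mem_maximalAtlas _) (mem_chart_target _ x)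

lemma ComplexManifold.injective_mfderiv_chart_symm (x : N) :
    Function.Injective (mfderiv 𝓘(ℂ, Fin m → ℂ) 𝓘(ℂ, Fin m → ℂ) (chartAt (Fin m → ℂ) x).symm
      (chartAt (Fin m → ℂ) x x)) :=
  (mdifferentiable_chart (I := 𝓘(ℂ, Fin m → ℂ)) x).symm.mfderiv_injective (mem_chart_target _ x)

lemma ComplexManifold.chart_symm_self (x : N) :
    (chartAt (Fin m → ℂ) x).symm (chartAt (Fin m → ℂ) x x) = x :=
  (chartAt (Fin m → ℂ) x).left_inv (mem_chart_source _ x)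

/-- A holomorphic function in local coordinates. -/
lemma ComplexManifold.contDiffAt_comp_chart_symm {F : Type*} [NormedAddCommGroup F]
    [NormedSpace ℂ F] {φ : N → F} {x : N} (hφ : ContMDiffAt 𝓘(ℂ, Fin m → ℂ) 𝓘(ℂ, F) ω φ x) :
    ContDiffAt ℂ ω (fun a => φ ((chartAt (Fin m → ℂ) x).symm a)) (chartAt (Fin m → ℂ) x x) := by
  rw [← contMDiffAt_iff_contDiffAt]
  refine ContMDiffAt.comp _ ?_ (ComplexManifold.contMDiffAt_chart_symm x)
  rwa [ComplexManifold.chart_symm_self]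

lemma ComplexManifold.injective_fderiv_comp_chart_symm {F : Type*} [NormedAddCommGroup F]
    [NormedSpace ℂ F] {φ : N → F} {x : N} (hφ : ContMDiffAt 𝓘(ℂ, Fin m → ℂ) 𝓘(ℂ, F) ω φ x)
    (hinj : Function.Injective (mfderiv 𝓘(ℂ, Fin m → ℂ) 𝓘(ℂ, F) φ x)) :
    Function.Injective (fderiv ℂ (fun a => φ ((chartAt (Fin m → ℂ) x).symm a))
      (chartAt (Fin m → ℂ) x x)) := by
  rw [← mfderiv_eq_fderiv]
  refine injective_mfderiv_comp (ComplexManifold.contMDiffAt_chart_symm x) ?_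
    (ComplexManifold.injective_mfderiv_chart_symm x) ?_
  · rwa [ComplexManifold.chart_symm_self]
  · rwa [ComplexManifold.chart_symm_self]

end LocalCoordinates

end Hypersurface

/-! ### Topology and coordinates of projective spaces and line bundles -/

namespace ProjSpace

variable {n : ℕ}

instance : CompactSpace (ProjSpace n) := by
  let S := Metric.sphere (0 : Fin (n + 1) → ℂ) 1
  have : CompactSpace S := isCompact_iff_compactSpace.1 (isCompact_sphere _ _)
  let f : S → ProjSpace n := fun v => Projectivization.mk' ℂ
    ⟨v.1, fun h => by have := v.2; simp [S, h] at this⟩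
  have hf : Continuous f := continuous_mk'.comp (Continuous.subtype_mk continuous_subtype_val _)
  have hsurj : Function.Surjective f := by
    intro p
    induction p using Projectivization.ind with
    | h v hv =>
      refine ⟨⟨((‖v‖ : ℂ)⁻¹) • v, by simp [S, norm_smul, hv]⟩, ?_⟩
      have hne : (‖v‖ : ℂ)⁻¹ ≠ 0 := by simpa using hv
      exact (Projectivization.mk_eq_mk_iff' ℂ _ _ _ _).2 ⟨_, rfl⟩
  exact hsurj.compactSpace hf

/-- The complement of the origin has real dimension `2 (n + 1) ≥ 2`, so it is connected even for `n
= 0`, and it maps onto projective space. -/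
instance : ConnectedSpace (ProjSpace n) := by
  have h1 : IsConnected ({0}ᶜ : Set (Fin (n + 1) → ℂ)) := by
    refine isConnected_compl_singleton_of_one_lt_rank ?_ 0
    rw [← Module.finrank_eq_rank ℝ, finrank_real_pi_complex]
    norm_cast
    rw [Fintype.card_fin]
    omega
  have : ConnectedSpace {v : Fin (n + 1) → ℂ // v ≠ 0} := isConnected_iff_connectedSpace.1 h1
  exact isQuotientMap_mk'.surjective.connectedSpace continuous_mk'

/-- The entries of the orthogonal projection onto a line. -/
def projector (p : ProjSpace n) (a b : Fin (n + 1)) : ℂ :=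
  p.rep a * (starRingEnd ℂ) (p.rep b) / ∑ k, p.rep k * (starRingEnd ℂ) (p.rep k)

lemma projector_mk (v : Fin (n + 1) → ℂ) (hv : v ≠ 0) (a b : Fin (n + 1)) :
    projector (Projectivization.mk ℂ v hv) a b =
      v a * (starRingEnd ℂ) (v b) / ∑ k, v k * (starRingEnd ℂ) (v k) := by
  obtain ⟨c, hc⟩ := Projectivization.exists_smul_eq_mk_rep ℂ v hv
  have h : ∀ l, (Projectivization.mk ℂ v hv).rep l = (c : ℂ) * v l := fun l => by
    rw [← hc]; rfl
  have hc0 : (c : ℂ) * (starRingEnd ℂ) (c : ℂ) ≠ 0 := mul_ne_zero c.ne_zero (by simp)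
  simp only [projector, h, map_mul]
  rw [show ∑ k, (c : ℂ) * v k * ((starRingEnd ℂ) (c : ℂ) * (starRingEnd ℂ) (v k)) =
      (c : ℂ) * (starRingEnd ℂ) (c : ℂ) * ∑ k, v k * (starRingEnd ℂ) (v k) by
    rw [Finset.mul_sum]; exact Finset.sum_congr rfl fun k _ => by ring,
    show (c : ℂ) * v a * ((starRingEnd ℂ) (c : ℂ) * (starRingEnd ℂ) (v b)) =
      (c : ℂ) * (starRingEnd ℂ) (c : ℂ) * (v a * (starRingEnd ℂ) (v b)) by ring]
  exact mul_div_mul_left _ _ hc0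

lemma sum_mul_conj_ne_zero {v : Fin (n + 1) → ℂ} (hv : v ≠ 0) :
    ∑ k, v k * (starRingEnd ℂ) (v k) ≠ 0 := by
  simp only [Complex.mul_conj, ← Complex.ofReal_sum]
  rw [Complex.ofReal_ne_zero, Ne, Finset.sum_eq_zero_iff_of_nonneg fun k _ => Complex.normSq_nonneg _]
  obtain ⟨k, hk⟩ := Function.ne_iff.1 hv
  exact fun h => hk (Complex.normSq_eq_zero.1 (h k (Finset.mem_univ k)))

lemma continuous_projector (a b : Fin (n + 1)) :
    Continuous fun p : ProjSpace n => projector p a b := by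
  rw [isQuotientMap_mk'.continuous_iff]
  have hc : ∀ k, Continuous fun v : {v : Fin (n + 1) → ℂ // v ≠ 0} => v.1 k := fun k =>
    (continuous_apply k).comp continuous_subtype_val
  have : Continuous fun v : {v : Fin (n + 1) → ℂ // v ≠ 0} =>
      v.1 a * (starRingEnd ℂ) (v.1 b) / ∑ k, v.1 k * (starRingEnd ℂ) (v.1 k) :=
    Continuous.div ((hc a).mul (Complex.continuous_conj.comp (hc b)))
      (continuous_finsetSum _ fun k _ => (hc k).mul (Complex.continuous_conj.comp (hc k)))
      fun v => sum_mul_conj_ne_zero v.2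
  exact this.congr fun v => (projector_mk v.1 v.2 a b).symm

/-- A column of the projector of index `b` with `v b ≠ 0` is a nonzero multiple of `v`, so the line
can be read off. As the projector is continuous, projective space is Hausdorff. -/
lemma projector_injective : Function.Injective (projector : ProjSpace n → _) := by
  intro p q h
  induction p using Projectivization.ind with
  | h v hv =>
    induction q using Projectivization.ind with
    | h w hw =>
      obtain ⟨b, hb⟩ := Function.ne_iff.1 hv
      have hb' : (starRingEnd ℂ) (v b) ≠ 0 := by simpa using hb
      refine (Projectivization.mk_eq_mk_iff' ℂ _ _ _ _).2
        ⟨(starRingEnd ℂ) (w b) / (∑ k, w k * (starRingEnd ℂ) (w k)) *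
          ((∑ k, v k * (starRingEnd ℂ) (v k)) / (starRingEnd ℂ) (v b)), ?_⟩
      ext a
      have := congrFun (congrFun h a) b
      rw [projector_mk, projector_mk] at this
      have hv' := sum_mul_conj_ne_zero hv
      have hw' := sum_mul_conj_ne_zero hw
      rw [div_eq_div_iff hv' hw'] at this
      simp only [Pi.smul_apply, smul_eq_mul]
      field_simp
      linear_combination -this

instance : T2Space (ProjSpace n) :=
  T2Space.of_injective_continuous projector_injective
    (continuous_pi fun a => continuous_pi fun b => continuous_projector a b)

instance : SecondCountableTopology (ProjSpace n) :=
  ChartedSpace.secondCountable_of_sigmaCompact (Fin n → ℂ) _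

end ProjSpace

section IsHolCoord

variable {M₁ M₂ : Type} [TopologicalSpace M₁] [TopologicalSpace M₂] {E₁ H₁ E₂ H₂ F₁ F₂ : Type*}
  [NormedAddCommGroup E₁] [NormedSpace ℂ E₁] [TopologicalSpace H₁] {I₁ : ModelWithCorners ℂ E₁ H₁}
  [NormedAddCommGroup E₂] [NormedSpace ℂ E₂] [TopologicalSpace H₂] {I₂ : ModelWithCorners ℂ E₂ H₂}
  [ChartedSpace H₁ M₁] [ChartedSpace H₂ M₂]
  [NormedAddCommGroup F₁] [NormedSpace ℂ F₁] [NormedAddCommGroup F₂] [NormedSpace ℂ F₂]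

lemma IsHolCoord.prod {κ₁ : OpenPartialHomeomorph M₁ F₁} {κ₂ : OpenPartialHomeomorph M₂ F₂}
    (h₁ : IsHolCoord I₁ κ₁) (h₂ : IsHolCoord I₂ κ₂) : IsHolCoord (I₁.prod I₂) (κ₁.prod κ₂) where
  contMDiffOn := ContMDiffOn.prodMk_space
    (h₁.contMDiffOn.comp contMDiffOn_fst fun _ hp => hp.1)
    (h₂.contMDiffOn.comp contMDiffOn_snd fun _ hp => hp.2)
  contMDiffOn_symm := ContMDiffOn.prodMk
    (h₁.contMDiffOn_symm.comp (contDiff_fst.contMDiff (𝕜 := ℂ) (E := F₁ × F₂)).contMDiffOn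
      fun _ hp => hp.1)
    (h₂.contMDiffOn_symm.comp (contDiff_snd.contMDiff (𝕜 := ℂ) (E := F₁ × F₂)).contMDiffOn
      fun _ hp => hp.2)

lemma isHolCoord_ofSet {s : Set ℂ} (hs : IsOpen s) :
    IsHolCoord 𝓘(ℂ) (OpenPartialHomeomorph.ofSet s hs) :=
  ⟨contMDiffOn_id, contMDiffOn_id⟩

lemma ProjSpace.isHolCoord_affineChart {n : ℕ} (j : Fin (n + 1)) :
    IsHolCoord 𝓘(ℂ, Fin n → ℂ) (ProjSpace.affineChart j : OpenPartialHomeomorph (ProjSpace n) _) :=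
  have h := IsManifold.subset_maximalAtlas (I := 𝓘(ℂ, Fin n → ℂ)) (n := ω)
    (show affineChart j ∈ atlas _ (ProjSpace n) from ⟨j, rfl⟩)
  ⟨contMDiffOn_of_mem_maximalAtlas h, contMDiffOn_symm_of_mem_maximalAtlas h⟩

end IsHolCoord

/-! ### Affine coordinates on products of projective spaces and on total spaces of line bundles. -/

namespace MultiProj

variable {r : ℕ} {n : Fin r → ℕ}

lemma isHolCoord_affineChart (J : ∀ i, Fin (n i + 1)) :
    IsHolCoord 𝓘(ℂ, ∀ i, Fin (n i) → ℂ)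
      (affineChart J : OpenPartialHomeomorph (MultiProj n) _) :=
  have h := IsManifold.subset_maximalAtlas (I := 𝓘(ℂ, ∀ i, Fin (n i) → ℂ)) (n := ω)
    (show affineChart J ∈ atlas _ (MultiProj n) from ⟨J, rfl⟩)
  ⟨contMDiffOn_of_mem_maximalAtlas h, contMDiffOn_symm_of_mem_maximalAtlas h⟩

lemma affineChart_target (J : ∀ i, Fin (n i + 1)) : (affineChart J).target = Set.univ := by
  ext; simp [affineChart, ProjSpace.affineChart]

/-- The homogeneous coordinates, normalised by `v_(J i) = 1`, of the point with affine coordinates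
`u`. -/
def homog (J : ∀ i, Fin (n i + 1)) (u : ∀ i, Fin (n i) → ℂ) (k : Σ i, Fin (n i + 1)) : ℂ :=
  ((J k.1).insertNth (1 : ℂ) (u k.1) : Fin (n k.1 + 1) → ℂ) k.2

lemma homog_self (J : ∀ i, Fin (n i + 1)) (u : ∀ i, Fin (n i) → ℂ) (i : Fin r) :
    homog J u ⟨i, J i⟩ = 1 := by simp [homog]

lemma homog_succAbove (J : ∀ i, Fin (n i + 1)) (u : ∀ i, Fin (n i) → ℂ) (i : Fin r) (k : Fin (n i)) :
    homog J u ⟨i, (J i).succAbove k⟩ = u i k := by simp [homog]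

lemma contDiff_homog (J : ∀ i, Fin (n i + 1)) (k : Σ i, Fin (n i + 1)) :
    ContDiff ℂ ω fun u => homog J u k := by
  obtain ⟨i, k⟩ := k
  refine Fin.succAboveCases (J i) ?_ (fun l => ?_) k
  · simp only [homog_self]
    exact contDiff_const
  · simp only [homog_succAbove]
    exact (contDiff_apply ℂ ℂ l).comp
      (ContinuousLinearMap.proj (R := ℂ) (φ := fun i => Fin (n i) → ℂ) i).contDiff

lemma blockNonzero_homog (J : ∀ i, Fin (n i + 1)) (u : ∀ i, Fin (n i) → ℂ) :
    BlockNonzero Sigma.fst (homog J u) := fun i => ⟨⟨i, J i⟩, rfl, by simp [homog_self]⟩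

lemma blockNonzero_coords (z : MultiProj n) : BlockNonzero Sigma.fst (coords z) := fun i => by
  obtain ⟨k, hk⟩ := Function.ne_iff.1 (z i).rep_nonzero
  exact ⟨⟨i, k⟩, rfl, hk⟩

lemma coords_eq_mul_homog {J : ∀ i, Fin (n i + 1)} {z : MultiProj n} (hz : z ∈ affineOpen J) :
    coords z = fun k => (z k.1).rep (J k.1) * homog J (affineChart J z) k := by
  ext ⟨i, k⟩
  have hi : (z i).rep (J i) ≠ 0 := hz i
  refine Fin.succAboveCases (J i) ?_ (fun l => ?_) k
  · simp [homog_self, coords]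
  · rw [homog_succAbove]
    exact (mul_div_cancel₀ _ hi).symm

/-- A section in the trivialisation over an affine open set. -/
def localFun (J : ∀ i, Fin (n i + 1)) (t : MvPolynomial (Σ i, Fin (n i + 1)) ℂ)
    (u : ∀ i, Fin (n i) → ℂ) : ℂ := MvPolynomial.eval (homog J u) t

lemma contDiff_localFun (J : ∀ i, Fin (n i + 1)) (t : MvPolynomial (Σ i, Fin (n i + 1)) ℂ) :
    ContDiff ℂ ω (localFun J t) := contDiff_eval (contDiff_homog J) t

/-- The monomial that trivialises `𝒪(d)` over the affine open set of index `J`. -/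
def cornerMonomial (d : Fin r → ℕ) (J : ∀ i, Fin (n i + 1)) (z : MultiProj n) : ℂ :=
  ∏ i, (z i).rep (J i) ^ d i

lemma cornerMonomial_ne_zero (d : Fin r → ℕ) {J : ∀ i, Fin (n i + 1)} {z : MultiProj n}
    (hz : z ∈ affineOpen J) : cornerMonomial d J z ≠ 0 :=
  Finset.prod_ne_zero_iff.2 fun i _ => pow_ne_zero _ (hz i)

lemma cornerMonomial_two_smul (d : Fin r → ℕ) (J : ∀ i, Fin (n i + 1)) (z : MultiProj n) :
    cornerMonomial (2 • d) J z = cornerMonomial d J z ^ 2 := by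
  simp only [cornerMonomial, ← Finset.prod_pow, Pi.smul_apply, smul_eq_mul, ← pow_mul, mul_comm]

lemma eval_coords {d : Fin r → ℕ} {t : MvPolynomial (Σ i, Fin (n i + 1)) ℂ}
    (ht : t ∈ sections n d) {J : ∀ i, Fin (n i + 1)} {z : MultiProj n} (hz : z ∈ affineOpen J) :
    MvPolynomial.eval (coords z) t = cornerMonomial d J z * localFun J t (affineChart J z) := by
  rw [coords_eq_mul_homog hz]
  exact eval_smul_of_multihomogeneous (β := Sigma.fst) ht (fun i => (z i).rep (J i)) _

lemma eval_coords_eq_zero_iff {d : Fin r → ℕ} {t : MvPolynomial (Σ i, Fin (n i + 1)) ℂ}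
    (ht : t ∈ sections n d) {J : ∀ i, Fin (n i + 1)} {z : MultiProj n} (hz : z ∈ affineOpen J) :
    MvPolynomial.eval (coords z) t = 0 ↔ localFun J t (affineChart J z) = 0 := by
  rw [eval_coords ht hz, mul_eq_zero, or_iff_right (cornerMonomial_ne_zero d hz)]

lemma exists_mem_affineOpen (z : MultiProj n) : ∃ J, z ∈ affineOpen J :=
  ⟨fun i => ProjSpace.idx (z i), fun i => ProjSpace.mem_affineOpen_idx (z i)⟩

/-- The coordinates `(u, w)` of the total space of `𝒪(d)` over an affine open set. -/
def lineCoord (d : Fin r → ℕ) (J : ∀ i, Fin (n i + 1)) :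
    OpenPartialHomeomorph (lineBundle n d).TotalSpace ((∀ i, Fin (n i) → ℂ) × ℂ) :=
  ((lineBundle n d).localTriv J).toOpenPartialHomeomorph.trans
    ((affineChart J).prod (OpenPartialHomeomorph.refl ℂ))

lemma mem_lineCoord_source {d : Fin r → ℕ} {J : ∀ i, Fin (n i + 1)}
    {e : (lineBundle n d).TotalSpace} : e ∈ (lineCoord d J).source ↔ e.proj ∈ affineOpen J := by
  rw [lineCoord, OpenPartialHomeomorph.trans_source]
  constructor
  · rintro ⟨h, -⟩
    exact ((lineBundle n d).mem_localTriv_source J e).1 h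
  · intro h
    refine ⟨((lineBundle n d).mem_localTriv_source J e).2 h, ?_, trivial⟩
    rw [affineChart_source]
    exact h

lemma lineCoord_target (d : Fin r → ℕ) (J : ∀ i, Fin (n i + 1)) :
    (lineCoord d J : OpenPartialHomeomorph (lineBundle n d).TotalSpace _).target = Set.univ := by
  rw [Set.eq_univ_iff_forall]
  intro p
  refine ⟨⟨by rw [affineChart_target]; trivial, trivial⟩, ?_⟩
  refine ((lineBundle n d).mem_localTriv_target J _).2 ?_
  change (affineChart J).symm p.1 ∈ affineOpen J
  rw [← affineChart_source]
  exact (affineChart J).map_target (by rw [affineChart_target]; trivial)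

lemma lineCoord_fst (d : Fin r → ℕ) (J : ∀ i, Fin (n i + 1)) (e : (lineBundle n d).TotalSpace) :
    (lineCoord d J e).1 = affineChart J e.proj := rfl

lemma lineCoord_snd (d : Fin r → ℕ) (J : ∀ i, Fin (n i + 1)) (e : (lineBundle n d).TotalSpace) :
    (lineCoord d J e).2 = ((lineBundle n d).localTriv J e).2 := rfl

lemma isHolCoord_lineCoord (d : Fin r → ℕ) (J : ∀ i, Fin (n i + 1)) :
    IsHolCoord (𝓘(ℂ, ∀ i, Fin (n i) → ℂ).prod 𝓘(ℂ))
      (lineCoord d J : OpenPartialHomeomorph (lineBundle n d).TotalSpace _) := by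
  have hp := (isHolCoord_affineChart J).prod (isHolCoord_ofSet isOpen_univ)
  have : MemTrivializationAtlas ((lineBundle n d).localTriv J) := ⟨⟨J, rfl⟩⟩
  have htriv := Bundle.Trivialization.contMDiffOn (IB := 𝓘(ℂ, ∀ i, Fin (n i) → ℂ)) (n := ω)
    ((lineBundle n d).localTriv J)
  have htriv' := Bundle.Trivialization.contMDiffOn_symm (IB := 𝓘(ℂ, ∀ i, Fin (n i) → ℂ)) (n := ω)
    ((lineBundle n d).localTriv J)
  constructor
  · exact hp.contMDiffOn.comp (htriv.mono fun e he => he.1) fun e he => ⟨he.2.1, trivial⟩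
  · exact htriv'.comp (hp.contMDiffOn_symm.mono fun e he => ⟨he.1.1, trivial⟩) fun e he => he.2

end MultiProj

/-! ### Topology of double covers -/

/-- A criterion for the connectedness of the source of a finite or proper map. -/
lemma connectedSpace_of_isClosedMap {X Z : Type*} [TopologicalSpace X] [TopologicalSpace Z]
    [ConnectedSpace Z] {f : X → Z} (hcl : IsClosedMap f) (hs : Function.Surjective f) {z₀ : Z}
    (h₀ : IsPreconnected (f ⁻¹' {z₀}))
    (h : ∀ x, 𝓝 (f x) ≤ Filter.map f (𝓝 x) ∨ IsPreconnected (f ⁻¹' {f x})) : ConnectedSpace X := by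
  -- The image of a clopen set is closed because `f` is. It is open at `f x` either because `f` is
  -- open at `x`, or because the connected fibre through `x` lies in `s` and closedness of `f` keeps
  -- nearby fibres away from the complement. So `s` and its complement would both meet the connected
  -- fibre over `z₀`.
  have himage : ∀ s : Set X, IsClopen s → s.Nonempty → f '' s = Set.univ := by
    intro s hs' hne
    refine IsClopen.eq_univ ⟨hcl s hs'.isClosed, isOpen_iff_mem_nhds.2 ?_⟩ (hne.image f)
    rintro _ ⟨x, hx, rfl⟩
    rcases h x with hx' | hx'
    · exact hx' (Filter.image_mem_map (hs'.isOpen.mem_nhds hx))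
    · have hsub : f ⁻¹' {f x} ⊆ s := hx'.subset_isClopen hs' ⟨x, rfl, hx⟩
      refine Filter.mem_of_superset ((hcl _ hs'.compl.isClosed).isOpen_compl.mem_nhds ?_) ?_
      · rintro ⟨y, hy, hyx⟩
        exact hy (hsub hyx)
      · intro z hz
        obtain ⟨y, rfl⟩ := hs z
        by_contra hy
        exact hz ⟨y, fun hys => hy ⟨y, hys, rfl⟩, rfl⟩
  have : PreconnectedSpace X := by
    rw [preconnectedSpace_iff_clopen]
    intro s hs'
    by_contra! hcon
    obtain ⟨x, hx, hxz⟩ := (himage s hs' hcon.1).symm ▸ Set.mem_univ z₀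
    obtain ⟨y, hy, hyz⟩ := (himage sᶜ hs'.compl (Set.nonempty_compl.2 hcon.2)).symm ▸ Set.mem_univ z₀
    exact hy (h₀.subset_isClopen hs' ⟨x, hxz, hx⟩ hyz)
  obtain ⟨x, -⟩ := hs z₀
  exact { toNonempty := ⟨x⟩ }

namespace MultiProj

variable {r : ℕ} {n : Fin r → ℕ} {d : Fin r → ℕ}

lemma continuous_lineCoord_symm (d : Fin r → ℕ) (J : ∀ i, Fin (n i + 1)) :
    Continuous (lineCoord d J : OpenPartialHomeomorph (lineBundle n d).TotalSpace _).symm := by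
  rw [← continuousOn_univ, ← lineCoord_target d J]
  exact (lineCoord d J).continuousOn_symm

lemma lineCoord_lineCoord_symm (J : ∀ i, Fin (n i + 1)) (p : (∀ i, Fin (n i) → ℂ) × ℂ) :
    lineCoord d J ((lineCoord d J).symm p) = p :=
  (lineCoord d J).right_inv (by rw [lineCoord_target]; trivial)

lemma lineCoord_symm_mem_source (J : ∀ i, Fin (n i + 1)) (p : (∀ i, Fin (n i) → ℂ) × ℂ) :
    (lineCoord d J).symm p ∈ (lineCoord d J).source :=
  (lineCoord d J).map_target (by rw [lineCoord_target]; trivial)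

lemma proj_lineCoord_symm {J : ∀ i, Fin (n i + 1)} {z : MultiProj n} (hz : z ∈ affineOpen J)
    (w : ℂ) : ((lineCoord d J).symm (affineChart J z, w)).proj = z := by
  have h1 := congrArg Prod.fst (lineCoord_lineCoord_symm (d := d) J (affineChart J z, w))
  have h2 := mem_lineCoord_source.1 (lineCoord_symm_mem_source (d := d) J (affineChart J z, w))
  rw [← affineChart_source] at h2 hz
  exact (affineChart J).injOn h2 hz h1

lemma eq_of_lineCoord_eq {J : ∀ i, Fin (n i + 1)} {e e' : (lineBundle n d).TotalSpace}
    (he : e.proj ∈ affineOpen J) (hp : e'.proj = e.proj)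
    (hw : (lineCoord d J e').2 = (lineCoord d J e).2) : e' = e := by
  refine (lineCoord d J).injOn (mem_lineCoord_source.2 (hp.symm ▸ he)) (mem_lineCoord_source.2 he) ?_
  exact Prod.ext (by rw [lineCoord_fst, lineCoord_fst, hp]) hw

lemma continuous_proj : Continuous fun e : (lineBundle n d).TotalSpace => e.proj :=
  (lineBundle n d).continuous_proj

instance : T2Space (lineBundle n d).TotalSpace := by
  refine ⟨fun e e' hne => ?_⟩
  by_cases hp : e.proj = e'.proj
  · obtain ⟨J, hJ⟩ := exists_mem_affineOpen e.proj
    have he : e ∈ (lineCoord d J).source := mem_lineCoord_source.2 hJ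
    have he' : e' ∈ (lineCoord d J).source := mem_lineCoord_source.2 (hp ▸ hJ)
    obtain ⟨U, V, hU, hV, hU', hV', hUV⟩ := t2_separation
      (fun h => hne ((lineCoord d J).injOn he he' h))
    refine ⟨_, _, (lineCoord d J).isOpen_inter_preimage hU, (lineCoord d J).isOpen_inter_preimage hV,
      ⟨he, hU'⟩, ⟨he', hV'⟩, ?_⟩
    exact (hUV.preimage (lineCoord d J)).mono Set.inter_subset_right Set.inter_subset_right
  · obtain ⟨U, V, hU, hV, hU', hV', hUV⟩ := t2_separation hp
    exact ⟨_, _, hU.preimage continuous_proj, hV.preimage continuous_proj, hU', hV', hUV.preimage _⟩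

instance : SecondCountableTopology (lineBundle n d).TotalSpace := by
  have : SigmaCompactSpace (lineBundle n d).TotalSpace := by
    rw [← isSigmaCompact_univ_iff]
    have : (Set.univ : Set (lineBundle n d).TotalSpace) =
        ⋃ J : ∀ i, Fin (n i + 1), (lineCoord d J).symm '' Set.univ := by
      refine (Set.eq_univ_of_forall fun e => ?_).symm
      obtain ⟨J, hJ⟩ := exists_mem_affineOpen e.proj
      exact Set.mem_iUnion.2 ⟨J, lineCoord d J e, trivial,
        (lineCoord d J).left_inv (mem_lineCoord_source.2 hJ)⟩
    rw [this]
    exact isSigmaCompact_iUnion _ fun J => isSigmaCompact_univ.image (continuous_lineCoord_symm d J)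
  have : SecondCountableTopology (ModelProd (∀ i, Fin (n i) → ℂ) ℂ) :=
    inferInstanceAs (SecondCountableTopology ((∀ i, Fin (n i) → ℂ) × ℂ))
  exact ChartedSpace.secondCountable_of_sigmaCompact (ModelProd (∀ i, Fin (n i) → ℂ) ℂ) _

/-- The fibre coordinate relative to the chosen representative of the base point. -/
def fibreCoord (e : (lineBundle n d).TotalSpace) : ℂ :=
  cornerMonomial d (fun i => ProjSpace.idx (e.proj i)) e.proj * (show ℂ from e.2)

/-- The right side does not mention `J`: it scales with the chosen representative exactly as the
monomials of multidegree `d` do. Equations between `w` and sections can thus be stated once, in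
homogeneous coordinates. -/
lemma lineCoord_snd_mul {J : ∀ i, Fin (n i + 1)} {e : (lineBundle n d).TotalSpace}
    (he : e.proj ∈ affineOpen J) :
    (lineCoord d J e).2 * cornerMonomial d J e.proj = fibreCoord e := by
  rw [lineCoord_snd, VectorBundleCore.localTriv_apply]
  change (transition d (fun i => ProjSpace.idx (e.proj i)) J e.proj • (show ℂ from e.2)) * _ = _
  rw [fibreCoord, smul_eq_mul, mul_right_comm]
  congr 1
  simp only [transition, cornerMonomial, ← Finset.prod_mul_distrib, ← mul_pow]
  refine Finset.prod_congr rfl fun i _ => ?_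
  rw [ProjSpace.ratio, div_mul_cancel₀ _ (he i)]

lemma mem_doubleCover_iff {t : MvPolynomial (Σ i, Fin (n i + 1)) ℂ}
    {e : (lineBundle n d).TotalSpace} :
    e ∈ doubleCover d t ↔ fibreCoord e ^ 2 = MvPolynomial.eval (coords e.proj) t := by
  have key : ∀ J, e.proj ∈ affineOpen J → (((lineBundle n d).localTriv J e).2 ^ 2 =
      MvPolynomial.eval (coords e.proj) t / (∏ i, (e.proj i).rep (J i) ^ d i) ^ 2 ↔
      fibreCoord e ^ 2 = MvPolynomial.eval (coords e.proj) t) := by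
    intro J hJ
    rw [← lineCoord_snd_mul hJ, mul_pow, lineCoord_snd]
    exact eq_div_iff (pow_ne_zero 2 (cornerMonomial_ne_zero d hJ))
  constructor
  · intro h
    obtain ⟨J, hJ⟩ := exists_mem_affineOpen e.proj
    exact (key J hJ).1 (h J hJ)
  · exact fun h J hJ => (key J hJ).2 h

lemma mem_doubleCover_iff_local {t : MvPolynomial (Σ i, Fin (n i + 1)) ℂ}
    (ht : t ∈ sections n (2 • d)) {e : (lineBundle n d).TotalSpace} {J : ∀ i, Fin (n i + 1)}
    (he : e.proj ∈ affineOpen J) :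
    e ∈ doubleCover d t ↔ (lineCoord d J e).2 ^ 2 = localFun J t (lineCoord d J e).1 := by
  rw [mem_doubleCover_iff, ← lineCoord_snd_mul he, eval_coords ht he, cornerMonomial_two_smul,
    mul_pow, mul_comm (cornerMonomial d J e.proj ^ 2), lineCoord_fst]
  exact mul_left_inj' (pow_ne_zero 2 (cornerMonomial_ne_zero d he))

/-- Every point lies in a bounded part of some affine open set. -/
lemma exists_mem_affineOpen_norm_le (z : MultiProj n) :
    ∃ J, z ∈ affineOpen J ∧ ‖affineChart J z‖ ≤ 1 := by
  have : ∀ i, ∃ j, ∀ k, ‖(z i).rep k‖ ≤ ‖(z i).rep j‖ := fun i => by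
    obtain ⟨j, -, hj⟩ := Finset.exists_max_image Finset.univ (fun k => ‖(z i).rep k‖)
      Finset.univ_nonempty
    exact ⟨j, fun k => hj k (Finset.mem_univ k)⟩
  choose J hJ using this
  have hne : ∀ i, (z i).rep (J i) ≠ 0 := fun i h => by
    refine (z i).rep_nonzero (funext fun k => norm_le_zero_iff.1 ?_)
    simpa [h] using hJ i k
  refine ⟨J, hne, (pi_norm_le_iff_of_nonneg zero_le_one).2 fun i =>
    (pi_norm_le_iff_of_nonneg zero_le_one).2 fun k => ?_⟩
  change ‖(z i).rep _ / (z i).rep (J i)‖ ≤ 1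
  rw [norm_div]
  exact div_le_one_of_le₀ (hJ i _) (norm_nonneg _)

/-- A family of double covers is proper over its base. -/
lemma isCompact_family {K : Set ℂ} (hK : IsCompact K)
    {γ : ℂ → MvPolynomial (Σ i, Fin (n i + 1)) ℂ} (hγ : ∀ ζ, γ ζ ∈ sections n (2 • d))
    (hcont : ∀ J, ContinuousOn (fun p : (∀ i, Fin (n i) → ℂ) × ℂ => localFun J (γ p.2) p.1)
      (Set.univ ×ˢ K)) :
    IsCompact {p : (lineBundle n d).TotalSpace × ℂ | p.2 ∈ K ∧ p.1 ∈ doubleCover d (γ p.2)} := by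
  let B := Metric.closedBall (0 : ∀ i, Fin (n i) → ℂ) 1
  have hB : IsCompact B := isCompact_closedBall _ _
  -- The part of the family over the closed unit polydisc of one chart. These parts cover the
  -- family, and `w² = γ` bounds `w` on each of them.
  let Q : (∀ i, Fin (n i + 1)) → Set (((∀ i, Fin (n i) → ℂ) × ℂ) × ℂ) := fun J =>
    {p | p.1.1 ∈ B ∧ p.2 ∈ K ∧ p.1.2 ^ 2 = localFun J (γ p.2) p.1.1}
  have hQ : ∀ J, IsCompact (Q J) := by
    intro J
    have hc := (hcont J).mono (Set.prod_mono (Set.subset_univ B) subset_rfl)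
    obtain ⟨R, hR⟩ := (hB.prod hK).exists_bound_of_continuousOn hc
    let K' := (B ×ˢ Metric.closedBall (0 : ℂ) (R + 1)) ×ˢ K
    have hK' : IsCompact K' := (hB.prod (isCompact_closedBall _ _)).prod hK
    have hcl : IsClosed (K' ∩ (fun p : ((∀ i, Fin (n i) → ℂ) × ℂ) × ℂ =>
        p.1.2 ^ 2 - localFun J (γ p.2) p.1.1) ⁻¹' {0}) := by
      refine ContinuousOn.preimage_isClosed_of_isClosed ?_ hK'.isClosed isClosed_singleton
      refine ContinuousOn.sub (by fun_prop) ?_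
      refine hc.comp (f := fun p : ((∀ i, Fin (n i) → ℂ) × ℂ) × ℂ => (p.1.1, p.2))
        (by fun_prop) fun p hp => ⟨hp.1.1, hp.2⟩
    convert hK'.of_isClosed_subset hcl Set.inter_subset_left using 1
    ext p
    constructor
    · rintro ⟨h1, h2, h3⟩
      refine ⟨⟨⟨h1, mem_closedBall_zero_iff.2 ?_⟩, h2⟩, sub_eq_zero.2 h3⟩
      have h4 := hR (p.1.1, p.2) ⟨h1, h2⟩
      rw [← h3, norm_pow] at h4
      -- From `2 ‖w‖ ≤ ‖w‖² + 1` and `‖w‖² ≤ R`.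
      nlinarith [sq_nonneg (‖p.1.2‖ - 1), norm_nonneg p.1.2]
    · rintro ⟨⟨⟨h1, -⟩, h2⟩, h3⟩
      exact ⟨h1, h2, sub_eq_zero.1 h3⟩
  have himage : {p : (lineBundle n d).TotalSpace × ℂ | p.2 ∈ K ∧ p.1 ∈ doubleCover d (γ p.2)} =
      ⋃ J, (fun p : ((∀ i, Fin (n i) → ℂ) × ℂ) × ℂ => ((lineCoord d J).symm p.1, p.2)) '' Q J := by
    ext ⟨e, ζ⟩
    simp only [Set.mem_iUnion]
    constructor
    · rintro ⟨h1, h2⟩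
      obtain ⟨J, hJ, hn⟩ := exists_mem_affineOpen_norm_le e.proj
      refine ⟨J, (lineCoord d J e, ζ), ⟨mem_closedBall_zero_iff.2 hn, h1,
        (mem_doubleCover_iff_local (hγ ζ) hJ).1 h2⟩, ?_⟩
      exact Prod.ext ((lineCoord d J).left_inv (mem_lineCoord_source.2 hJ)) rfl
    · rintro ⟨J, ⟨p, ζ'⟩, ⟨-, h2, h3⟩, h4⟩
      obtain ⟨rfl, rfl⟩ := Prod.ext_iff.1 h4
      refine ⟨h2, (mem_doubleCover_iff_local (hγ _)
        (mem_lineCoord_source.1 (lineCoord_symm_mem_source J p))).2 ?_⟩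
      rw [lineCoord_lineCoord_symm]
      exact h3
  rw [himage]
  exact isCompact_iUnion fun J => (hQ J).image
    (((continuous_lineCoord_symm d J).comp continuous_fst).prodMk continuous_snd)

lemma isCompact_doubleCover {t : MvPolynomial (Σ i, Fin (n i + 1)) ℂ}
    (ht : t ∈ sections n (2 • d)) : IsCompact (doubleCover d t) := by
  have h := (isCompact_family (d := d) (isCompact_singleton (x := (0 : ℂ))) (γ := fun _ => t)
    (fun _ => ht) fun J =>
      ((contDiff_localFun J t).continuous.comp continuous_fst).continuousOn).image continuous_fst
  convert h using 1
  ext e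
  constructor
  · intro he
    exact ⟨(e, 0), ⟨rfl, he⟩, rfl⟩
  · rintro ⟨p, ⟨-, hp⟩, rfl⟩
    exact hp

/-- A continuous local square root with a given value. -/
lemma exists_continuousAt_sqrt {X : Type*} [TopologicalSpace X] {f : X → ℂ} {x : X}
    (hf : ContinuousAt f x) {w : ℂ} (hw : w ≠ 0) (hwx : w ^ 2 = f x) :
    ∃ g : X → ℂ, ContinuousAt g x ∧ g x = w ∧ ∀ y, g y ^ 2 = f y := by
  -- Division by `w²` moves the value at `x` to `1`, where the principal branch of the square root
  -- is continuous.
  refine ⟨fun y => w * (f y / w ^ 2) ^ (1 / 2 : ℂ), ?_, ?_, fun y => ?_⟩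
  · refine continuousAt_const.mul (ContinuousAt.cpow (hf.div_const _) continuousAt_const ?_)
    rw [← hwx, div_self (pow_ne_zero 2 hw)]
    exact Complex.one_mem_slitPlane
  · simp [← hwx, div_self (pow_ne_zero 2 hw)]
  · rw [mul_pow, ← Complex.cpow_nat_mul]
    norm_num
    exact mul_div_cancel₀ _ (pow_ne_zero 2 hw)

/-- The double cover of a connected manifold with nonempty branch locus is connected. -/
lemma isConnected_doubleCover {t : MvPolynomial (Σ i, Fin (n i + 1)) ℂ}
    (ht : t ∈ sections n (2 • d)) {z₀ : MultiProj n} (hz₀ : MvPolynomial.eval (coords z₀) t = 0) :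
    IsConnected (doubleCover d t) := by
  have hcomp : CompactSpace (doubleCover d t) := isCompact_iff_compactSpace.1 (isCompact_doubleCover ht)
  let f : doubleCover d t → MultiProj n := fun e => e.1.proj
  have hf : Continuous f := continuous_proj.comp continuous_subtype_val
  have hmem : ∀ {J : ∀ i, Fin (n i + 1)} {z : MultiProj n} (_ : z ∈ affineOpen J) {w : ℂ},
      w ^ 2 = localFun J t (affineChart J z) →
        (lineCoord d J).symm (affineChart J z, w) ∈ doubleCover d t := by
    intro J z hz w hw
    refine (mem_doubleCover_iff_local ht (J := J) ?_).2 ?_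
    · rwa [proj_lineCoord_symm hz]
    · rwa [lineCoord_lineCoord_symm]
  -- Over a zero of `t` the equation `w² = 0` leaves a single point.
  have hfib : ∀ z, MvPolynomial.eval (coords z) t = 0 → IsPreconnected (f ⁻¹' {z}) := by
    intro z hz
    refine Set.Subsingleton.isPreconnected ?_
    rintro ⟨e, he⟩ hez ⟨e', he'⟩ hez'
    obtain ⟨J, hJ⟩ := exists_mem_affineOpen z
    have h1 : e.proj = z := hez
    have h2 : e'.proj = z := hez'
    have hw : ∀ e : (lineBundle n d).TotalSpace, e ∈ doubleCover d t → e.proj = z →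
        (lineCoord d J e).2 = 0 := by
      intro e he hez
      have := (mem_doubleCover_iff_local ht (hez ▸ hJ)).1 he
      rw [lineCoord_fst, hez, (eval_coords_eq_zero_iff ht hJ).1 hz] at this
      exact eq_zero_of_pow_eq_zero this
    exact Subtype.ext (eq_of_lineCoord_eq (h2 ▸ hJ) (h1.trans h2.symm)
      ((hw e he h1).trans (hw e' he' h2).symm))
  refine isConnected_iff_connectedSpace.2 (connectedSpace_of_isClosedMap (f := f) hf.isClosedMap
    (fun z => ?_) (hfib z₀ hz₀) fun x => ?_)
  · obtain ⟨J, hJ⟩ := exists_mem_affineOpen z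
    obtain ⟨w, hw⟩ := IsAlgClosed.exists_pow_nat_eq (localFun J t (affineChart J z)) zero_lt_two
    exact ⟨⟨_, hmem hJ hw⟩, proj_lineCoord_symm hJ w⟩
  · obtain ⟨e, he⟩ := x
    obtain ⟨J, hJ⟩ := exists_mem_affineOpen e.proj
    by_cases hz : MvPolynomial.eval (coords e.proj) t = 0
    · exact Or.inr (hfib _ hz)
    left
    have he2 := (mem_doubleCover_iff_local ht hJ).1 he
    have hchart : ContinuousAt (affineChart J) e.proj :=
      (affineChart J).continuousAt (by rw [affineChart_source]; exact hJ)
    have hw : (lineCoord d J e).2 ≠ 0 := by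
      intro h
      rw [h] at he2
      exact hz ((eval_coords_eq_zero_iff ht hJ).2 (he2.symm.trans (by simp)))
    obtain ⟨g, hg, hge, hg2⟩ := exists_continuousAt_sqrt
      (f := fun z => localFun J t (affineChart J z))
      ((contDiff_localFun J t).continuous.continuousAt.comp hchart) hw he2
    classical
    -- Away from the branch locus a local continuous square root gives a section through `e`, so the
    -- projection is open there. Outside the chart the section has a default value.
    let s : MultiProj n → doubleCover d t := fun z =>
      if hz : z ∈ affineOpen J then ⟨_, hmem hz (hg2 z)⟩ else ⟨e, he⟩
    have hse : s e.proj = ⟨e, he⟩ := by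
      simp only [s, dif_pos hJ]
      refine Subtype.ext ?_
      change (lineCoord d J).symm (affineChart J e.proj, g e.proj) = e
      rw [hge]
      exact (lineCoord d J).left_inv (mem_lineCoord_source.2 hJ)
    have hev : ∀ᶠ z in 𝓝 e.proj, z ∈ affineOpen J := (isOpen_affineOpen J).mem_nhds hJ
    have hscont : ContinuousAt s e.proj := by
      rw [Topology.IsInducing.subtypeVal.continuousAt_iff]
      have : ContinuousAt (fun z => (lineCoord d J).symm (affineChart J z, g z)) e.proj :=
        (continuous_lineCoord_symm d J).continuousAt.comp (hchart.prodMk hg)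
      refine this.congr ?_
      filter_upwards [hev] with z hz
      simp [s, dif_pos hz]
    intro N hN
    have hN' : s ⁻¹' (f ⁻¹' N) ∈ 𝓝 e.proj := hscont.preimage_mem_nhds (hse ▸ hN)
    filter_upwards [hN', hev] with z hz hzJ
    have : f (s z) = z := by
      simp only [s, dif_pos hzJ]
      exact proj_lineCoord_symm hzJ _
    rw [← this]
    exact hz

end MultiProj

/-! ### General members of the linear systems -/

section Decomposition

open MvPolynomial

variable {σ B : Type*} [DecidableEq B]

/-- The blocks after adjoining one block of `m` new variables. -/
def extendBlocks (β : σ → B) (m : ℕ) : σ ⊕ Fin m → Option B := Sum.elim (fun k => some (β k)) fun _ => none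

/-- The multidegree `(D, e)`. -/
def extendDegree (D : B → ℕ) (e : ℕ) : Option B → ℕ := fun b => b.elim e D

lemma weight_extendBlocks [Fintype σ] (β : σ → B) {m : ℕ} {D : B → ℕ} {e : ℕ} {c : σ ⊕ Fin m →₀ ℕ}
    (hc : Finsupp.weight (blockWeight (extendBlocks β m)) c = extendDegree D e) :
    (∀ b, ∑ k with β k = b, c (Sum.inl k) = D b) ∧ ∑ l, c (Sum.inr l) = e := by
  classical
  constructor
  · intro b
    have := congrFun hc (some b)
    rw [weight_blockWeight_apply, Finset.sum_filter, Fintype.sum_sum_type] at this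
    simpa [extendBlocks, extendDegree, Finset.sum_filter] using this
  · have := congrFun hc none
    rw [weight_blockWeight_apply, Finset.sum_filter, Fintype.sum_sum_type] at this
    simpa [extendBlocks, extendDegree] using this

lemma isWeightedHomogeneous_extend_iff [Fintype σ] (β : σ → B) {m : ℕ} {D : B → ℕ} {e : ℕ}
    (c : σ ⊕ Fin m →₀ ℕ) :
    Finsupp.weight (blockWeight (extendBlocks β m)) c = extendDegree D e ↔
    (∀ b, ∑ k with β k = b, c (Sum.inl k) = D b) ∧ ∑ l, c (Sum.inr l) = e := by
  classical
  refine ⟨weight_extendBlocks β, fun h => ?_⟩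
  ext (_ | b)
  · rw [weight_blockWeight_apply, Finset.sum_filter, Fintype.sum_sum_type]
    simpa [extendBlocks, extendDegree] using h.2
  · rw [weight_blockWeight_apply, Finset.sum_filter, Fintype.sum_sum_type]
    simpa [extendBlocks, extendDegree, Finset.sum_filter] using h.1 b

/-- Specialisation of the last block of variables. -/
def specialize {m : ℕ} (y : Fin m → ℂ) : MvPolynomial (σ ⊕ Fin m) ℂ →ₐ[ℂ] MvPolynomial σ ℂ :=
  aeval (Sum.elim X fun l => C (y l))

omit [DecidableEq B] in
lemma eval_specialize {m : ℕ} (y : Fin m → ℂ) (v : σ → ℂ) (s : MvPolynomial (σ ⊕ Fin m) ℂ) :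
    eval v (specialize y s) = eval (Sum.elim v y) s := by
  have : (eval v).comp (specialize (σ := σ) y : MvPolynomial (σ ⊕ Fin m) ℂ →+* _) =
      eval (Sum.elim v y) := by
    ext k
    · simp [specialize]
    · rcases k with k | l <;> simp [specialize]
  exact DFunLike.congr_fun this s

lemma specialize_rename {m : ℕ} (y : Fin m → ℂ) (A : MvPolynomial σ ℂ) :
    specialize y (rename Sum.inl A) = A := by
  rw [specialize, aeval_rename]
  exact aeval_X_left_apply A

lemma isWeightedHomogeneous_specialize [Fintype σ] {β : σ → B} {m : ℕ} {D : B → ℕ} {e : ℕ}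
    {s : MvPolynomial (σ ⊕ Fin m) ℂ}
    (hs : IsWeightedHomogeneous (blockWeight (extendBlocks β m)) s (extendDegree D e))
    (y : Fin m → ℂ) : IsWeightedHomogeneous (blockWeight β) (specialize y s) D := by
  rw [specialize, aeval_def, eval₂_eq']
  refine IsWeightedHomogeneous.sum _ _ _ fun c hc => ?_
  obtain ⟨h1, -⟩ := weight_extendBlocks β (hs (mem_support_iff.1 hc))
  rw [Fintype.prod_sum_type, ← mul_assoc, mul_comm, ← mul_assoc]
  simp only [Sum.elim_inl, Sum.elim_inr, ← map_pow, ← map_prod, algebraMap_eq, ← C_mul]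
  refine IsWeightedHomogeneous.C_mul ?_ _
  have h2 := IsWeightedHomogeneous.prod (R := ℂ) (w := blockWeight β) Finset.univ
    (fun k => X k ^ c (Sum.inl k)) (fun k => c (Sum.inl k) • blockWeight β k)
    (fun k _ => (isWeightedHomogeneous_X ℂ (blockWeight β) k).pow _)
  convert h2 using 1
  ext b
  rw [← h1 b, Finset.sum_apply, Finset.sum_filter]
  refine Finset.sum_congr rfl fun k _ => ?_
  by_cases h : β k = b
  · subst h; simp [blockWeight]
  · simp [blockWeight, h, Ne.symm h]

lemma isWeightedHomogeneous_rename_mul [Fintype σ] {β : σ → B} {m : ℕ} {D : B → ℕ} {e : ℕ}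
    {A : MvPolynomial σ ℂ} (hA : IsWeightedHomogeneous (blockWeight β) A D)
    {q : MvPolynomial (σ ⊕ Fin m) ℂ}
    (hq : IsWeightedHomogeneous (blockWeight (extendBlocks β m)) q (extendDegree 0 e)) :
    IsWeightedHomogeneous (blockWeight (extendBlocks β m)) (rename Sum.inl A * q)
      (extendDegree D e) := by
  have h1 : IsWeightedHomogeneous (blockWeight (extendBlocks β m)) (rename (Sum.inl : σ → σ ⊕ Fin m) A)
      (extendDegree D 0) := by
    intro c hc
    obtain ⟨c', rfl, hc'⟩ := coeff_rename_ne_zero _ _ _ hc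
    rw [isWeightedHomogeneous_extend_iff, ← hA hc']
    constructor
    · intro b
      rw [weight_blockWeight_apply]
      refine Finset.sum_congr rfl fun k _ => ?_
      exact Finsupp.mapDomain_apply Sum.inl_injective _ _
    · refine Finset.sum_eq_zero fun l _ => ?_
      exact Finsupp.mapDomain_of_notMem_range _ _ (by simp)
  have h2 := h1.mul hq
  convert h2 using 1
  ext (_ | b) <;> simp [extendDegree]

lemma isWeightedHomogeneous_X_inr (β : σ → B) {m : ℕ} (l : Fin m) :
    IsWeightedHomogeneous (blockWeight (extendBlocks β m)) (X (Sum.inr l) : MvPolynomial _ ℂ)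
      (extendDegree 0 1) := by
  convert isWeightedHomogeneous_X ℂ (blockWeight (extendBlocks β m)) (Sum.inr l) using 1
  ext (_ | b) <;> simp [extendDegree, blockWeight, extendBlocks]

/-- The polynomial `A x² + B x y + C y²`. -/
def binaryQuadratic (A : Fin 3 → MvPolynomial σ ℂ) : MvPolynomial (σ ⊕ Fin 2) ℂ :=
  rename Sum.inl (A 0) * X (Sum.inr 0) ^ 2 +
    rename Sum.inl (A 1) * (X (Sum.inr 0) * X (Sum.inr 1)) +
    rename Sum.inl (A 2) * X (Sum.inr 1) ^ 2

/-- The polynomial `λ A + μ B + ν C`. -/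
def netPolynomial (A : Fin 3 → MvPolynomial σ ℂ) : MvPolynomial (σ ⊕ Fin 3) ℂ :=
  ∑ j, rename Sum.inl (A j) * X (Sum.inr j)

/-- The coefficients `A`, `B`, `C` of `A x² + B x y + C y²`. -/
def quadCoeff (j : Fin 3) : MvPolynomial (σ ⊕ Fin 2) ℂ →ₗ[ℂ] MvPolynomial σ ℂ :=
  match j with
  | 0 => (specialize ![1, 0]).toLinearMap
  -- At `[1 : 1]` the form takes the value `A + B + C`.
  | 1 => (specialize ![1, 1]).toLinearMap - (specialize ![1, 0]).toLinearMap -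
      (specialize ![0, 1]).toLinearMap
  | 2 => (specialize ![0, 1]).toLinearMap

omit [DecidableEq B] in
lemma quadCoeff_binaryQuadratic (A : Fin 3 → MvPolynomial σ ℂ) (j : Fin 3) :
    quadCoeff j (binaryQuadratic A) = A j := by
  have hX : ∀ (y : Fin 2 → ℂ) (l : Fin 2), specialize (σ := σ) y (X (Sum.inr l)) = C (y l) := by
    intro y l; simp [specialize]
  fin_cases j
  · simp [quadCoeff, binaryQuadratic, specialize_rename, hX]
  · simp [quadCoeff, binaryQuadratic, specialize_rename, hX]
    ring
  · simp [quadCoeff, binaryQuadratic, specialize_rename, hX]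

lemma isWeightedHomogeneous_quadCoeff [Fintype σ] {β : σ → B} {D : B → ℕ} {e : ℕ}
    {s : MvPolynomial (σ ⊕ Fin 2) ℂ}
    (hs : IsWeightedHomogeneous (blockWeight (extendBlocks β 2)) s (extendDegree D e)) (j : Fin 3) :
    IsWeightedHomogeneous (blockWeight β) (quadCoeff j s) D := by
  have := isWeightedHomogeneous_specialize hs
  fin_cases j
  · exact this _
  · exact ((this _).sub (this _)).sub (this _)
  · exact this _

lemma isWeightedHomogeneous_binaryQuadratic [Fintype σ] {β : σ → B} {D : B → ℕ}
    {A : Fin 3 → MvPolynomial σ ℂ} (hA : ∀ j, IsWeightedHomogeneous (blockWeight β) (A j) D) :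
    IsWeightedHomogeneous (blockWeight (extendBlocks β 2)) (binaryQuadratic A) (extendDegree D 2) := by
  have h2 : extendDegree (0 : B → ℕ) 1 + extendDegree 0 1 = extendDegree 0 2 := by
    ext (_ | b) <;> simp [extendDegree]
  have hq : ∀ l l' : Fin 2, IsWeightedHomogeneous (blockWeight (extendBlocks β 2))
      (X (Sum.inr l) * X (Sum.inr l') : MvPolynomial _ ℂ) (extendDegree 0 2) := fun l l' =>
    h2 ▸ (isWeightedHomogeneous_X_inr β l).mul (isWeightedHomogeneous_X_inr β l')
  unfold binaryQuadratic
  rw [sq, sq]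
  exact ((isWeightedHomogeneous_rename_mul (hA 0) (hq 0 0)).add
    (isWeightedHomogeneous_rename_mul (hA 1) (hq 0 1))).add
    (isWeightedHomogeneous_rename_mul (hA 2) (hq 1 1))

lemma isWeightedHomogeneous_netPolynomial [Fintype σ] {β : σ → B} {D : B → ℕ}
    {A : Fin 3 → MvPolynomial σ ℂ} (hA : ∀ j, IsWeightedHomogeneous (blockWeight β) (A j) D) :
    IsWeightedHomogeneous (blockWeight (extendBlocks β 3)) (netPolynomial A) (extendDegree D 1) :=
  IsWeightedHomogeneous.sum _ _ _ fun j _ =>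
    isWeightedHomogeneous_rename_mul (hA j) (isWeightedHomogeneous_X_inr β j)

omit [DecidableEq B] in
lemma eval_elim_eq_sum [Fintype σ] {m : ℕ} (v : σ → ℂ) (y : Fin m → ℂ)
    (s : MvPolynomial (σ ⊕ Fin m) ℂ) : eval (Sum.elim v y) s =
      ∑ c ∈ s.support, coeff c s * (∏ k, v k ^ c (Sum.inl k)) * ∏ l, y l ^ c (Sum.inr l) := by
  rw [eval_eq']
  refine Finset.sum_congr rfl fun c _ => ?_
  rw [Fintype.prod_sum_type, mul_assoc]
  rfl

/-- Degree `2` in the last block leaves only the exponents `(0, 2)`, `(1, 1)` and `(2, 0)`, and the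
identity can be checked on each monomial. -/
lemma eq_binaryQuadratic [Fintype σ] {β : σ → B} {D : B → ℕ} {s : MvPolynomial (σ ⊕ Fin 2) ℂ}
    (hs : IsWeightedHomogeneous (blockWeight (extendBlocks β 2)) s (extendDegree D 2)) :
    s = binaryQuadratic fun j => quadCoeff j s := by
  refine MvPolynomial.funext fun p => ?_
  obtain ⟨v, y, rfl⟩ : ∃ v y, p = Sum.elim v y := ⟨p ∘ Sum.inl, p ∘ Sum.inr, by simp⟩
  have hA : ∀ A : MvPolynomial σ ℂ, eval (Sum.elim v y) (rename Sum.inl A) = eval v A := by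
    intro A; rw [eval_rename]; rfl
  simp only [binaryQuadratic, map_add, map_mul, map_pow, hA, eval_X, Sum.elim_inr, quadCoeff,
    LinearMap.sub_apply, map_sub, AlgHom.toLinearMap_apply, eval_specialize, eval_elim_eq_sum,
    Finset.sum_mul, ← Finset.sum_sub_distrib, ← Finset.sum_add_distrib]
  refine Finset.sum_congr rfl fun c hc => ?_
  obtain ⟨-, h2⟩ := weight_extendBlocks β (hs (mem_support_iff.1 hc))
  simp only [Fin.prod_univ_two, Fin.sum_univ_two] at h2 ⊢
  have h3 : (c (Sum.inr 0) = 0 ∧ c (Sum.inr 1) = 2) ∨ (c (Sum.inr 0) = 1 ∧ c (Sum.inr 1) = 1) ∨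
      (c (Sum.inr 0) = 2 ∧ c (Sum.inr 1) = 0) := by omega
  rcases h3 with ⟨ha, hb⟩ | ⟨ha, hb⟩ | ⟨ha, hb⟩ <;> rw [ha, hb] <;> simp

lemma exists_eq_netPolynomial [Fintype σ] {β : σ → B} {D : B → ℕ} {t : MvPolynomial (σ ⊕ Fin 3) ℂ}
    (ht : IsWeightedHomogeneous (blockWeight (extendBlocks β 3)) t (extendDegree D 1)) :
    ∃ A : Fin 3 → MvPolynomial σ ℂ, (∀ j, IsWeightedHomogeneous (blockWeight β) (A j) D) ∧
      t = netPolynomial A := by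
  refine ⟨fun j => specialize (Pi.single j 1) t, fun j => isWeightedHomogeneous_specialize ht _,
    MvPolynomial.funext fun p => ?_⟩
  obtain ⟨v, y, rfl⟩ : ∃ v y, p = Sum.elim v y := ⟨p ∘ Sum.inl, p ∘ Sum.inr, by simp⟩
  have hA : ∀ A : MvPolynomial σ ℂ, eval (Sum.elim v y) (rename Sum.inl A) = eval v A := by
    intro A; rw [eval_rename]; rfl
  simp only [netPolynomial, Fin.sum_univ_three, map_add, map_mul, hA, eval_X, Sum.elim_inr,
    eval_specialize]
  simp only [eval_elim_eq_sum, Finset.sum_mul, ← Finset.sum_add_distrib]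
  refine Finset.sum_congr rfl fun c hc => ?_
  obtain ⟨-, h2⟩ := weight_extendBlocks β (ht (mem_support_iff.1 hc))
  simp only [Fin.prod_univ_three, Fin.sum_univ_three] at h2 ⊢
  have h3 : (c (Sum.inr 0) = 1 ∧ c (Sum.inr 1) = 0 ∧ c (Sum.inr 2) = 0) ∨
      (c (Sum.inr 0) = 0 ∧ c (Sum.inr 1) = 1 ∧ c (Sum.inr 2) = 0) ∨
      (c (Sum.inr 0) = 0 ∧ c (Sum.inr 1) = 0 ∧ c (Sum.inr 2) = 1) := by omega
  rcases h3 with ⟨ha, hb, hd⟩ | ⟨ha, hb, hd⟩ | ⟨ha, hb, hd⟩ <;> rw [ha, hb, hd] <;> simp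

omit [DecidableEq B] in
lemma pderiv_inr_rename {m : ℕ} (A : MvPolynomial σ ℂ) (l : Fin m) :
    pderiv (Sum.inr l) (rename (Sum.inl : σ → σ ⊕ Fin m) A) = 0 := by
  classical
  refine pderiv_eq_zero_of_notMem_vars fun h => ?_
  obtain ⟨k, -, hk⟩ := Finset.mem_image.1 (vars_rename _ _ h)
  exact Sum.inl_ne_inr hk

omit [DecidableEq B] in
lemma eval_pderiv_inl_rename {m : ℕ} (A : MvPolynomial σ ℂ) (k : σ) (v : σ → ℂ) (y : Fin m → ℂ) :
    eval (Sum.elim v y) (pderiv (Sum.inl k) (rename (Sum.inl : σ → σ ⊕ Fin m) A)) =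
      eval v (pderiv k A) := by
  rw [pderiv_rename Sum.inl_injective, eval_rename]
  rfl

omit [DecidableEq B] in
lemma eval_binaryQuadratic (A : Fin 3 → MvPolynomial σ ℂ) (v : σ → ℂ) (y : Fin 2 → ℂ) :
    eval (Sum.elim v y) (binaryQuadratic A) = eval v (A 0) * y 0 ^ 2 +
      eval v (A 1) * (y 0 * y 1) + eval v (A 2) * y 1 ^ 2 := by
  have hA : ∀ A : MvPolynomial σ ℂ, eval (Sum.elim v y) (rename Sum.inl A) = eval v A := by
    intro A; rw [eval_rename]; rfl
  simp [binaryQuadratic, hA]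

omit [DecidableEq B] in
lemma eval_pderiv_inl_binaryQuadratic (A : Fin 3 → MvPolynomial σ ℂ) (k : σ) (v : σ → ℂ)
    (y : Fin 2 → ℂ) :
    eval (Sum.elim v y) (pderiv (Sum.inl k) (binaryQuadratic A)) = eval v (pderiv k (A 0)) * y 0 ^ 2 +
      eval v (pderiv k (A 1)) * (y 0 * y 1) + eval v (pderiv k (A 2)) * y 1 ^ 2 := by
  simp [binaryQuadratic, pderiv_X_of_ne, eval_pderiv_inl_rename]
  ring

omit [DecidableEq B] in
lemma eval_pderiv_inr_binaryQuadratic (A : Fin 3 → MvPolynomial σ ℂ) (v : σ → ℂ) (y : Fin 2 → ℂ) :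
    eval (Sum.elim v y) (pderiv (Sum.inr 0) (binaryQuadratic A)) =
        2 * eval v (A 0) * y 0 + eval v (A 1) * y 1 ∧
      eval (Sum.elim v y) (pderiv (Sum.inr 1) (binaryQuadratic A)) =
        eval v (A 1) * y 0 + 2 * eval v (A 2) * y 1 := by
  classical
  have hA : ∀ A : MvPolynomial σ ℂ, eval (Sum.elim v y) (rename Sum.inl A) = eval v A := by
    intro A; rw [eval_rename]; rfl
  constructor
  · simp [binaryQuadratic, pderiv_inr_rename, hA]
    ring
  · simp [binaryQuadratic, pderiv_inr_rename, hA]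
    ring

omit [DecidableEq B] in
lemma eval_pderiv_inl_netPolynomial (A : Fin 3 → MvPolynomial σ ℂ) (k : σ) (v : σ → ℂ)
    (y : Fin 3 → ℂ) :
    eval (Sum.elim v y) (pderiv (Sum.inl k) (netPolynomial A)) =
      ∑ j, eval v (pderiv k (A j)) * y j := by
  simp [netPolynomial, pderiv_X_of_ne, eval_pderiv_inl_rename, mul_comm]

omit [DecidableEq B] in
lemma eval_pderiv_inr_netPolynomial (A : Fin 3 → MvPolynomial σ ℂ) (v : σ → ℂ) (y : Fin 3 → ℂ)
    (j : Fin 3) : eval (Sum.elim v y) (pderiv (Sum.inr j) (netPolynomial A)) = eval v (A j) := by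
  classical
  have hA : ∀ A : MvPolynomial σ ℂ, eval (Sum.elim v y) (rename Sum.inl A) = eval v A := by
    intro A; rw [eval_rename]; rfl
  simp only [netPolynomial, map_sum, pderiv_mul, pderiv_inr_rename, zero_mul, zero_add, map_mul, hA]
  rw [Finset.sum_eq_single j]
  · simp
  · intro l _ hl
    rw [pderiv_X_of_ne (fun h => hl (Sum.inr_injective h))]
    simp
  · simp

/-- The divisor `A x² + B x y + C y² = 0` is smooth, and `A = B = C = 0` is a transversal
intersection. -/
structure IsRegularNet (β : σ → B) (A : Fin 3 → MvPolynomial σ ℂ) : Prop where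
  smooth : ∀ v, BlockNonzero β v → ∀ y : Fin 2 → ℂ, y ≠ 0 →
    ∃ k, eval (Sum.elim v y) (pderiv k (binaryQuadratic A)) ≠ 0
  transversal : ∀ v, BlockNonzero β v → (∀ j, eval v (A j) = 0) → ∀ y : Fin 3 → ℂ,
    (∀ k, ∑ j, eval v (pderiv k (A j)) * y j = 0) → y = 0

omit [DecidableEq B] in
lemma blockNonzero_extendBlocks {β : σ → B} {m : ℕ} {v : σ → ℂ} {y : Fin m → ℂ} :
    BlockNonzero (extendBlocks β m) (Sum.elim v y) ↔ BlockNonzero β v ∧ y ≠ 0 := by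
  constructor
  · intro h
    refine ⟨fun b => ?_, fun hy => ?_⟩
    · obtain ⟨k | l, h1, h2⟩ := h (some b)
      · exact ⟨k, Option.some_injective _ h1, h2⟩
      · simp [extendBlocks] at h1
    · obtain ⟨k | l, h1, h2⟩ := h none
      · simp [extendBlocks] at h1
      · simp [hy] at h2
  · rintro ⟨h1, h2⟩ (_ | b)
    · obtain ⟨l, hl⟩ := Function.ne_iff.1 h2
      exact ⟨Sum.inr l, rfl, hl⟩
    · obtain ⟨k, hk, hv⟩ := h1 b
      exact ⟨Sum.inl k, by simp [extendBlocks, hk], hv⟩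

omit [DecidableEq B] in
lemma surjective_extendBlocks {β : σ → B} (hβ : Function.Surjective β) (m : ℕ) [NeZero m] :
    Function.Surjective (extendBlocks β m) := by
  rintro (_ | b)
  · exact ⟨Sum.inr 0, rfl⟩
  · obtain ⟨k, rfl⟩ := hβ b
    exact ⟨Sum.inl k, rfl⟩

omit [DecidableEq B] in
lemma one_le_extendDegree {D : B → ℕ} (hD : ∀ b, 1 ≤ D b) {e : ℕ} (he : 1 ≤ e) (b : Option B) :
    1 ≤ extendDegree D e b := by
  cases b with
  | none => exact he
  | some b => exact hD b

/-- Two nonzero polynomials have a common nonzero. -/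
lemma exists_evalDual_ne_zero {W : Type*} [AddCommGroup W] [Module ℂ W]
    {G₁ G₂ : MvPolynomial (Module.Dual ℂ W) ℂ} {w₁ w₂ : W} (h₁ : evalDual G₁ w₁ ≠ 0)
    (h₂ : evalDual G₂ w₂ ≠ 0) : ∃ w, evalDual (G₁ * G₂) w ≠ 0 := by
  -- Both polynomials are restricted to the line through `w₁` and `w₂`, where they are nonzero
  -- polynomials in one variable.
  obtain ⟨P₁, hP₁⟩ := exists_polynomial_curve G₁ w₁ (w₂ - w₁) 0
  obtain ⟨P₂, hP₂⟩ := exists_polynomial_curve G₂ w₁ (w₂ - w₁) 0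
  have h1 : P₁ ≠ 0 := by
    rintro rfl
    refine h₁ ?_
    have := (hP₁ 0).symm
    simpa using this
  have h2 : P₂ ≠ 0 := by
    rintro rfl
    refine h₂ ?_
    have := (hP₂ 1).symm
    simpa using this
  by_contra! h
  refine mul_ne_zero h1 h2 (Polynomial.funext fun x => ?_)
  rw [Polynomial.eval_mul, hP₁, hP₂, Polynomial.eval_zero, ← h (w₁ + x • (w₂ - w₁) + x ^ 2 • 0)]
  exact (map_mul _ _ _).symm

lemma isZariskiOpen_ne_zero {W : Type*} [AddCommGroup W] [Module ℂ W]
    (G : MvPolynomial (Module.Dual ℂ W) ℂ) : IsZariskiOpen {w | evalDual G w ≠ 0} :=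
  ⟨{G}, by simp⟩

/-- The general divisor of multidegree `D` is smooth. -/
theorem exists_smooth_divisor_polynomial [Fintype σ] [Fintype B] [Nonempty B] {β : σ → B}
    (hβ : Function.Surjective β) {D : B → ℕ} (hD : ∀ b, 1 ≤ D b) :
    ∃ G : MvPolynomial (Module.Dual ℂ (weightedHomogeneousSubmodule ℂ (blockWeight β) D)) ℂ,
      (∃ t, evalDual G t ≠ 0) ∧ ∀ t, evalDual G t ≠ 0 → ∀ v, BlockNonzero β v →
        ∃ k, eval v (pderiv k t.1) ≠ 0 := by
  obtain ⟨t, ht, hsm⟩ := exists_smooth_divisor hβ hD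
  obtain ⟨G, hG, hG'⟩ := exists_elimination_polynomial β
    (W := weightedHomogeneousSubmodule ℂ (blockWeight β) D)
    (fun k => (pderiv k).toLinearMap ∘ₗ Submodule.subtype _) (fun k => D - blockWeight β k)
    (fun k t => isWeightedHomogeneous_pderiv t.2 k) ⟨t, ht⟩ hsm
  exact ⟨G, ⟨_, hG⟩, hG'⟩

/-- The general net of divisors of multidegree `D` is regular. -/
theorem exists_regularNet_polynomial [Fintype σ] [Fintype B] [Nonempty B] {β : σ → B}
    (hβ : Function.Surjective β) {D : B → ℕ} (hD : ∀ b, 1 ≤ D b)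
    (W : Submodule ℂ (MvPolynomial (σ ⊕ Fin 2) ℂ))
    (hW : ∀ s, s ∈ W ↔
      IsWeightedHomogeneous (blockWeight (extendBlocks β 2)) s (extendDegree D 2)) :
    ∃ G : MvPolynomial (Module.Dual ℂ W) ℂ, (∃ s, evalDual G s ≠ 0) ∧
      ∀ s, evalDual G s ≠ 0 → IsRegularNet β fun j => quadCoeff j s.1 := by
  classical
  obtain ⟨s₁, hs₁, hsm₁⟩ := exists_smooth_divisor (surjective_extendBlocks hβ 2)
    (one_le_extendDegree hD one_le_two)
  obtain ⟨G₁, hG₁, hG₁'⟩ := exists_elimination_polynomial (extendBlocks β 2) (W := W)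
    (fun k => (pderiv k).toLinearMap ∘ₗ Submodule.subtype _)
    (fun k => extendDegree D 2 - blockWeight (extendBlocks β 2) k)
    (fun k s => isWeightedHomogeneous_pderiv ((hW _).1 s.2) k) ⟨s₁, (hW _).2 hs₁⟩ hsm₁
  -- Transversality is recast as smoothness one dimension up. In the new variables the partial
  -- derivatives of `λ A + μ B + ν C` are `A`, `B`, `C`; in the old ones they are the combinations
  -- of the differentials of `A`, `B`, `C` with coefficients `λ, μ, ν`. A singular point is a point
  -- of `A = B = C = 0` together with a linear relation between the differentials.
  obtain ⟨t, ht, hsm₂⟩ := exists_smooth_divisor (surjective_extendBlocks hβ 3)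
    (one_le_extendDegree hD le_rfl)
  obtain ⟨A, hA, rfl⟩ := exists_eq_netPolynomial ht
  -- The net polynomial depends linearly on `s`, so elimination applies on the same parameter space
  -- `W` as for the first condition.
  let Λ : W →ₗ[ℂ] MvPolynomial (σ ⊕ Fin 3) ℂ :=
    ∑ j, LinearMap.mulRight ℂ (X (Sum.inr j)) ∘ₗ (rename Sum.inl).toLinearMap ∘ₗ quadCoeff j ∘ₗ
      Submodule.subtype W
  have hΛ : ∀ s, Λ s = netPolynomial fun j => quadCoeff j s.1 := fun s => by
    simp [Λ, netPolynomial]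
  obtain ⟨G₂, hG₂, hG₂'⟩ := exists_elimination_polynomial (extendBlocks β 3) (W := W)
    (fun k => (pderiv k).toLinearMap ∘ₗ Λ)
    (fun k => extendDegree D 1 - blockWeight (extendBlocks β 3) k)
    (fun k s => by
      refine isWeightedHomogeneous_pderiv ?_ k
      rw [hΛ]
      exact isWeightedHomogeneous_netPolynomial
        (isWeightedHomogeneous_quadCoeff ((hW _).1 s.2)))
    ⟨binaryQuadratic A, (hW _).2 (isWeightedHomogeneous_binaryQuadratic hA)⟩
    (fun v hv => by
      obtain ⟨k, hk⟩ := hsm₂ v hv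
      refine ⟨k, ?_⟩
      simp only [LinearMap.comp_apply, hΛ, quadCoeff_binaryQuadratic]
      exact hk)
  refine ⟨G₁ * G₂, exists_evalDual_ne_zero hG₁ hG₂, fun s hs => ?_⟩
  rw [evalDual, map_mul] at hs
  constructor
  · intro v hv y hy
    rw [← eq_binaryQuadratic ((hW _).1 s.2)]
    exact hG₁' s (left_ne_zero_of_mul hs) _ (blockNonzero_extendBlocks.2 ⟨hv, hy⟩)
  · intro v hv hzero y hy
    by_contra hne
    obtain ⟨k | j, hk⟩ := hG₂' s (right_ne_zero_of_mul hs) _ (blockNonzero_extendBlocks.2 ⟨hv, hne⟩)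
    · refine hk ?_
      simp only [LinearMap.comp_apply, hΛ]
      exact (eval_pderiv_inl_netPolynomial _ k v y).trans (hy k)
    · refine hk ?_
      simp only [LinearMap.comp_apply, hΛ]
      exact (eval_pderiv_inr_netPolynomial _ v y j).trans (hzero j)

end Decomposition

/-! ### Sections of line bundles in affine coordinates -/

namespace MultiProj

open MvPolynomial

variable {r : ℕ} {n d : Fin r → ℕ}

lemma weight_weightProd_eq_iff (m : ℕ) (c : (Σ i, Fin (n i + 1)) ⊕ Fin 2 →₀ ℕ) :
    Finsupp.weight (weightProd n) c = (d, m) ↔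
      (∀ b, ∑ k with Sigma.fst k = b, c (Sum.inl k) = d b) ∧ ∑ l, c (Sum.inr l) = m := by
  rw [Finsupp.weight_apply, Finsupp.sum_fintype _ _ (by simp), Fintype.sum_sum_type, Prod.ext_iff]
  have h1 : (∑ k : Σ i, Fin (n i + 1), c (Sum.inl k) • weightProd n (Sum.inl k) +
      ∑ l : Fin 2, c (Sum.inr l) • weightProd n (Sum.inr l)).1 =
      fun b => ∑ k with Sigma.fst k = b, c (Sum.inl k) := by
    ext b
    simp only [weightProd, weight, Prod.fst_add, Prod.fst_sum, Sum.elim_inl, Sum.elim_inr,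
      Prod.smul_mk, smul_zero, Finset.sum_const_zero, add_zero, Finset.sum_apply, Pi.smul_apply,
      Pi.single_apply, Finset.sum_filter, smul_eq_mul, mul_ite, mul_one, mul_zero, eq_comm (a := b)]
  have h2 : (∑ k : Σ i, Fin (n i + 1), c (Sum.inl k) • weightProd n (Sum.inl k) +
      ∑ l : Fin 2, c (Sum.inr l) • weightProd n (Sum.inr l)).2 = ∑ l, c (Sum.inr l) := by
    simp [weightProd, Prod.snd_sum]
  rw [h1, h2, funext_iff]

/-- Translation between the grading by `(Fin r → ℕ) × ℕ` and the grading by blocks indexed by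
`Option (Fin r)`. -/
lemma mem_sectionsProd_iff (m : ℕ) (s : MvPolynomial ((Σ i, Fin (n i + 1)) ⊕ Fin 2) ℂ) :
    s ∈ sectionsProd n d m ↔
      IsWeightedHomogeneous (blockWeight (extendBlocks Sigma.fst 2)) s (extendDegree d m) := by
  rw [mem_weightedHomogeneousSubmodule]
  refine forall₂_congr fun c _ => ?_
  rw [weight_weightProd_eq_iff, isWeightedHomogeneous_extend_iff]

/-- A vector that is nonzero in each block gives homogeneous coordinates of a point. -/
lemma exists_point_of_blockNonzero {v : (Σ i, Fin (n i + 1)) → ℂ} (hv : BlockNonzero Sigma.fst v) :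
    ∃ (z : MultiProj n) (a : Fin r → ℂ), (∀ i, a i ≠ 0) ∧ coords z = fun k => a k.1 * v k := by
  have hne : ∀ i, (fun k => v ⟨i, k⟩) ≠ 0 := fun i h => by
    obtain ⟨⟨_, k⟩, rfl, hk⟩ := hv i
    exact hk (congrFun h k)
  choose a ha using fun i => Projectivization.exists_smul_eq_mk_rep ℂ _ (hne i)
  refine ⟨fun i => Projectivization.mk ℂ _ (hne i), fun i => a i, fun i => (a i).ne_zero, ?_⟩
  ext ⟨i, k⟩
  exact (congrFun (ha i) k).symm

/-- Three sections on a threefold have a common zero. -/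
lemma exists_common_zero_point (hn : ∑ i, n i = 3) (hd : ∀ i, 1 ≤ d i)
    {A : Fin 3 → MvPolynomial (Σ i, Fin (n i + 1)) ℂ} (hA : ∀ j, A j ∈ sections n d) :
    ∃ z : MultiProj n, ∀ j, eval (coords z) (A j) = 0 := by
  let J : Fin r → Σ i, Fin (n i + 1) := fun i => ⟨i, 0⟩
  -- The number of affine coordinates equals the number of sections, as `exists_common_zero`
  -- requires.
  have hcard : Fintype.card (AffineIndex Sigma.fst J) = 3 := by
    let e : AffineIndex Sigma.fst J ≃ Σ i, Fin (n i) :=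
      { toFun := fun k => ⟨k.1.1, k.1.2.pred fun h => k.2 (Sigma.ext rfl (heq_of_eq h.symm))⟩
        invFun := fun k => ⟨⟨k.1, k.2.succ⟩, fun h => by
          simp only [J, Sigma.mk.injEq, heq_eq_eq, true_and] at h
          exact Fin.succ_ne_zero _ h.symm⟩
        left_inv := fun k => by simp
        right_inv := fun k => by simp }
    rw [Fintype.card_congr e, Fintype.card_sigma]
    simpa using hn
  let e := Fintype.equivFinOfCardEq hcard
  obtain ⟨v, hv, hz⟩ := exists_common_zero (β := Sigma.fst) (J := J) (fun i => rfl) hd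
    (fun k => A (e k)) (fun k => hA (e k))
  obtain ⟨z, a, -, hza⟩ := exists_point_of_blockNonzero hv
  refine ⟨z, fun j => ?_⟩
  rw [hza, eval_smul_of_multihomogeneous (β := Sigma.fst) (hA j)]
  have := hz (e.symm j)
  rw [Equiv.apply_symm_apply] at this
  rw [this, mul_zero]

/-- Some section vanishes nowhere on a given finite set. -/
lemma exists_section_ne_zero {S : Set (MultiProj n)} (hS : S.Finite) (D : Fin r → ℕ) :
    ∃ t ∈ sections n D, ∀ z ∈ S, eval (coords z) t ≠ 0 := by
  have : Finite S := hS
  -- Evaluation at each point of `S` is a nonzero functional, as a corner monomial shows, and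
  -- finitely many nonzero functionals have a common nonzero vector.
  obtain ⟨t, ht, h⟩ := Module.Dual.exists_forall_mem_ne_zero_of_forall_exists (sections n D)
    (fun z : S => ((aeval (coords z.1) : MvPolynomial _ ℂ →ₐ[ℂ] ℂ).toLinearMap : Module.Dual ℂ _))
    (fun z => by
      obtain ⟨J, hJ⟩ := exists_mem_affineOpen z.1
      refine ⟨monomial (cornerExponent (fun i => ⟨i, J i⟩) D) 1,
        isWeightedHomogeneous_monomial _ _ _ (weight_cornerExponent (β := Sigma.fst) (fun i => rfl) D), ?_⟩
      rw [monomial_cornerExponent]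
      simp only [AlgHom.toLinearMap_apply, map_prod, map_pow, aeval_X]
      exact Finset.prod_ne_zero_iff.2 fun i _ => pow_ne_zero _ (hJ i))
  exact ⟨t, ht, fun z hz => h ⟨z, hz⟩⟩

lemma hasFDerivAt_eval {E σ : Type*} [NormedAddCommGroup E] [NormedSpace ℂ E] [Fintype σ]
    {v : E → σ → ℂ} {v' : σ → E →L[ℂ] ℂ} {u : E} (hv : ∀ k, HasFDerivAt (fun u => v u k) (v' k) u)
    (t : MvPolynomial σ ℂ) :
    HasFDerivAt (fun u => eval (v u) t) (∑ k, eval (v u) (pderiv k t) • v' k) u := by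
  classical
  induction t using MvPolynomial.induction_on with
  | C a =>
    refine ((hasFDerivAt_const a u).congr_fderiv ?_).congr_of_eventuallyEq
      (Filter.Eventually.of_forall fun u => eval_C a)
    ext w
    simp
  | add p q hp hq =>
    refine ((hp.fun_add hq).congr_fderiv ?_).congr_of_eventuallyEq
      (Filter.Eventually.of_forall fun u => map_add _ p q)
    ext w
    simp [add_mul, Finset.sum_add_distrib]
  | mul_X p l hp =>
    refine ((hp.fun_mul (hv l)).congr_fderiv ?_).congr_of_eventuallyEq
      (Filter.Eventually.of_forall fun u => by simp)
    ext w
    simp only [add_apply, smul_apply, sum_apply, pderiv_mul, map_add, map_mul, eval_X, add_mul,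
      Finset.sum_add_distrib, smul_eq_mul]
    rw [add_comm, Finset.mul_sum]
    congr 1
    · exact Finset.sum_congr rfl fun k _ => by ring
    · rw [Finset.sum_eq_single l]
      · simp
      · intro k _ hk
        rw [pderiv_X_of_ne (Ne.symm hk)]
        simp
      · simp

/-- The derivative of the normalised homogeneous coordinates. -/
def homogDeriv (J : ∀ i, Fin (n i + 1)) (k : Σ i, Fin (n i + 1)) : (∀ i, Fin (n i) → ℂ) →L[ℂ] ℂ :=
  ((J k.1).insertNth 0 (fun l => (ContinuousLinearMap.proj (R := ℂ) (φ := fun _ => ℂ) l).comp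
      (ContinuousLinearMap.proj (R := ℂ) (φ := fun i => Fin (n i) → ℂ) k.1)) :
    Fin (n k.1 + 1) → (∀ i, Fin (n i) → ℂ) →L[ℂ] ℂ) k.2

lemma hasFDerivAt_homog (J : ∀ i, Fin (n i + 1)) (k : Σ i, Fin (n i + 1)) (u : ∀ i, Fin (n i) → ℂ) :
    HasFDerivAt (fun u => homog J u k) (homogDeriv J k) u := by
  obtain ⟨i, k⟩ := k
  refine Fin.succAboveCases (J i) ?_ (fun l => ?_) k
  · simp only [homog_self, homogDeriv, Fin.insertNth_apply_same]
    exact hasFDerivAt_const _ _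
  · simp only [homog_succAbove, homogDeriv, Fin.insertNth_apply_succAbove]
    exact ((ContinuousLinearMap.proj (R := ℂ) (φ := fun _ => ℂ) l).comp
      (ContinuousLinearMap.proj (R := ℂ) (φ := fun i => Fin (n i) → ℂ) i)).hasFDerivAt

lemma fderiv_localFun_single (J : ∀ i, Fin (n i + 1)) (t : MvPolynomial (Σ i, Fin (n i + 1)) ℂ)
    (u : ∀ i, Fin (n i) → ℂ) (i : Fin r) (l : Fin (n i)) :
    fderiv ℂ (localFun J t) u (Pi.single i (Pi.single l 1)) =
      eval (homog J u) (pderiv ⟨i, (J i).succAbove l⟩ t) := by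
  have h : HasFDerivAt (localFun J t) _ u := hasFDerivAt_eval (fun k => hasFDerivAt_homog J k u) t
  rw [h.fderiv, sum_apply, Fintype.sum_sigma, Finset.sum_eq_single i]
  · rw [Fin.sum_univ_succAbove _ (J i), Finset.sum_eq_single l]
    · simp [homogDeriv]
    · intro l' _ hl
      simp [homogDeriv, hl]
    · simp
  · intro i' _ hi
    refine Finset.sum_eq_zero fun k _ => ?_
    refine Fin.succAboveCases (J i') ?_ (fun l => ?_) k <;> simp [homogDeriv, hi]
  · simp

/-- At a zero of a section, its partial derivatives vanish if the affine ones do. -/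
lemma eval_pderiv_eq_zero_of_fderiv_localFun {D : Fin r → ℕ}
    {t : MvPolynomial (Σ i, Fin (n i + 1)) ℂ} (ht : t ∈ sections n D) {J : ∀ i, Fin (n i + 1)}
    {u : ∀ i, Fin (n i) → ℂ} (h0 : localFun J t u = 0) (h1 : fderiv ℂ (localFun J t) u = 0)
    (k : Σ i, Fin (n i + 1)) : eval (homog J u) (pderiv k t) = 0 := by
  obtain ⟨i, k⟩ := k
  have hs : ∀ l, eval (homog J u) (pderiv ⟨i, (J i).succAbove l⟩ t) = 0 := fun l => by
    rw [← fderiv_localFun_single, h1, zero_apply]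
  refine Fin.succAboveCases (J i) ?_ hs k
  -- Euler's identity in the block `i` recovers the derivative along the coordinate that is
  -- normalised to `1`.
  have h := sum_block_mul_pderiv (β := Sigma.fst) ht i (homog J u)
  rw [show eval (homog J u) t = 0 from h0, mul_zero, Finset.sum_filter, Fintype.sum_sigma,
    Finset.sum_eq_single i] at h
  · rw [Fin.sum_univ_succAbove _ (J i), Finset.sum_eq_zero] at h
    · simpa [homog_self] using h
    · intro l _
      simp [hs]
  · intro i' _ hi
    exact Finset.sum_eq_zero fun l _ => if_neg hi
  · simp

lemma differentiableAt_localFun (J : ∀ i, Fin (n i + 1)) (t : MvPolynomial (Σ i, Fin (n i + 1)) ℂ)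
    (u : ∀ i, Fin (n i) → ℂ) : DifferentiableAt ℂ (localFun J t) u :=
  (contDiff_localFun J t).differentiable (by simp) u

/-- A smooth divisor has regular local equations. -/
lemma fderiv_localFun_ne_zero {D : Fin r → ℕ} {t : MvPolynomial (Σ i, Fin (n i + 1)) ℂ}
    (ht : t ∈ sections n D) (hsm : ∀ v, BlockNonzero Sigma.fst v → ∃ k, eval v (pderiv k t) ≠ 0)
    {J : ∀ i, Fin (n i + 1)} {u : ∀ i, Fin (n i) → ℂ} (h0 : localFun J t u = 0) :
    fderiv ℂ (localFun J t) u ≠ 0 := fun h1 => by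
  obtain ⟨k, hk⟩ := hsm _ (blockNonzero_homog J u)
  exact hk (eval_pderiv_eq_zero_of_fderiv_localFun ht h0 h1 k)

/-! ### Nets of divisors, their discriminant and their nodes. -/

section Net

variable {A : Fin 3 → MvPolynomial (Σ i, Fin (n i + 1)) ℂ}

lemma localFun_combination (J : ∀ i, Fin (n i + 1)) (y : Fin 3 → ℂ) :
    localFun J (∑ j, C (y j) * A j) = fun u => ∑ j, y j * localFun J (A j) u := by
  ext u
  simp [localFun]

lemma fderiv_localFun_combination (J : ∀ i, Fin (n i + 1)) (y : Fin 3 → ℂ) (u : ∀ i, Fin (n i) → ℂ) :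
    fderiv ℂ (localFun J (∑ j, C (y j) * A j)) u = ∑ j, y j • fderiv ℂ (localFun J (A j)) u := by
  rw [localFun_combination, fderiv_fun_sum fun j _ => (differentiableAt_localFun J _ u).const_mul _]
  exact Finset.sum_congr rfl fun j _ => fderiv_const_mul (differentiableAt_localFun J _ u) _

lemma combination_mem_sections (hA : ∀ j, A j ∈ sections n d) (y : Fin 3 → ℂ) :
    ∑ j, C (y j) * A j ∈ sections n d :=
  Submodule.sum_mem _ fun j _ => IsWeightedHomogeneous.C_mul (hA j) _

/-- The affine local equations of the smooth divisor `A x² + B x y + C y² = 0` are regular. -/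
lemma eq_zero_of_fderiv_binaryQuadratic (hreg : IsRegularNet Sigma.fst A) (hA : ∀ j, A j ∈ sections n d)
    {J : ∀ i, Fin (n i + 1)} {u : ∀ i, Fin (n i) → ℂ} {y : Fin 2 → ℂ}
    (h0 : 2 * localFun J (A 0) u * y 0 + localFun J (A 1) u * y 1 = 0)
    (h1 : localFun J (A 1) u * y 0 + 2 * localFun J (A 2) u * y 1 = 0)
    (h2 : ∀ w, y 0 ^ 2 * fderiv ℂ (localFun J (A 0)) u w + y 0 * y 1 * fderiv ℂ (localFun J (A 1)) u w +
      y 1 ^ 2 * fderiv ℂ (localFun J (A 2)) u w = 0) : y = 0 := by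
  by_contra hy
  obtain ⟨k | l, hk⟩ := hreg.smooth _ (blockNonzero_homog J u) y hy
  · refine hk ?_
    -- For fixed `y` the quadratic form is a section in the variables of `Z`. It vanishes at the
    -- point by Euler's identity in `y`.
    have h := eval_pderiv_eq_zero_of_fderiv_localFun
      (combination_mem_sections hA ![y 0 ^ 2, y 0 * y 1, y 1 ^ 2]) (J := J) (u := u)
      (by
        rw [localFun_combination]
        simp only [Fin.sum_univ_three, Matrix.cons_val]
        linear_combination (y 0 / 2) * h0 + (y 1 / 2) * h1)
      (by
        rw [fderiv_localFun_combination]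
        ext w
        simpa [Fin.sum_univ_three] using h2 w) k
    rw [eval_pderiv_inl_binaryQuadratic, ← h]
    simp [Fin.sum_univ_three, mul_comm]
  · have := eval_pderiv_inr_binaryQuadratic A (homog J u) y
    fin_cases l
    · exact hk (this.1.trans h0)
    · exact hk (this.2.trans h1)

/-- The differentials of `A`, `B`, `C` at a node form a basis. -/
lemma eq_zero_of_sum_smul_fderiv (hreg : IsRegularNet Sigma.fst A) (hA : ∀ j, A j ∈ sections n d)
    {J : ∀ i, Fin (n i + 1)} {u : ∀ i, Fin (n i) → ℂ} (h0 : ∀ j, localFun J (A j) u = 0)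
    {y : Fin 3 → ℂ} (hy : ∀ w, ∑ j, y j * fderiv ℂ (localFun J (A j)) u w = 0) : y = 0 := by
  refine hreg.transversal _ (blockNonzero_homog J u) h0 y fun k => ?_
  have h := eval_pderiv_eq_zero_of_fderiv_localFun (combination_mem_sections hA y) (J := J) (u := u)
    (by rw [localFun_combination]; simp [h0]) (by
      rw [fderiv_localFun_combination]
      ext w
      simpa using hy w) k
  rw [← h]
  simp [mul_comm]

/-- The discriminant `B² - 4 A C`. -/
def discr (A : Fin 3 → MvPolynomial (Σ i, Fin (n i + 1)) ℂ) : MvPolynomial (Σ i, Fin (n i + 1)) ℂ :=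
  A 1 ^ 2 - C 4 * (A 0 * A 2)

lemma discr_mem_sections (hA : ∀ j, A j ∈ sections n d) : discr A ∈ sections n (2 • d) := by
  have h : ∀ j k, A j * A k ∈ sections n (2 • d) := fun j k => by
    rw [two_smul]
    exact IsWeightedHomogeneous.mul (hA j) (hA k)
  rw [discr, sq]
  exact Submodule.sub_mem _ (h 1 1) (IsWeightedHomogeneous.C_mul (h 0 2) _)

lemma localFun_discr (J : ∀ i, Fin (n i + 1)) (u : ∀ i, Fin (n i) → ℂ) :
    localFun J (discr A) u = localFun J (A 1) u ^ 2 - 4 * (localFun J (A 0) u * localFun J (A 2) u) := by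
  simp [localFun, discr]

lemma fderiv_localFun_discr (J : ∀ i, Fin (n i + 1)) (u w : ∀ i, Fin (n i) → ℂ) :
    fderiv ℂ (localFun J (discr A)) u w =
      2 * localFun J (A 1) u * fderiv ℂ (localFun J (A 1)) u w -
        4 * localFun J (A 0) u * fderiv ℂ (localFun J (A 2)) u w -
        4 * localFun J (A 2) u * fderiv ℂ (localFun J (A 0)) u w := by
  have h := fun j => (differentiableAt_localFun J (A j) u).hasFDerivAt
  have h2 := ((h 1).fun_mul (h 1)).fun_sub (((h 0).fun_mul (h 2)).const_mul (4 : ℂ))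
  have h3 := h2.congr_of_eventuallyEq (f₁ := localFun J (discr A))
    (Filter.Eventually.of_forall fun u => by rw [localFun_discr, sq])
  rw [h3.fderiv]
  simp only [sub_apply, add_apply, smul_apply, smul_eq_mul]
  ring

/-- The discriminant is singular exactly at the nodes `A = B = C = 0`. -/
lemma eq_zero_of_fderiv_discr (hreg : IsRegularNet Sigma.fst A) (hA : ∀ j, A j ∈ sections n d)
    {J : ∀ i, Fin (n i + 1)} {u : ∀ i, Fin (n i) → ℂ} (h0 : localFun J (discr A) u = 0)
    (h1 : fderiv ℂ (localFun J (discr A)) u = 0) (j : Fin 3) : localFun J (A j) u = 0 := by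
  rw [localFun_discr] at h0
  have h1 : ∀ w, _ := fun w => (fderiv_localFun_discr J u w).symm.trans (by rw [h1, zero_apply])
  have hA0 : localFun J (A 0) u = 0 := by
    by_contra hne
    -- If `A ≠ 0`, the form has the double root `[-B : 2 A]` over a zero of the discriminant `Δ`. At
    -- this root its differential along `Z` is `-A dΔ + Δ dA`, which vanishes, so `Y` would be
    -- singular.
    have := eq_zero_of_fderiv_binaryQuadratic hreg hA (J := J) (u := u)
      (y := ![-localFun J (A 1) u, 2 * localFun J (A 0) u])
      (by simp; ring) (by simp; linear_combination -h0) (fun w => by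
        simp only [Matrix.cons_val_zero, Matrix.cons_val_one]
        linear_combination -localFun J (A 0) u * h1 w + fderiv ℂ (localFun J (A 0)) u w * h0)
    have := congrFun this 1
    simp [hne] at this
  have hA1 : localFun J (A 1) u = 0 := by
    rw [hA0] at h0
    simpa using h0
  have hA2 : localFun J (A 2) u = 0 := by
    by_contra hne
    -- With `A = B = 0` the differential of the discriminant is `-4 C dA`. If `C ≠ 0` then `dA = 0`,
    -- and `Y` would be singular at `[1 : 0]`.
    have hd : ∀ w, fderiv ℂ (localFun J (A 0)) u w = 0 := fun w => by
      simpa [hA0, hA1, hne] using h1 w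
    have := eq_zero_of_fderiv_binaryQuadratic hreg hA (J := J) (u := u) (y := ![1, 0])
      (by simp [hA0]) (by simp [hA1]) (by simp [hd])
    have := congrFun this 0
    simp at this
  fin_cases j <;> assumption

/-- The differential of `(A, B, C)` at a node. -/
def netDeriv (A : Fin 3 → MvPolynomial (Σ i, Fin (n i + 1)) ℂ) (J : ∀ i, Fin (n i + 1))
    (u : ∀ i, Fin (n i) → ℂ) : (∀ i, Fin (n i) → ℂ) →L[ℂ] (Fin 3 → ℂ) :=
  ContinuousLinearMap.pi fun j => fderiv ℂ (localFun J (A j)) u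

lemma finrank_affine (hn : ∑ i, n i = 3) : Module.finrank ℂ (∀ i, Fin (n i) → ℂ) = 3 := by
  rw [Module.finrank_pi_fintype]
  simpa using hn

/-- A functional that kills the range is a linear relation between the differentials of `A`, `B`,
`C`, which transversality excludes. Source and target both have dimension `3`. Hence `A`, `B`, `C`
are local coordinates at a node. -/
lemma bijective_netDeriv (hn : ∑ i, n i = 3) (hreg : IsRegularNet Sigma.fst A)
    (hA : ∀ j, A j ∈ sections n d) {J : ∀ i, Fin (n i + 1)} {u : ∀ i, Fin (n i) → ℂ}
    (h0 : ∀ j, localFun J (A j) u = 0) : Function.Bijective (netDeriv A J u) := by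
  have hsurj : Function.Surjective (netDeriv A J u : (∀ i, Fin (n i) → ℂ) →ₗ[ℂ] (Fin 3 → ℂ)) := by
    rw [← LinearMap.range_eq_top]
    by_contra hne
    obtain ⟨f, hf, hle⟩ := Submodule.exists_le_ker_of_lt_top _ (lt_top_iff_ne_top.2 hne)
    have hfx : ∀ x, f x = ∑ j, f (Pi.single j 1) * x j := fun x => by
      conv_lhs => rw [← Finset.univ_sum_single x]
      rw [map_sum]
      refine Finset.sum_congr rfl fun j _ => ?_
      rw [mul_comm, ← smul_eq_mul, ← map_smul, ← Pi.single_smul, smul_eq_mul, mul_one]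
    have := eq_zero_of_sum_smul_fderiv hreg hA h0 (y := fun j => f (Pi.single j 1)) (fun x => by
      have : f (netDeriv A J u x) = 0 := hle ⟨x, rfl⟩
      rw [hfx] at this
      simpa [netDeriv] using this)
    refine hf (LinearMap.ext fun x => ?_)
    rw [hfx]
    simp [funext_iff] at this
    simp [this]
  exact ⟨(LinearMap.injective_iff_surjective_of_finrank_eq_finrank
    (by rw [finrank_affine hn]; simp)).2 hsurj, hsurj⟩

/-- The set of nodes `A = B = C = 0`. -/
def nodes (A : Fin 3 → MvPolynomial (Σ i, Fin (n i + 1)) ℂ) : Set (MultiProj n) :=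
  {z | ∀ j, eval (coords z) (A j) = 0}

lemma mem_nodes_iff (hA : ∀ j, A j ∈ sections n d) {J : ∀ i, Fin (n i + 1)} {z : MultiProj n}
    (hz : z ∈ affineOpen J) : z ∈ nodes A ↔ ∀ j, localFun J (A j) (affineChart J z) = 0 :=
  forall_congr' fun j => eval_coords_eq_zero_iff (hA j) hz

/-- An infinite set of nodes would accumulate in the compact space `Z`. The limit would again be a
node, and nodes are isolated because the differential of `(A, B, C)` there is injective. -/
lemma finite_nodes (hn : ∑ i, n i = 3) (hreg : IsRegularNet Sigma.fst A)
    (hA : ∀ j, A j ∈ sections n d) : (nodes A).Finite := by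
  by_contra hinf
  obtain ⟨z, hz⟩ := Set.Infinite.exists_accPt_principal (s := nodes A) hinf
  obtain ⟨J, hJ⟩ := exists_mem_affineOpen z
  have hJ' : z ∈ (affineChart J).source := by rwa [affineChart_source]
  let F : (∀ i, Fin (n i) → ℂ) → Fin 3 → ℂ := fun u j => localFun J (A j) u
  have hF : HasFDerivAt F (netDeriv A J (affineChart J z)) (affineChart J z) :=
    hasFDerivAt_pi.2 fun j => (differentiableAt_localFun J _ _).hasFDerivAt
  have hfreq : ∃ᶠ z' in 𝓝[≠] z, z' ∈ nodes A := accPt_iff_frequently_nhdsNE.1 hz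
  have hchart : ∀ᶠ z' in 𝓝 z, z' ∈ (affineChart J).source := (affineChart J).open_source.mem_nhds hJ'
  have hcont : ContinuousAt (affineChart J) z := (affineChart J).continuousAt hJ'
  have hmem : ∀ z' ∈ (affineChart J).source, z' ∈ nodes A → F (affineChart J z') = 0 := by
    intro z' hz' h
    rw [affineChart_source] at hz'
    exact funext ((mem_nodes_iff hA hz').1 h)
  have h0 : F (affineChart J z) = 0 := by
    by_contra hne
    have h1 : ∀ᶠ z' in 𝓝 z, F (affineChart J z') ≠ 0 :=
      (ContinuousAt.comp (g := F) hF.continuousAt hcont).eventually_ne hne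
    obtain ⟨z', ⟨h2, h3⟩, h4⟩ := (((hfreq.filter_mono nhdsWithin_le_nhds).and_eventually h1).and_eventually
      hchart).exists
    exact h3 (hmem z' h4 h2)
  have hinj := (bijective_netDeriv hn hreg hA (J := J) (u := affineChart J z) (congrFun h0)).1
  obtain ⟨K, -, hK⟩ := (LinearMap.injective_iff_antilipschitz
    (netDeriv A J (affineChart J z)).toLinearMap).1 hinj
  have hev : ∀ᶠ u in 𝓝[≠] (affineChart J z), F u ≠ 0 := hF.eventually_ne ⟨K, hK⟩
  have hev' : ∀ᶠ z' in 𝓝 z, affineChart J z' ≠ affineChart J z → F (affineChart J z') ≠ 0 :=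
    hcont.eventually (eventually_nhdsWithin_iff.1 hev)
  obtain ⟨z', ⟨⟨h1, h2⟩, h3⟩, h4⟩ := (((hfreq.and_eventually
    (hev'.filter_mono nhdsWithin_le_nhds)).and_eventually
    (hchart.filter_mono nhdsWithin_le_nhds)).and_eventually self_mem_nhdsWithin).exists
  exact h2 (fun h => h4 ((affineChart J).injOn h3 hJ' h)) (hmem z' h3 h1)

end Net

end MultiProj

/-! ### A holomorphic disk that avoids finitely many values -/

/-- A quadratic curve through `0` and `1` that avoids finitely many values at the other points of a
strip around the real axis. -/
lemma exists_quadratic_avoiding {F : Set ℂ} (hF : F.Finite) (h1 : (1 : ℂ) ∉ F) :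
    ∃ q : Polynomial ℂ, q.eval 0 = 0 ∧ q.eval 1 = 1 ∧ q.derivative.eval 0 ≠ 0 ∧
      ∃ η > 0, ∀ x : ℂ, |x.im| < η → x ≠ 0 → q.eval x ≠ 0 ∧ q.eval x ∉ F := by
  -- For real `x` the value `x + i μ x (1 - x)` has real part `x`. It equals `f` only if `x = re f`
  -- and `μ (x - x²) = im f`, which excludes one value of `μ` for each `f` in `F`.
  obtain ⟨μ, hμ⟩ : ∃ μ : ℝ, μ ∉ (fun f : ℂ => f.im / (f.re - f.re ^ 2)) '' F :=
    (hF.image _).exists_notMem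
  let q : Polynomial ℂ := Polynomial.X + Polynomial.C (Complex.I * μ) * (Polynomial.X * (1 - Polynomial.X))
  have hq : ∀ x, q.eval x = x + Complex.I * μ * (x * (1 - x)) := fun x => by simp [q]
  have hqF : ∀ f ∈ insert 0 F, ∀ x : ℝ, (x : ℂ) ≠ 0 → q.eval (x : ℂ) ≠ f := by
    rintro f hf x hx h
    rw [hq] at h
    have hre : x = f.re := by rw [← h]; simp
    have him : μ * (x * (1 - x)) = f.im := by rw [← h]; simp
    rcases hf with rfl | hf
    · exact hx (by rw [hre]; simp)
    -- Here the excluded quotient has denominator zero and says nothing. For `x ≠ 0` this case means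
    -- `x = 1` and `f = 1`, which is not in `F`.
    · by_cases hz : x - x ^ 2 = 0
      · have him' : f.im = 0 := by rw [← him]; linear_combination μ * hz
        have hx1 : x = 1 := by
          have : x * (1 - x) = 0 := by linear_combination hz
          rcases mul_eq_zero.1 this with h | h
          · exact absurd (by rw [h]; simp) hx
          · linarith
        refine h1 ?_
        convert hf
        apply Complex.ext <;> simp [← hre, him', hx1]
      · refine hμ ⟨f, hf, ?_⟩
        change f.im / (f.re - f.re ^ 2) = μ
        rw [← hre, ← him, div_eq_iff hz]
        ring
  have hq0 : ∀ f, q - Polynomial.C f ≠ 0 := by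
    intro f h
    have h' : ∀ x, q.eval x = f := fun x => by
      have := congrArg (Polynomial.eval x) h
      simpa [sub_eq_zero] using this
    have := (h' 0).trans (h' 1).symm
    simp [hq] at this
  let S : Set ℂ := ⋃ f ∈ insert 0 F, {x | (q - Polynomial.C f).IsRoot x}
  have hS : (S \ {0}).Finite := (Set.Finite.biUnion (hF.insert 0) fun f _ =>
    Polynomial.finite_setOfPred_isRoot (hq0 f)).subset Set.sdiff_subset
  have hSim : ∀ x ∈ S \ {0}, 0 < |x.im| := by
    rintro x ⟨hx, hx0⟩
    rw [abs_pos]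
    intro him
    obtain ⟨f, hf, hxf⟩ := Set.mem_iUnion₂.1 hx
    have hxr : x = (x.re : ℂ) := Complex.ext rfl (by simp [him])
    refine hqF f hf x.re (by rw [← hxr]; exact hx0) ?_
    rw [← hxr]
    have : (q - Polynomial.C f).eval x = 0 := hxf
    simpa [sub_eq_zero] using this
  -- The parameters to be avoided, other than `0`, are finite in number and none is real, so a strip
  -- around the real axis misses them all.
  obtain ⟨η, hη, hηS⟩ : ∃ η > 0, ∀ x ∈ S \ {0}, η ≤ |x.im| := by
    by_cases hne : (S \ {0}).Nonempty
    · obtain ⟨x, hx, hmin⟩ := hS.exists_minimalFor (fun x => |x.im|) _ hne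
      exact ⟨|x.im|, hSim x hx, fun y hy => (le_total _ _).elim id fun h => hmin hy h⟩
    · exact ⟨1, one_pos, fun x hx => absurd ⟨x, hx⟩ hne⟩
  refine ⟨q, by simp [hq], by simp [hq], ?_, η, hη, fun x hx hx0 => ?_⟩
  · have : q.derivative.eval 0 = 1 + Complex.I * μ := by simp [q]
    rw [this]
    intro h
    have := congrArg Complex.re h
    simp at this
  · have : ∀ f ∈ insert 0 F, q.eval x ≠ f := fun f hf h => by
      refine absurd (hηS x ⟨Set.mem_iUnion₂.2 ⟨f, hf, ?_⟩, hx0⟩) (not_le.2 hx)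
      change (q - Polynomial.C f).eval x = 0
      simp [h]
    exact ⟨this 0 (Set.mem_insert _ _), fun h => this _ (Set.mem_insert_of_mem _ h) rfl⟩

/-- The unit disk maps onto a strip of given width around the real axis. -/
lemma exists_disk_to_strip {η : ℝ} (hη : 0 < η) :
    ∃ h : ℂ → ℂ, DifferentiableOn ℂ h (Metric.ball 0 1) ∧ h 0 = 0 ∧ deriv h 0 ≠ 0 ∧
      (∃ c ∈ Metric.ball (0 : ℂ) 1, h c = 1) ∧
      ∀ ζ ∈ Metric.ball (0 : ℂ) 1, |(h ζ).im| < η ∧ (ζ ≠ 0 → h ζ ≠ 0) := by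
  -- The map is `ε log ((1 + ζ) / (1 - ζ))`: the Cayley transform sends the disk to the right half
  -- plane, the logarithm sends that to `|Im| < π / 2`, and `ε` rescales the strip to `|Im| < η /
  -- 2`.
  let ε : ℝ := η / Real.pi
  have hε : 0 < ε := div_pos hη Real.pi_pos
  have hεC : (ε : ℂ) ≠ 0 := by exact_mod_cast hε.ne'
  let g : ℂ → ℂ := fun ζ => (1 + ζ) / (1 - ζ)
  have hne : ∀ ζ ∈ Metric.ball (0 : ℂ) 1, 1 - ζ ≠ 0 := by
    intro ζ hζ h
    rw [sub_eq_zero] at h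
    simp [← h] at hζ
  have hre : ∀ ζ ∈ Metric.ball (0 : ℂ) 1, 0 < (g ζ).re := by
    intro ζ hζ
    have h1 : Complex.normSq ζ < 1 := by
      rw [Complex.normSq_eq_norm_sq]
      rw [mem_ball_zero_iff] at hζ
      nlinarith [norm_nonneg ζ]
    have h2 : 0 < Complex.normSq (1 - ζ) := Complex.normSq_pos.2 (hne ζ hζ)
    rw [Complex.div_re, ← add_div]
    refine div_pos ?_ h2
    rw [Complex.normSq_apply] at h1
    simp
    nlinarith
  have hslit : ∀ ζ ∈ Metric.ball (0 : ℂ) 1, g ζ ∈ Complex.slitPlane := fun ζ hζ => Or.inl (hre ζ hζ)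
  have hg : ∀ ζ ∈ Metric.ball (0 : ℂ) 1, HasDerivAt g ((1 * (1 - ζ) - (1 + ζ) * (-1)) / (1 - ζ) ^ 2) ζ := by
    intro ζ hζ
    exact ((hasDerivAt_id ζ).const_add 1).div ((hasDerivAt_id ζ).const_sub 1) (hne ζ hζ)
  have hh : ∀ ζ ∈ Metric.ball (0 : ℂ) 1, HasDerivAt (fun ζ => (ε : ℂ) * Complex.log (g ζ))
      (ε * (((1 * (1 - ζ) - (1 + ζ) * (-1)) / (1 - ζ) ^ 2) / g ζ)) ζ := fun ζ hζ =>
    ((hg ζ hζ).clog (hslit ζ hζ)).const_mul _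
  refine ⟨fun ζ => ε * Complex.log (g ζ), fun ζ hζ => (hh ζ hζ).differentiableAt.differentiableWithinAt,
    by simp [g], ?_, ?_, fun ζ hζ => ⟨?_, fun hζ0 => ?_⟩⟩
  · rw [(hh 0 (Metric.mem_ball_self one_pos)).deriv]
    simp only [g]
    norm_num
    exact hε.ne'
  -- The point `(E - 1) / (E + 1)` is the preimage of `E` under the Cayley transform, and `ε log E =
  -- 1`.
  · let E := Real.exp (1 / ε)
    have hE : 0 < E := Real.exp_pos _
    refine ⟨((E - 1) / (E + 1) : ℝ), ?_, ?_⟩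
    · rw [mem_ball_zero_iff, Complex.norm_real, Real.norm_eq_abs, abs_lt]
      constructor
      · rw [lt_div_iff₀ (by positivity)]; linarith
      · rw [div_lt_iff₀ (by positivity)]; linarith
    · have : g (((E - 1) / (E + 1) : ℝ) : ℂ) = E := by
        have h1 : (E + 1 : ℂ) ≠ 0 := by exact_mod_cast (by positivity : E + 1 ≠ 0)
        simp only [g]
        push_cast
        field_simp
        ring
      simp only [this]
      rw [← Complex.ofReal_log hE.le, Real.log_exp]
      push_cast
      field_simp
  · rw [Complex.im_ofReal_mul, Complex.log_im, abs_mul, abs_of_pos hε]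
    have h1 := Complex.abs_arg_lt_pi_div_two_iff.2 (Or.inl (hre ζ hζ))
    calc ε * |Complex.arg (g ζ)| < ε * Real.pi := by
          have := Real.pi_pos
          gcongr
          linarith
      _ = η := div_mul_cancel₀ _ Real.pi_ne_zero
  · refine mul_ne_zero hεC fun hlog => ?_
    have h1 : g ζ = 1 := by
      rw [← Complex.exp_log (Complex.slitPlane_ne_zero (hslit ζ hζ)), hlog, Complex.exp_zero]
    rw [div_eq_one_iff_eq (hne ζ hζ)] at h1
    exact hζ0 (by linear_combination h1 / 2)

/-- A holomorphic disk through `0` and `1` that meets a finite set at most at its centre. -/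
theorem exists_disk_avoiding {F : Set ℂ} (hF : F.Finite) (h1 : (1 : ℂ) ∉ F) :
    ∃ H : ℂ → ℂ, ContDiffOn ℂ ω H (Metric.ball 0 1) ∧ H 0 = 0 ∧ deriv H 0 ≠ 0 ∧
      (∃ c ∈ Metric.ball (0 : ℂ) 1, c ≠ 0 ∧ H c = 1) ∧
      ∀ ζ ∈ Metric.ball (0 : ℂ) 1, ζ ≠ 0 → H ζ ≠ 0 ∧ H ζ ∉ F := by
  obtain ⟨q, hq0, hq1, hq', η, hη, hq⟩ := exists_quadratic_avoiding hF h1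
  obtain ⟨h, hd, hh0, hh', ⟨c, hc, hhc⟩, hh⟩ := exists_disk_to_strip hη
  refine ⟨fun ζ => q.eval (h ζ), (q.differentiable.comp_differentiableOn hd).contDiffOn Metric.isOpen_ball,
    by simp [hh0, hq0], ?_, ⟨c, hc, ?_, by simp [hhc, hq1]⟩, fun ζ hζ hζ0 => hq _ (hh ζ hζ).1 ((hh ζ hζ).2 hζ0)⟩
  · have h2 := (hd.differentiableAt (Metric.ball_mem_nhds 0 one_pos)).hasDerivAt
    have h3 := (q.hasDerivAt (h 0)).comp 0 h2
    rw [show deriv (fun ζ => q.eval (h ζ)) 0 = _ from h3.deriv, hh0]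
    exact mul_ne_zero hq' hh'
  · rintro rfl
    simp [hh0] at hhc

/-! ### Smoothings of the discriminant double cover -/

namespace MultiProj

open MvPolynomial

variable {r : ℕ} {n d : Fin r → ℕ}

/-- A family of sections `γ ζ`, over the unit disk, that deforms the discriminant `B² - 4 A C` to
smooth sections, in general position at the nodes, and that passes through `t`. -/
structure SmoothingFamily (d : Fin r → ℕ) (A : Fin 3 → MvPolynomial (Σ i, Fin (n i + 1)) ℂ)
    (t : MvPolynomial (Σ i, Fin (n i + 1)) ℂ) where
  γ : ℂ → MvPolynomial (Σ i, Fin (n i + 1)) ℂ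
  mem_sections : ∀ ζ, γ ζ ∈ sections n (2 • d)
  -- The difference quotient `(γ ζ - discr A) / ζ` in a trivialisation. It records the joint
  -- holomorphy of the family, and its nonvanishing at the nodes makes the total space smooth there.
  slope : (∀ i, Fin (n i + 1)) → (∀ i, Fin (n i) → ℂ) × ℂ → ℂ
  contDiffOn_slope : ∀ J, ContDiffOn ℂ ω (slope J) (Set.univ ×ˢ Metric.ball 0 1)
  localFun_γ : ∀ J u, ∀ ζ ∈ Metric.ball (0 : ℂ) 1,
    localFun J (γ ζ) u = localFun J (discr A) u + ζ * slope J (u, ζ)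
  slope_ne_zero : ∀ J u, (∀ j, localFun J (A j) u = 0) → slope J (u, 0) ≠ 0
  smooth : ∀ ζ ∈ Metric.ball (0 : ℂ) 1, ζ ≠ 0 → ∀ J u, localFun J (γ ζ) u = 0 →
    fderiv ℂ (localFun J (γ ζ)) u ≠ 0
  c : ℂ
  c_mem : c ∈ Metric.ball (0 : ℂ) 1
  c_ne_zero : c ≠ 0
  γ_c : γ c = t

/-- The quadratic curve `δ + x (ρ - δ) + x² (t - ρ)` runs from the discriminant `δ` at `0` to `t` at
`1`. Its initial direction is `ρ` at the nodes, where `δ` vanishes. The detour through `ρ` is needed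
because `t` is independent of `s` and may vanish at a node. -/
theorem exists_smoothingFamily (hn : ∑ i, n i = 3)
    {A : Fin 3 → MvPolynomial (Σ i, Fin (n i + 1)) ℂ} (hA : ∀ j, A j ∈ sections n d)
    (hreg : IsRegularNet Sigma.fst A) {G : MvPolynomial (Module.Dual ℂ (sections n (2 • d))) ℂ}
    (hG : ∀ t, evalDual G t ≠ 0 → ∀ v, BlockNonzero Sigma.fst v → ∃ k, eval v (pderiv k t.1) ≠ 0)
    {t : sections n (2 • d)} (ht : evalDual G t ≠ 0) : Nonempty (SmoothingFamily d A t.1) := by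
  obtain ⟨R, hR, hRne⟩ := exists_section_ne_zero (finite_nodes hn hreg hA) (2 • d)
  let δ : sections n (2 • d) := ⟨discr A, discr_mem_sections hA⟩
  let ρ : sections n (2 • d) := ⟨R, hR⟩
  obtain ⟨P, hP⟩ := exists_polynomial_curve G δ (ρ - δ) (t - ρ)
  have hP1 : P.eval 1 ≠ 0 := by
    rw [hP]
    simpa using ht
  have hP0 : P ≠ 0 := by
    rintro rfl
    simp at hP1
  -- The roots of `P` contain all parameters whose section may be singular. The value `0` is taken
  -- only at the centre, and `1` is not a root because `G` is nonzero at `t`.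
  obtain ⟨H, hH, hH0, hH', ⟨c, hc, hc0, hHc⟩, hHF⟩ := exists_disk_avoiding
    (F := {x | P.IsRoot x} \ {0}) ((Polynomial.finite_setOfPred_isRoot hP0).subset Set.sdiff_subset)
    (fun h => hP1 h.1)
  let γ : ℂ → sections n (2 • d) := fun ζ => δ + H ζ • (ρ - δ) + H ζ ^ 2 • (t - ρ)
  have hγ : ∀ J u ζ, localFun J (γ ζ) u = localFun J (discr A) u +
      H ζ * (localFun J R u - localFun J (discr A) u) + H ζ ^ 2 * (localFun J t u - localFun J R u) := by
    intro J u ζ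
    simp [γ, δ, ρ, localFun, smul_eval]
  have hball : (0 : ℂ) ∈ Metric.ball (0 : ℂ) 1 := Metric.mem_ball_self one_pos
  -- `dslope H 0` is `H ζ / ζ` extended by `H' 0`, holomorphic by the removable singularity theorem.
  have hslope : ContDiffOn ℂ ω (dslope H 0) (Metric.ball 0 1) :=
    ((Complex.differentiableOn_dslope (Metric.isOpen_ball.mem_nhds hball)).2
      (hH.differentiableOn (by simp))).contDiffOn Metric.isOpen_ball
  have hsl : ∀ ζ, ζ * dslope H 0 ζ = H ζ := fun ζ => by
    have := sub_smul_dslope H 0 ζ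
    simpa [hH0] using this
  refine ⟨⟨fun ζ => (γ ζ).1, fun ζ => (γ ζ).2, fun J p => dslope H 0 p.2 *
    ((localFun J R p.1 - localFun J (discr A) p.1) + H p.2 * (localFun J t p.1 - localFun J R p.1)),
    fun J => ?_, fun J u ζ _ => ?_, fun J u h0 => ?_, fun ζ hζ hζ0 J u h0 => ?_, c, hc, hc0, ?_⟩⟩
  · have h1 := fun s => ((contDiff_localFun J s).comp
      (contDiff_fst (𝕜 := ℂ) (E := ∀ i, Fin (n i) → ℂ) (F := ℂ))).contDiffOn
        (s := Set.univ ×ˢ Metric.ball (0 : ℂ) 1)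
    have h2 : Set.MapsTo Prod.snd ((Set.univ : Set (∀ i, Fin (n i) → ℂ)) ×ˢ Metric.ball (0 : ℂ) 1)
      (Metric.ball (0 : ℂ) 1) := fun p hp => hp.2
    exact (hslope.comp contDiff_snd.contDiffOn h2).mul (((h1 R).sub (h1 _)).add
      ((hH.comp contDiff_snd.contDiffOn h2).mul ((h1 t).sub (h1 R))))
  · rw [hγ, ← hsl]
    ring
  · have hu : (affineChart J).symm u ∈ affineOpen J := by
      rw [← affineChart_source]
      exact (affineChart J).map_target (by rw [affineChart_target]; trivial)
    have hu' : affineChart J ((affineChart J).symm u) = u :=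
      (affineChart J).right_inv (by rw [affineChart_target]; trivial)
    have h1 := hRne _ ((mem_nodes_iff hA hu).2 (by rwa [hu']))
    rw [Ne, eval_coords_eq_zero_iff hR hu, hu'] at h1
    rw [dslope_same]
    refine mul_ne_zero hH' ?_
    simpa [localFun_discr, h0, hH0] using h1
  · refine fderiv_localFun_ne_zero (γ ζ).2 (hG (γ ζ) ?_) h0
    rw [← hP]
    exact fun h => (hHF ζ hζ hζ0).2 ⟨h, (hHF ζ hζ hζ0).1⟩
  · simp [γ, hHc]

end MultiProj

/-! ### The double cover, the small resolution and the total space as complex manifolds -/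

lemma fderiv_comp_eq_zero {E F : Type*} [NormedAddCommGroup E] [NormedSpace ℂ E]
    [NormedAddCommGroup F] [NormedSpace ℂ F] {f : E → ℂ} {g : F → E} {a : F}
    (hf : DifferentiableAt ℂ f (g a)) (hg : DifferentiableAt ℂ g a) (h : fderiv ℂ f (g a) = 0) :
    fderiv ℂ (fun x => f (g x)) a = 0 := by
  rw [fderiv_fun_comp a hf hg, h, ContinuousLinearMap.zero_comp]

namespace ProjSpace

lemma eq_iff_rep {p q : ProjSpace 1} : p = q ↔ p.rep 0 * q.rep 1 = p.rep 1 * q.rep 0 := by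
  refine ⟨by rintro rfl; ring, fun h => ?_⟩
  have hp := p.rep_nonzero
  rw [← p.mk_rep, ← q.mk_rep, Projectivization.mk_eq_mk_iff']
  rcases Function.ne_iff.1 q.rep_nonzero with ⟨k, hk⟩
  refine ⟨p.rep k / q.rep k, ?_⟩
  fin_cases k
  · have hk : q.rep 0 ≠ 0 := hk
    ext l
    fin_cases l
    · simp [hk]
    · simp
      field_simp
      linear_combination h
  · have hk : q.rep 1 ≠ 0 := hk
    ext l
    fin_cases l
    · simp
      field_simp
      linear_combination -h
    · simp [hk]

/-- The homogeneous coordinates of the point of `ℙ¹` with affine coordinate `y`. -/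
def lift (j : Fin 2) (y : Fin 1 → ℂ) : Fin 2 → ℂ := j.insertNth (1 : ℂ) y

lemma lift_zero (y : Fin 1 → ℂ) : lift 0 y = ![1, y 0] := by
  ext k; fin_cases k <;> rfl

lemma lift_one (y : Fin 1 → ℂ) : lift 1 y = ![y 0, 1] := by
  ext k; fin_cases k <;> rfl

lemma lift_ne_zero (j : Fin 2) (y : Fin 1 → ℂ) : lift j y ≠ 0 := insertNth_one_ne_zero j y

lemma rep_eq_smul_lift {j : Fin 2} {p : ProjSpace 1} (hp : p ∈ affineOpen j) :
    p.rep = p.rep j • lift j (affineChart j p) := by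
  have hj : p.rep j ≠ 0 := hp
  ext k
  refine Fin.succAboveCases j ?_ (fun l => ?_) k
  · simp [lift]
  · simp only [lift, Pi.smul_apply, Fin.insertNth_apply_succAbove, smul_eq_mul]
    exact (mul_div_cancel₀ _ hj).symm

lemma contDiff_lift (j k : Fin 2) : ContDiff ℂ ω fun y => lift j y k := by
  refine Fin.succAboveCases j ?_ (fun l => ?_) k
  · simpa [lift] using contDiff_const
  · simpa [lift] using contDiff_apply ℂ ℂ l

end ProjSpace

namespace MultiProj

open MvPolynomial

variable {r : ℕ} {n d : Fin r → ℕ}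

lemma finrank_affine_prod (hn : ∑ i, n i = 3) :
    Module.finrank ℂ ((∀ i, Fin (n i) → ℂ) × ℂ) = 3 + 1 := by
  rw [Module.finrank_prod, finrank_affine hn, Module.finrank_self]

/-! ### The smooth double cover. -/

section DoubleCover

/-- The local equation `w² = t` of the double cover. -/
def coverEq (J : ∀ i, Fin (n i + 1)) (t : MvPolynomial (Σ i, Fin (n i + 1)) ℂ)
    (p : (∀ i, Fin (n i) → ℂ) × ℂ) : ℂ := p.2 ^ 2 - localFun J t p.1

lemma contDiff_coverEq (J : ∀ i, Fin (n i + 1)) (t : MvPolynomial (Σ i, Fin (n i + 1)) ℂ) :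
    ContDiff ℂ ω (coverEq J t) :=
  (contDiff_snd.pow 2).sub ((contDiff_localFun J t).comp contDiff_fst)

/-- Restriction to the fibre line and to the horizontal slice gives the derivatives `2 w` and `-dt`.
-/
lemma of_fderiv_coverEq {J : ∀ i, Fin (n i + 1)} {t : MvPolynomial (Σ i, Fin (n i + 1)) ℂ}
    {p : (∀ i, Fin (n i) → ℂ) × ℂ} (h : fderiv ℂ (coverEq J t) p = 0) :
    p.2 = 0 ∧ fderiv ℂ (localFun J t) p.1 = 0 := by
  have hd : DifferentiableAt ℂ (coverEq J t) p := (contDiff_coverEq J t).differentiable (by simp) p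
  constructor
  · have h1 := fderiv_comp_eq_zero (g := fun w : ℂ => (p.1, w)) (a := p.2) hd
      (by fun_prop) h
    have h2 : HasDerivAt (fun w : ℂ => coverEq J t (p.1, w)) (2 * p.2) p.2 := by
      simpa [coverEq] using ((hasDerivAt_id p.2).pow 2).sub_const (localFun J t p.1)
    have h3 := congrArg (fun L : ℂ →L[ℂ] ℂ => L 1) h1
    simpa [h2.hasFDerivAt.fderiv] using h3
  · have h1 := fderiv_comp_eq_zero (g := fun u => (u, p.2)) (a := p.1) hd (by fun_prop) h
    have h2 : HasFDerivAt (fun u => coverEq J t (u, p.2)) (-fderiv ℂ (localFun J t) p.1) p.1 := by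
      simpa [coverEq] using (differentiableAt_localFun J t p.1).hasFDerivAt.const_sub (p.2 ^ 2)
    rw [h2.fderiv, neg_eq_zero] at h1
    exact h1

/-- The double cover branched along a smooth divisor is a connected complex threefold. -/
theorem exists_doubleCover_manifold (hn : ∑ i, n i = 3) {t : MvPolynomial (Σ i, Fin (n i + 1)) ℂ}
    (ht : t ∈ sections n (2 • d))
    (hsm : ∀ J u, localFun J t u = 0 → fderiv ℂ (localFun J t) u ≠ 0)
    {z₀ : MultiProj n} (hz₀ : eval (coords z₀) t = 0) :
    ∃ (X : ComplexManifold 3) (κ : X → (lineBundle n d).TotalSpace),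
      IsSubmanifoldEmbedding (𝓘(ℂ, ∀ i, Fin (n i) → ℂ).prod 𝓘(ℂ)) (doubleCover d t) X κ :=
  exists_submanifold_of_regular_equations _ (finrank_affine_prod hn) (isConnected_doubleCover ht hz₀)
    (lineCoord d) (isHolCoord_lineCoord d) (fun J => coverEq J t)
    (fun J => (contDiff_coverEq J t).contDiffOn)
    (fun e _ => (exists_mem_affineOpen e.proj).imp fun J hJ => mem_lineCoord_source.2 hJ)
    (fun J e he => by
      rw [mem_doubleCover_iff_local ht (mem_lineCoord_source.1 he), coverEq, sub_eq_zero])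
    (fun J p _ h0 h => by
      obtain ⟨h1, h2⟩ := of_fderiv_coverEq h
      refine hsm J p.1 ?_ h2
      rw [coverEq, h1] at h0
      simpa using h0)

end DoubleCover

/-! ### The divisor in `Z × ℙ¹` and its map to the discriminant double cover. -/

section Resolution

variable {A : Fin 3 → MvPolynomial (Σ i, Fin (n i + 1)) ℂ}

/-- The local equation `A x² + B x y + C y² = 0`. -/
def quadricEq (A : Fin 3 → MvPolynomial (Σ i, Fin (n i + 1)) ℂ) (J : ∀ i, Fin (n i + 1)) (j : Fin 2)
    (p : (∀ i, Fin (n i) → ℂ) × (Fin 1 → ℂ)) : ℂ :=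
  localFun J (A 0) p.1 * ProjSpace.lift j p.2 0 ^ 2 +
    localFun J (A 1) p.1 * (ProjSpace.lift j p.2 0 * ProjSpace.lift j p.2 1) +
    localFun J (A 2) p.1 * ProjSpace.lift j p.2 1 ^ 2

lemma contDiff_quadricEq (J : ∀ i, Fin (n i + 1)) (j : Fin 2) : ContDiff ℂ ω (quadricEq A J j) := by
  have h1 := fun k => (contDiff_localFun J (A k)).comp
    (contDiff_fst (𝕜 := ℂ) (E := ∀ i, Fin (n i) → ℂ) (F := Fin 1 → ℂ))
  have h2 := fun k => (ProjSpace.contDiff_lift j k).comp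
    (contDiff_snd (𝕜 := ℂ) (E := ∀ i, Fin (n i) → ℂ) (F := Fin 1 → ℂ))
  exact (((h1 0).mul ((h2 0).pow 2)).add ((h1 1).mul ((h2 0).mul (h2 1)))).add
    ((h1 2).mul ((h2 1).pow 2))

lemma mem_zeroLocusProd_iff {p : MultiProj n × ProjSpace 1} :
    p ∈ zeroLocusProd (binaryQuadratic A) ↔ eval (coords p.1) (A 0) * p.2.rep 0 ^ 2 +
      eval (coords p.1) (A 1) * (p.2.rep 0 * p.2.rep 1) + eval (coords p.1) (A 2) * p.2.rep 1 ^ 2 = 0 := by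
  rw [← eval_binaryQuadratic]
  rfl

lemma mem_zeroLocusProd_iff_local (hA : ∀ j, A j ∈ sections n d) {p : MultiProj n × ProjSpace 1}
    {J : ∀ i, Fin (n i + 1)} {j : Fin 2} (hJ : p.1 ∈ affineOpen J) (hj : p.2 ∈ ProjSpace.affineOpen j) :
    p ∈ zeroLocusProd (binaryQuadratic A) ↔
      quadricEq A J j (affineChart J p.1, ProjSpace.affineChart j p.2) = 0 := by
  have hm := cornerMonomial_ne_zero d hJ
  have hj' : p.2.rep j ≠ 0 := hj
  have hrep := fun k => congrFun (ProjSpace.rep_eq_smul_lift hj) k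
  rw [mem_zeroLocusProd_iff, eval_coords (hA 0) hJ, eval_coords (hA 1) hJ, eval_coords (hA 2) hJ,
    hrep 0, hrep 1, quadricEq]
  simp only [Pi.smul_apply, smul_eq_mul]
  constructor <;> intro h
  · refine mul_left_cancel₀ (mul_ne_zero hm (pow_ne_zero 2 hj')) ?_
    linear_combination h
  · linear_combination (cornerMonomial d J p.1 * p.2.rep j ^ 2) * h

/-- At a critical zero of the affine equation, Euler's identity in `(x, y)` supplies the missing
derivative along the coordinate normalised to `1`. All partial derivatives of the form then vanish,
against the smoothness of the divisor. -/
lemma fderiv_quadricEq_ne_zero (hreg : IsRegularNet Sigma.fst A) (hA : ∀ j, A j ∈ sections n d)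
    {J : ∀ i, Fin (n i + 1)} {j : Fin 2} {p : (∀ i, Fin (n i) → ℂ) × (Fin 1 → ℂ)}
    (h0 : quadricEq A J j p = 0) : fderiv ℂ (quadricEq A J j) p ≠ 0 := by
  intro h
  have hd : DifferentiableAt ℂ (quadricEq A J j) p := (contDiff_quadricEq J j).differentiable (by simp) p
  refine ProjSpace.lift_ne_zero j p.2 ?_
  have hu : ∀ w, ProjSpace.lift j p.2 0 ^ 2 * fderiv ℂ (localFun J (A 0)) p.1 w +
      ProjSpace.lift j p.2 0 * ProjSpace.lift j p.2 1 * fderiv ℂ (localFun J (A 1)) p.1 w +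
      ProjSpace.lift j p.2 1 ^ 2 * fderiv ℂ (localFun J (A 2)) p.1 w = 0 := by
    intro w
    have h1 := fderiv_comp_eq_zero (g := fun u => (u, p.2)) (a := p.1) hd (by fun_prop) h
    have h2 := fun k => (differentiableAt_localFun J (A k) p.1).hasFDerivAt
    have h3 : HasFDerivAt (fun u => quadricEq A J j (u, p.2)) _ p.1 :=
      (((h2 0).mul_const (ProjSpace.lift j p.2 0 ^ 2)).fun_add
        ((h2 1).mul_const (ProjSpace.lift j p.2 0 * ProjSpace.lift j p.2 1))).fun_add
        ((h2 2).mul_const (ProjSpace.lift j p.2 1 ^ 2))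
    rw [h3.fderiv] at h1
    have := congrArg (fun L : (∀ i, Fin (n i) → ℂ) →L[ℂ] ℂ => L w) h1
    simpa using this
  have hp2 : (p.1, fun _ : Fin 1 => p.2 0) = p :=
    Prod.ext rfl (funext fun k => by rw [Subsingleton.elim k 0])
  have h1 := fderiv_comp_eq_zero (g := fun y : ℂ => (p.1, fun _ : Fin 1 => y)) (a := p.2 0)
    (by rw [hp2]; exact hd) (by fun_prop) (by rw [hp2]; exact h)
  have h1' := congrArg (fun L : ℂ →L[ℂ] ℂ => L 1) h1
  simp only [fderiv_apply_one_eq_deriv, zero_apply] at h1'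
  have hid := hasDerivAt_id (p.2 0)
  fin_cases j
  · have h2 : HasDerivAt (fun y : ℂ => quadricEq A J 0 (p.1, fun _ => y)) _ (p.2 0) :=
      ((hid.const_mul (localFun J (A 1) p.1)).const_add (localFun J (A 0) p.1)).fun_add
        ((hid.pow 2).const_mul (localFun J (A 2) p.1)) |>.congr_of_eventuallyEq
        (Filter.Eventually.of_forall fun y => by simp [quadricEq, ProjSpace.lift_zero])
    have h3 := h2.deriv.symm.trans h1'
    refine eq_zero_of_fderiv_binaryQuadratic hreg hA (J := J) (u := p.1) ?_ ?_ hu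
    all_goals simp [quadricEq, ProjSpace.lift_zero] at h0 h3 ⊢
    · linear_combination 2 * h0 - p.2 0 * h3
    · linear_combination h3
  · have h2 : HasDerivAt (fun y : ℂ => quadricEq A J 1 (p.1, fun _ => y)) _ (p.2 0) :=
      ((((hid.pow 2).const_mul (localFun J (A 0) p.1)).fun_add
        (hid.const_mul (localFun J (A 1) p.1))).add_const (localFun J (A 2) p.1)) |>.congr_of_eventuallyEq
        (Filter.Eventually.of_forall fun y => by simp [quadricEq, ProjSpace.lift_one])
    have h3 := h2.deriv.symm.trans h1'
    refine eq_zero_of_fderiv_binaryQuadratic hreg hA (J := J) (u := p.1) ?_ ?_ hu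
    all_goals simp [quadricEq, ProjSpace.lift_one] at h0 h3 ⊢
    · linear_combination h3
    · linear_combination 2 * h0 - p.2 0 * h3

/-- The point `e` of the total space of `𝒪(d)` corresponds to the point `p = (z, [x : y])`:
`w y = 2 A x + B y` and `w x = - (B x + 2 C y)`. -/
structure IsResolved (A : Fin 3 → MvPolynomial (Σ i, Fin (n i + 1)) ℂ) (p : MultiProj n × ProjSpace 1)
    (e : (lineBundle n d).TotalSpace) : Prop where
  proj_eq : e.proj = p.1
  eq₀ : fibreCoord e * p.2.rep 1 = 2 * eval (coords p.1) (A 0) * p.2.rep 0 + eval (coords p.1) (A 1) * p.2.rep 1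
  eq₁ : fibreCoord e * p.2.rep 0 = -(eval (coords p.1) (A 1) * p.2.rep 0 + 2 * eval (coords p.1) (A 2) * p.2.rep 1)

lemma exists_fibreCoord_eq (d : Fin r → ℕ) (z : MultiProj n) (w : ℂ) :
    ∃ e : (lineBundle n d).TotalSpace, e.proj = z ∧ fibreCoord e = w := by
  obtain ⟨J, hJ⟩ := exists_mem_affineOpen z
  have hp := proj_lineCoord_symm (d := d) hJ (w / cornerMonomial d J z)
  refine ⟨_, hp, ?_⟩
  rw [← lineCoord_snd_mul (J := J) (by rw [hp]; exact hJ), lineCoord_lineCoord_symm, hp]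
  exact div_mul_cancel₀ _ (cornerMonomial_ne_zero d hJ)

lemma eq_of_fibreCoord_eq {e e' : (lineBundle n d).TotalSpace} (hp : e'.proj = e.proj)
    (hw : fibreCoord e' = fibreCoord e) : e' = e := by
  obtain ⟨J, hJ⟩ := exists_mem_affineOpen e.proj
  refine eq_of_lineCoord_eq hJ hp (mul_right_cancel₀ (cornerMonomial_ne_zero d hJ) ?_)
  rw [lineCoord_snd_mul hJ, ← hw, ← lineCoord_snd_mul (J := J) (hp ▸ hJ), hp]

lemma IsResolved.unique {p : MultiProj n × ProjSpace 1} {e e' : (lineBundle n d).TotalSpace}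
    (h : IsResolved A p e) (h' : IsResolved A p e') : e' = e := by
  refine eq_of_fibreCoord_eq (h'.proj_eq.trans h.proj_eq.symm) ?_
  obtain ⟨k, hk⟩ := Function.ne_iff.1 p.2.rep_nonzero
  refine mul_right_cancel₀ hk ?_
  fin_cases k
  · exact h'.eq₁.trans h.eq₁.symm
  · exact h'.eq₀.trans h.eq₀.symm

/-- Whichever of `x`, `y` is nonzero, one equation determines `w`; the other then follows from `A x²
+ B x y + C y² = 0`. -/
lemma exists_isResolved (d : Fin r → ℕ) {p : MultiProj n × ProjSpace 1}
    (hp : p ∈ zeroLocusProd (binaryQuadratic A)) :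
    ∃ e : (lineBundle n d).TotalSpace, IsResolved A p e := by
  rw [mem_zeroLocusProd_iff] at hp
  by_cases h1 : p.2.rep 1 = 0
  · have h0 : p.2.rep 0 ≠ 0 := fun h0 => p.2.rep_nonzero (by ext k; fin_cases k <;> assumption)
    obtain ⟨e, he, hw⟩ := exists_fibreCoord_eq d p.1
      (-(eval (coords p.1) (A 1) * p.2.rep 0 + 2 * eval (coords p.1) (A 2) * p.2.rep 1) / p.2.rep 0)
    have hA0 : eval (coords p.1) (A 0) = 0 := by simpa [h1, h0] using hp
    exact ⟨e, he, by simp [h1, hA0], by rw [hw, div_mul_cancel₀ _ h0]⟩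
  · obtain ⟨e, he, hw⟩ := exists_fibreCoord_eq d p.1
      ((2 * eval (coords p.1) (A 0) * p.2.rep 0 + eval (coords p.1) (A 1) * p.2.rep 1) / p.2.rep 1)
    refine ⟨e, he, by rw [hw, div_mul_cancel₀ _ h1], ?_⟩
    rw [hw]
    field_simp
    linear_combination 2 * hp

lemma IsResolved.mem_zeroLocusProd {p : MultiProj n × ProjSpace 1} {e : (lineBundle n d).TotalSpace}
    (h : IsResolved A p e) : p ∈ zeroLocusProd (binaryQuadratic A) := by
  rw [mem_zeroLocusProd_iff]
  linear_combination (p.2.rep 1 / 2) * h.eq₁ - (p.2.rep 0 / 2) * h.eq₀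

/-- The two equations say that `(x, y)` is an eigenvector, with eigenvalue `w`, of the trace-free
matrix with rows `(-B, -2 C)` and `(2 A, B)`. The square of this matrix is `B² - 4 A C` times the
identity. -/
lemma IsResolved.mem_doubleCover {p : MultiProj n × ProjSpace 1} {e : (lineBundle n d).TotalSpace}
    (h : IsResolved A p e) : e ∈ doubleCover d (discr A) := by
  rw [mem_doubleCover_iff, h.proj_eq]
  obtain ⟨k, hk⟩ := Function.ne_iff.1 p.2.rep_nonzero
  refine mul_right_cancel₀ hk ?_
  simp only [discr, map_sub, map_mul, map_pow, eval_C]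
  fin_cases k
  · change _ * p.2.rep 0 = _ * p.2.rep 0
    linear_combination (fibreCoord e - eval (coords p.1) (A 1)) * h.eq₁ - 2 * eval (coords p.1) (A 2) * h.eq₀
  · change _ * p.2.rep 1 = _ * p.2.rep 1
    linear_combination (fibreCoord e + eval (coords p.1) (A 1)) * h.eq₀ + 2 * eval (coords p.1) (A 0) * h.eq₁

/-- When `w² = B² - 4 A C`, `w` is an eigenvalue of the matrix with rows `(-B, -2 C)` and `(2 A,
B)`, so an eigenvector `(x, y)` exists. The case distinction writes down a nonzero one. -/
lemma exists_isResolved_of_mem_doubleCover {e : (lineBundle n d).TotalSpace}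
    (he : e ∈ doubleCover d (discr A)) : ∃ p, IsResolved A p e := by
  rw [mem_doubleCover_iff] at he
  simp only [discr, map_sub, map_mul, map_pow, eval_C] at he
  set a := eval (coords e.proj) (A 0)
  set b := eval (coords e.proj) (A 1)
  set c := eval (coords e.proj) (A 2)
  set w := fibreCoord e
  obtain ⟨y, hy, h0, h1⟩ : ∃ y : Fin 2 → ℂ, y ≠ 0 ∧ w * y 1 = 2 * a * y 0 + b * y 1 ∧
      w * y 0 = -(b * y 0 + 2 * c * y 1) := by
    by_cases ha : a = 0
    · by_cases hb : b = w
      · by_cases hc : c = 0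
        · have hb0 : b = 0 ∨ b ≠ 0 := em _
          rcases hb0 with hb0 | hb0
          · refine ⟨![1, 0], by simp, ?_, ?_⟩ <;> simp [ha, ← hb, hb0]
          · refine ⟨![0, 1], by simp, ?_, ?_⟩ <;> simp [ha, ← hb, hc]
        · refine ⟨![-c, b], by simp [hc], ?_, ?_⟩
          · simp [ha, ← hb]
          · simp [← hb]; ring
      · refine ⟨![1, 0], by simp, by simp [ha], ?_⟩
        have : (w - b) * (w + b) = 0 := by linear_combination he - 4 * c * ha
        rcases mul_eq_zero.1 this with h | h
        · exact absurd (by linear_combination -h) hb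
        · simp; linear_combination h
    · refine ⟨![w - b, 2 * a], by simp [ha], ?_, ?_⟩
      · simp; ring
      · simp; linear_combination he
  obtain ⟨s, hs⟩ := Projectivization.exists_smul_eq_mk_rep ℂ y hy
  have hrep : ∀ k, (Projectivization.mk ℂ y hy).rep k = s * y k := fun k => by rw [← hs]; rfl
  refine ⟨(e.proj, Projectivization.mk ℂ y hy), rfl, ?_, ?_⟩
  · simp only [hrep]
    linear_combination (s : ℂ) * h0
  · simp only [hrep]
    linear_combination (s : ℂ) * h1

/-- Two independent eigenvectors with the same eigenvalue would make the trace-free matrix scalar,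
hence zero, and that means `A = B = C = 0`. -/
lemma IsResolved.eq_of_not_mem_nodes {p p' : MultiProj n × ProjSpace 1}
    {e : (lineBundle n d).TotalSpace} (h : IsResolved A p e) (h' : IsResolved A p' e)
    (hp : p.1 ∉ nodes A) : p' = p := by
  have hpp : p'.1 = p.1 := h'.proj_eq.symm.trans h.proj_eq
  refine Prod.ext hpp (ProjSpace.eq_iff_rep.2 ?_)
  have h0' := h'.eq₀
  have h1' := h'.eq₁
  rw [hpp] at h0' h1'
  have h0 := h.eq₀
  have h1 := h.eq₁
  by_contra hne
  rw [← sub_eq_zero.not] at hne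
  have k0 : eval (coords p.1) (A 0) = 0 := by
    refine (mul_eq_zero.1 ?_).resolve_right hne
    linear_combination (p'.2.rep 1 / 2) * h0 - (p.2.rep 1 / 2) * h0'
  have k1 : fibreCoord e - eval (coords p.1) (A 1) = 0 := by
    refine (mul_eq_zero.1 ?_).resolve_right hne
    linear_combination p'.2.rep 0 * h0 - p.2.rep 0 * h0'
  have k2 : eval (coords p.1) (A 2) = 0 := by
    refine (mul_eq_zero.1 ?_).resolve_right hne
    linear_combination (p'.2.rep 0 / 2) * h1 - (p.2.rep 0 / 2) * h1'
  have k3 : fibreCoord e + eval (coords p.1) (A 1) = 0 := by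
    refine (mul_eq_zero.1 ?_).resolve_right hne
    linear_combination p.2.rep 1 * h1' - p'.2.rep 1 * h1
  refine hp fun j => ?_
  fin_cases j
  · exact k0
  · change eval (coords p.1) (A 1) = 0
    linear_combination k3 / 2 - k1 / 2
  · exact k2

/-- The fibre coordinate `w` of the point that corresponds to `(u, [x : y])`. -/
def resolvedCoord (A : Fin 3 → MvPolynomial (Σ i, Fin (n i + 1)) ℂ) (J : ∀ i, Fin (n i + 1)) (j : Fin 2)
    (q : (∀ i, Fin (n i) → ℂ) × (Fin 1 → ℂ)) : ℂ :=
  if j = 0 then -(localFun J (A 1) q.1 + 2 * localFun J (A 2) q.1 * q.2 0)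
  else 2 * localFun J (A 0) q.1 * q.2 0 + localFun J (A 1) q.1

lemma contDiff_resolvedCoord (J : ∀ i, Fin (n i + 1)) (j : Fin 2) :
    ContDiff ℂ ω (resolvedCoord A J j) := by
  have h1 := fun k => (contDiff_localFun J (A k)).comp
    (contDiff_fst (𝕜 := ℂ) (E := ∀ i, Fin (n i) → ℂ) (F := Fin 1 → ℂ))
  have h2 := (contDiff_apply ℂ ℂ (n := ω) (0 : Fin 1)).comp
    (contDiff_snd (𝕜 := ℂ) (E := ∀ i, Fin (n i) → ℂ) (F := Fin 1 → ℂ))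
  unfold resolvedCoord
  split_ifs
  · exact ((h1 1).add ((contDiff_const.mul (h1 2)).mul h2)).neg
  · exact ((contDiff_const.mul (h1 0)).mul h2).add (h1 1)

/-- The point of the total space of `𝒪(d)` that corresponds to `(z, [x : y])`, in a chart. -/
def resolvedPt (d : Fin r → ℕ) (A : Fin 3 → MvPolynomial (Σ i, Fin (n i + 1)) ℂ)
    (J : ∀ i, Fin (n i + 1)) (j : Fin 2) (p : MultiProj n × ProjSpace 1) :
    (lineBundle n d).TotalSpace :=
  (lineCoord d J).symm (affineChart J p.1,
    resolvedCoord A J j (affineChart J p.1, ProjSpace.affineChart j p.2))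

lemma contMDiffOn_resolvedPt (J : ∀ i, Fin (n i + 1)) (j : Fin 2) :
    ContMDiffOn (𝓘(ℂ, ∀ i, Fin (n i) → ℂ).prod 𝓘(ℂ, Fin 1 → ℂ)) (𝓘(ℂ, ∀ i, Fin (n i) → ℂ).prod 𝓘(ℂ)) ω
      (resolvedPt d A J j) ((affineChart J).prod (ProjSpace.affineChart j)).source := by
  have h1 := ((isHolCoord_affineChart J).prod (ProjSpace.isHolCoord_affineChart j)).contMDiffOn
  have h2 : ContDiff ℂ ω fun q : (∀ i, Fin (n i) → ℂ) × (Fin 1 → ℂ) => (q.1, resolvedCoord A J j q) :=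
    contDiff_fst.prodMk (contDiff_resolvedCoord J j)
  exact (isHolCoord_lineCoord d J).contMDiffOn_symm.comp (h2.contMDiff.comp_contMDiffOn h1)
    fun p _ => by rw [lineCoord_target]; trivial

/-- A map chosen pointwise by `IsResolved` agrees in each chart with an explicit holomorphic
formula. Its continuity and holomorphy follow. -/
lemma IsResolved.eq_resolvedPt (hA : ∀ j, A j ∈ sections n d) {p : MultiProj n × ProjSpace 1}
    {e : (lineBundle n d).TotalSpace} (h : IsResolved A p e) {J : ∀ i, Fin (n i + 1)} {j : Fin 2}
    (hp : p ∈ ((affineChart J).prod (ProjSpace.affineChart j)).source) : e = resolvedPt d A J j p := by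
  have hJ : p.1 ∈ affineOpen J := by
    rw [← affineChart_source]
    exact hp.1
  have hj : p.2 ∈ ProjSpace.affineOpen j := hp.2
  have hj' : p.2.rep j ≠ 0 := hj
  have hpr := proj_lineCoord_symm (d := d) hJ
    (resolvedCoord A J j (affineChart J p.1, ProjSpace.affineChart j p.2))
  have heJ : e.proj ∈ affineOpen J := by rwa [h.proj_eq]
  symm
  refine eq_of_lineCoord_eq heJ (hpr.trans h.proj_eq.symm) ?_
  rw [resolvedPt, lineCoord_lineCoord_symm]
  refine mul_right_cancel₀ (mul_ne_zero (cornerMonomial_ne_zero d heJ) hj') ?_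
  rw [← mul_assoc (lineCoord d J e).2, lineCoord_snd_mul heJ]
  have h0 := h.eq₀
  have h1 := h.eq₁
  have hrep := fun k => congrFun (ProjSpace.rep_eq_smul_lift hj) k
  rw [eval_coords (hA 0) hJ, eval_coords (hA 1) hJ, ← h.proj_eq] at h0
  rw [eval_coords (hA 1) hJ, eval_coords (hA 2) hJ, ← h.proj_eq] at h1
  rw [h.proj_eq] at *
  fin_cases j
  · have hr1 : p.2.rep 1 = p.2.rep 0 * ProjSpace.affineChart 0 p.2 0 := hrep 1
    rw [hr1] at h1
    simp only [resolvedCoord, Fin.zero_eta, if_true]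
    linear_combination -h1
  · have hr0 : p.2.rep 0 = p.2.rep 1 * ProjSpace.affineChart 1 p.2 0 := hrep 0
    rw [hr0] at h0
    simp only [resolvedCoord, Fin.mk_one, one_ne_zero, if_false]
    linear_combination -h0

lemma exists_mem_prod_source (p : MultiProj n × ProjSpace 1) :
    ∃ (J : ∀ i, Fin (n i + 1)) (j : Fin 2), p ∈ ((affineChart J).prod (ProjSpace.affineChart j)).source := by
  obtain ⟨J, hJ⟩ := exists_mem_affineOpen p.1
  obtain ⟨j, hj⟩ := ProjSpace.exists_mem_affineOpen p.2
  exact ⟨J, j, by rwa [affineChart_source], hj⟩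

lemma continuous_of_isResolved (hA : ∀ j, A j ∈ sections n d) {N : Type*} [TopologicalSpace N]
    {ι : N → MultiProj n × ProjSpace 1} (hι : Continuous ι) {Ψ : N → (lineBundle n d).TotalSpace}
    (h : ∀ x, IsResolved A (ι x) (Ψ x)) : Continuous Ψ := by
  rw [continuous_iff_continuousAt]
  intro x
  obtain ⟨J, j, hp⟩ := exists_mem_prod_source (ι x)
  have hopen := ((affineChart J).prod (ProjSpace.affineChart j)).open_source.mem_nhds hp
  have h1 := ((contMDiffOn_resolvedPt (d := d) (A := A) J j).continuousOn.continuousAt hopen).comp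
    hι.continuousAt
  refine h1.congr ?_
  filter_upwards [hι.continuousAt.preimage_mem_nhds hopen] with y hy
  exact ((h y).eq_resolvedPt hA hy).symm

lemma contMDiff_of_isResolved (hA : ∀ j, A j ∈ sections n d) {m : ℕ} {N : ComplexManifold m}
    {ι : N → MultiProj n × ProjSpace 1}
    (hι : ContMDiff 𝓘(ℂ, Fin m → ℂ) (𝓘(ℂ, ∀ i, Fin (n i) → ℂ).prod 𝓘(ℂ, Fin 1 → ℂ)) ω ι)
    {Ψ : N → (lineBundle n d).TotalSpace} (h : ∀ x, IsResolved A (ι x) (Ψ x)) :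
    ContMDiff 𝓘(ℂ, Fin m → ℂ) (𝓘(ℂ, ∀ i, Fin (n i) → ℂ).prod 𝓘(ℂ)) ω Ψ := by
  intro x
  obtain ⟨J, j, hp⟩ := exists_mem_prod_source (ι x)
  have hopen := ((affineChart J).prod (ProjSpace.affineChart j)).open_source.mem_nhds hp
  have h1 := ((contMDiffOn_resolvedPt (d := d) (A := A) J j).contMDiffAt hopen).comp x (hι x)
  refine h1.congr_of_eventuallyEq ?_
  filter_upwards [hι.continuous.continuousAt.preimage_mem_nhds hopen] with y hy
  exact (h y).eq_resolvedPt hA hy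

lemma isClosed_zeroLocusProd (hA : ∀ j, A j ∈ sections n d) :
    IsClosed (zeroLocusProd (binaryQuadratic A)) := by
  rw [← isOpen_compl_iff, isOpen_iff_mem_nhds]
  intro p hp
  obtain ⟨J, j, hs⟩ := exists_mem_prod_source p
  have hopen := ((affineChart J).prod (ProjSpace.affineChart j)).open_source.mem_nhds hs
  have hiff : ∀ q ∈ ((affineChart J).prod (ProjSpace.affineChart j)).source,
      (q ∈ zeroLocusProd (binaryQuadratic A) ↔
        quadricEq A J j (((affineChart J).prod (ProjSpace.affineChart j)) q) = 0) := fun q hq =>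
    mem_zeroLocusProd_iff_local hA (by rw [← affineChart_source]; exact hq.1) hq.2
  have hcont : ContinuousAt (fun q => quadricEq A J j (((affineChart J).prod (ProjSpace.affineChart j)) q)) p :=
    ContinuousAt.comp (contDiff_quadricEq J j).continuous.continuousAt
      (((affineChart J).prod (ProjSpace.affineChart j)).continuousAt hs)
  filter_upwards [hopen, hcont.eventually_ne (fun h => hp ((hiff p hs).2 h))] with q hq hne h
  exact hne ((hiff q hq).1 h)

/-- The small resolution is connected. -/
lemma isConnected_zeroLocusProd (hA : ∀ j, A j ∈ sections n d) {z₀ : MultiProj n} (hz₀ : z₀ ∈ nodes A) :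
    IsConnected (zeroLocusProd (binaryQuadratic A)) := by
  rw [isConnected_iff_connectedSpace]
  have hcomp : CompactSpace (zeroLocusProd (binaryQuadratic A)) :=
    isCompact_iff_compactSpace.1 (isClosed_zeroLocusProd hA).isCompact
  have hδ : eval (coords z₀) (discr A) = 0 := by
    have h := fun j => hz₀ j
    simp [discr, h]
  have : ConnectedSpace (doubleCover d (discr A)) :=
    isConnected_iff_connectedSpace.1 (isConnected_doubleCover (discr_mem_sections hA) hδ)
  -- Connectedness is lifted from the discriminant double cover along a closed surjection whose
  -- fibres are single points, or copies of `ℙ¹` over the nodes.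
  choose Ψ hΨ using fun p : zeroLocusProd (binaryQuadratic A) => exists_isResolved d p.2
  let f : zeroLocusProd (binaryQuadratic A) → doubleCover d (discr A) := fun p =>
    ⟨Ψ p, (hΨ p).mem_doubleCover⟩
  have hf : Continuous f :=
    (continuous_of_isResolved hA continuous_subtype_val hΨ).subtype_mk _
  have hsurj : Function.Surjective f := by
    rintro ⟨e, he⟩
    obtain ⟨p, hp⟩ := exists_isResolved_of_mem_doubleCover he
    exact ⟨⟨p, hp.mem_zeroLocusProd⟩, Subtype.ext (hp.unique (hΨ ⟨p, hp.mem_zeroLocusProd⟩))⟩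
  have hfib : ∀ x, IsPreconnected (f ⁻¹' {f x}) := by
    intro x
    by_cases hx : x.1.1 ∈ nodes A
    · let g : ProjSpace 1 → zeroLocusProd (binaryQuadratic A) := fun q =>
        ⟨(x.1.1, q), by
          have h := fun j => hx j
          rw [mem_zeroLocusProd_iff]
          simp [h]⟩
      have hg : Continuous g := (Continuous.prodMk_right x.1.1).subtype_mk _
      have h0 : ∀ p : zeroLocusProd (binaryQuadratic A), p.1.1 = x.1.1 → fibreCoord (Ψ p) = 0 := by
        intro p hp
        obtain ⟨k, hk⟩ := Function.ne_iff.1 p.1.2.rep_nonzero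
        refine (mul_eq_zero.1 ?_).resolve_right hk
        have h := fun j => hx j
        have h0 := (hΨ p).eq₀
        have h1 := (hΨ p).eq₁
        rw [hp] at h0 h1
        fin_cases k
        · simpa [h] using h1
        · simpa [h] using h0
      have : f ⁻¹' {f x} = Set.range g := by
        ext p
        constructor
        · intro hp
          have h1 : Ψ p = Ψ x := congrArg Subtype.val hp
          refine ⟨p.1.2, Subtype.ext (Prod.ext ?_ rfl)⟩
          rw [← (hΨ p).proj_eq, h1, (hΨ x).proj_eq]
        · rintro ⟨q, rfl⟩
          refine Subtype.ext (eq_of_fibreCoord_eq ((hΨ _).proj_eq.trans (hΨ x).proj_eq.symm) ?_)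
          exact (h0 (g q) rfl).trans (h0 x rfl).symm
      rw [this]
      exact isPreconnected_range hg
    · refine Set.Subsingleton.isPreconnected fun p hp p' hp' => ?_
      have key : ∀ p ∈ f ⁻¹' {f x}, p = x := fun p hp => by
        have h1 : Ψ p = Ψ x := congrArg Subtype.val hp
        exact Subtype.ext ((hΨ x).eq_of_not_mem_nodes (h1 ▸ hΨ p) hx)
      rw [key p hp, key p' hp']
  obtain ⟨x₀⟩ : Nonempty (zeroLocusProd (binaryQuadratic A)) := by
    obtain ⟨e⟩ : Nonempty (doubleCover d (discr A)) := inferInstance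
    exact ⟨(hsurj e).choose⟩
  exact connectedSpace_of_isClosedMap hf.isClosedMap hsurj (hfib x₀) fun x => Or.inr (hfib x)

/-- The small resolution `A x² + B x y + C y² = 0` is a connected complex threefold. -/
theorem exists_resolution_manifold (hn : ∑ i, n i = 3) (hreg : IsRegularNet Sigma.fst A)
    (hA : ∀ j, A j ∈ sections n d) {z₀ : MultiProj n} (hz₀ : z₀ ∈ nodes A) :
    ∃ (Y : ComplexManifold 3) (ι : Y → MultiProj n × ProjSpace 1),
      IsSubmanifoldEmbedding (𝓘(ℂ, ∀ i, Fin (n i) → ℂ).prod 𝓘(ℂ, Fin 1 → ℂ))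
        (zeroLocusProd (binaryQuadratic A)) Y ι :=
  exists_submanifold_of_regular_equations _
    (E := (∀ i, Fin (n i) → ℂ) × (Fin 1 → ℂ))
    (by rw [Module.finrank_prod, finrank_affine hn]; simp) (isConnected_zeroLocusProd hA hz₀)
    (Λ := (∀ i, Fin (n i + 1)) × Fin 2) (fun a => (affineChart a.1).prod (ProjSpace.affineChart a.2))
    (fun a => (isHolCoord_affineChart a.1).prod (ProjSpace.isHolCoord_affineChart a.2))
    (fun a => quadricEq A a.1 a.2) (fun a => (contDiff_quadricEq a.1 a.2).contDiffOn)
    (fun p _ => by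
      obtain ⟨J, j, h⟩ := exists_mem_prod_source p
      exact ⟨(J, j), h⟩)
    (fun a p hp => mem_zeroLocusProd_iff_local hA (by rw [← affineChart_source]; exact hp.1) hp.2)
    (fun a p _ h0 => fderiv_quadricEq_ne_zero hreg hA h0)

end Resolution

end MultiProj

/-! ### The total space of the smoothing. -/

namespace MultiProj

open MvPolynomial

variable {r : ℕ} {n d : Fin r → ℕ} {A : Fin 3 → MvPolynomial (Σ i, Fin (n i + 1)) ℂ}
  {t : MvPolynomial (Σ i, Fin (n i + 1)) ℂ}

instance : ConnectedSpace unitDisk :=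
  isConnected_iff_connectedSpace.1
    ((convex_ball (0 : ℂ) 1).isConnected ⟨0, Metric.mem_ball_self one_pos⟩)

namespace SmoothingFamily

variable (Γ : SmoothingFamily d A t)

lemma localFun_γ_zero (J : ∀ i, Fin (n i + 1)) (u : ∀ i, Fin (n i) → ℂ) :
    localFun J (Γ.γ 0) u = localFun J (discr A) u := by
  rw [Γ.localFun_γ J u 0 (Metric.mem_ball_self one_pos), zero_mul, add_zero]

/-- The total space `{(e, ζ) | w² = γ ζ}` of the smoothing. -/
def total : Set ((lineBundle n d).TotalSpace × ℂ) :=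
  {p | p.2 ∈ Metric.ball (0 : ℂ) 1 ∧ p.1 ∈ doubleCover d (Γ.γ p.2)}

/-- The coordinates `(u, w, ζ)`. -/
def totalCoord (d : Fin r → ℕ) (J : ∀ i, Fin (n i + 1)) :
    OpenPartialHomeomorph ((lineBundle n d).TotalSpace × ℂ) (((∀ i, Fin (n i) → ℂ) × ℂ) × ℂ) :=
  (lineCoord d J).prod (OpenPartialHomeomorph.ofSet (Metric.ball (0 : ℂ) 1) Metric.isOpen_ball)

lemma isHolCoord_totalCoord (d : Fin r → ℕ) (J : ∀ i, Fin (n i + 1)) :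
    IsHolCoord ((𝓘(ℂ, ∀ i, Fin (n i) → ℂ).prod 𝓘(ℂ)).prod 𝓘(ℂ)) (totalCoord (n := n) d J) :=
  (isHolCoord_lineCoord d J).prod (isHolCoord_ofSet Metric.isOpen_ball)

lemma mem_totalCoord_source {J : ∀ i, Fin (n i + 1)} {p : (lineBundle n d).TotalSpace × ℂ} :
    p ∈ (totalCoord d J).source ↔ p.1.proj ∈ affineOpen J ∧ p.2 ∈ Metric.ball (0 : ℂ) 1 := by
  rw [← mem_lineCoord_source]
  exact Iff.rfl

lemma totalCoord_apply (J : ∀ i, Fin (n i + 1)) (p : (lineBundle n d).TotalSpace × ℂ) :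
    totalCoord d J p = (lineCoord d J p.1, p.2) := rfl

lemma totalCoord_target (J : ∀ i, Fin (n i + 1)) :
    (totalCoord (n := n) d J).target = Set.univ ×ˢ Metric.ball (0 : ℂ) 1 := by
  rw [← lineCoord_target d J]
  rfl

/-- The local equation `w² = γ ζ` of the total space. -/
def totalEq (J : ∀ i, Fin (n i + 1)) (p : ((∀ i, Fin (n i) → ℂ) × ℂ) × ℂ) : ℂ :=
  p.1.2 ^ 2 - localFun J (discr A) p.1.1 - p.2 * Γ.slope J (p.1.1, p.2)

/-- The equation is written with `slope`, which is holomorphic jointly in `(u, ζ)`. On each slice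
over the disk it is the equation of the double cover branched along `γ ζ`. -/
lemma totalEq_eq (J : ∀ i, Fin (n i + 1)) {p : ((∀ i, Fin (n i) → ℂ) × ℂ) × ℂ}
    (hp : p.2 ∈ Metric.ball (0 : ℂ) 1) : Γ.totalEq J p = coverEq J (Γ.γ p.2) p.1 := by
  rw [coverEq, Γ.localFun_γ J _ _ hp, totalEq, sub_sub]

lemma contDiffOn_totalEq (J : ∀ i, Fin (n i + 1)) :
    ContDiffOn ℂ ω (Γ.totalEq J) (Set.univ ×ˢ Metric.ball (0 : ℂ) 1) := by
  have h1 : ContDiff ℂ ω fun p : ((∀ i, Fin (n i) → ℂ) × ℂ) × ℂ => (p.1.1, p.2) := by fun_prop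
  have h2 := (Γ.contDiffOn_slope J).comp h1.contDiffOn (s := Set.univ ×ˢ Metric.ball (0 : ℂ) 1)
    fun p hp => ⟨trivial, hp.2⟩
  have h3 : ContDiff ℂ ω fun p : ((∀ i, Fin (n i) → ℂ) × ℂ) × ℂ => p.1.2 ^ 2 := by fun_prop
  have h4 : ContDiff ℂ ω fun p : ((∀ i, Fin (n i) → ℂ) × ℂ) × ℂ => localFun J (discr A) p.1.1 :=
    (contDiff_localFun J _).comp (by fun_prop)
  exact (h3.contDiffOn.sub h4.contDiffOn).sub (contDiff_snd.contDiffOn.mul h2)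

lemma isOpen_totalDomain : IsOpen ((Set.univ : Set ((∀ i, Fin (n i) → ℂ) × ℂ)) ×ˢ Metric.ball (0 : ℂ) 1) :=
  isOpen_univ.prod Metric.isOpen_ball

lemma differentiableAt_totalEq (J : ∀ i, Fin (n i + 1)) {p : ((∀ i, Fin (n i) → ℂ) × ℂ) × ℂ}
    (hp : p.2 ∈ Metric.ball (0 : ℂ) 1) : DifferentiableAt ℂ (Γ.totalEq J) p :=
  ((Γ.contDiffOn_totalEq J).contDiffAt (isOpen_totalDomain.mem_nhds ⟨trivial, hp⟩)).differentiableAt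
    (by simp)

lemma mem_total_iff {J : ∀ i, Fin (n i + 1)} {p : (lineBundle n d).TotalSpace × ℂ}
    (hp : p ∈ (totalCoord d J).source) : p ∈ Γ.total ↔ Γ.totalEq J (totalCoord d J p) = 0 := by
  obtain ⟨h1, h2⟩ := mem_totalCoord_source.1 hp
  rw [Γ.totalEq_eq J (by exact h2), coverEq, sub_eq_zero]
  exact (and_iff_right h2).trans (mem_doubleCover_iff_local (Γ.mem_sections p.2) h1)

/-- If the local equation is critical in the direction of the fibre, then the point is a node. -/
lemma node_of_fderiv_totalEq (hreg : IsRegularNet Sigma.fst A) (hA : ∀ j, A j ∈ sections n d)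
    {J : ∀ i, Fin (n i + 1)} {p : ((∀ i, Fin (n i) → ℂ) × ℂ) × ℂ} (hp : p.2 ∈ Metric.ball (0 : ℂ) 1)
    (h0 : Γ.totalEq J p = 0) (h1 : ∀ v, fderiv ℂ (Γ.totalEq J) p (v, 0) = 0) :
    p.1.2 = 0 ∧ p.2 = 0 ∧ ∀ j, localFun J (A j) p.1.1 = 0 := by
  have h2 : fderiv ℂ (coverEq J (Γ.γ p.2)) p.1 = 0 := by
    have hd := (Γ.differentiableAt_totalEq J hp).hasFDerivAt
    have hg : HasFDerivAt (fun v : (∀ i, Fin (n i) → ℂ) × ℂ => (v, p.2))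
      (ContinuousLinearMap.inl ℂ _ ℂ) p.1 := hasFDerivAt_prodMk_left p.1 p.2
    have h3 := HasFDerivAt.comp (g := Γ.totalEq J) p.1 hd hg
    have h4 : coverEq J (Γ.γ p.2) = Γ.totalEq J ∘ fun v => (v, p.2) :=
      funext fun v => (Γ.totalEq_eq J (p := (v, p.2)) hp).symm
    rw [h4, h3.fderiv]
    ext v <;> exact h1 _
  obtain ⟨hw, hdu⟩ := of_fderiv_coverEq h2
  rw [Γ.totalEq_eq J hp, coverEq, hw] at h0
  have hu : localFun J (Γ.γ p.2) p.1.1 = 0 := by simpa using h0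
  -- Off the centre `γ ζ` has no singular zero. At the centre it has the local equation of the
  -- discriminant, whose singular zeros are the nodes.
  have hζ : p.2 = 0 := by
    by_contra hne
    exact Γ.smooth p.2 hp hne J _ hu hdu
  have hfun : localFun J (Γ.γ p.2) = localFun J (discr A) := funext fun u => by
    rw [hζ, localFun_γ_zero]
  rw [hfun] at hu hdu
  exact ⟨hw, hζ, eq_zero_of_fderiv_discr hreg hA hu hdu⟩

/-- The differential of the local equation at a node. -/
lemma fderiv_totalEq_of_node {J : ∀ i, Fin (n i + 1)} {u : ∀ i, Fin (n i) → ℂ}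
    (hu : ∀ j, localFun J (A j) u = 0) (v : ((∀ i, Fin (n i) → ℂ) × ℂ) × ℂ) :
    fderiv ℂ (Γ.totalEq J) ((u, 0), 0) v = -(v.2 * Γ.slope J (u, 0)) := by
  have h1 : DifferentiableAt ℂ (fun p : ((∀ i, Fin (n i) → ℂ) × ℂ) × ℂ => Γ.slope J (p.1.1, p.2))
      ((u, 0), 0) := by
    have h : DifferentiableAt ℂ (Γ.slope J) (u, 0) :=
      ((Γ.contDiffOn_slope J).contDiffAt ((isOpen_univ.prod Metric.isOpen_ball).mem_nhds
        ⟨trivial, Metric.mem_ball_self one_pos⟩)).differentiableAt (by simp)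
    exact DifferentiableAt.comp (g := Γ.slope J) ((u, (0 : ℂ)), (0 : ℂ)) h (by fun_prop)
  have h2 : HasFDerivAt (fun p : ((∀ i, Fin (n i) → ℂ) × ℂ) × ℂ => localFun J (discr A) p.1.1)
      (0 : ((∀ i, Fin (n i) → ℂ) × ℂ) × ℂ →L[ℂ] ℂ) ((u, 0), 0) := by
    have h := (differentiableAt_localFun J (discr A) u).hasFDerivAt
    have h0 : fderiv ℂ (localFun J (discr A)) u = 0 := by
      refine ContinuousLinearMap.ext fun v => ?_
      rw [fderiv_localFun_discr, hu, hu, hu, zero_apply]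
      ring
    rw [h0] at h
    have hg : HasFDerivAt (fun p : ((∀ i, Fin (n i) → ℂ) × ℂ) × ℂ => p.1.1)
        ((ContinuousLinearMap.fst ℂ _ ℂ).comp (ContinuousLinearMap.fst ℂ _ ℂ)) ((u, 0), 0) :=
      ((ContinuousLinearMap.fst ℂ (∀ i, Fin (n i) → ℂ) ℂ).comp
        (ContinuousLinearMap.fst ℂ _ ℂ)).hasFDerivAt
    have := HasFDerivAt.comp (g := localFun J (discr A)) ((u, (0 : ℂ)), (0 : ℂ)) h hg
    rwa [ContinuousLinearMap.zero_comp] at this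
  have h3 : HasFDerivAt (fun p : ((∀ i, Fin (n i) → ℂ) × ℂ) × ℂ => p.1.2)
      ((ContinuousLinearMap.snd ℂ _ ℂ).comp (ContinuousLinearMap.fst ℂ _ ℂ)) ((u, 0), 0) :=
    ((ContinuousLinearMap.snd ℂ (∀ i, Fin (n i) → ℂ) ℂ).comp
      (ContinuousLinearMap.fst ℂ _ ℂ)).hasFDerivAt
  have h4 : HasFDerivAt (fun p : ((∀ i, Fin (n i) → ℂ) × ℂ) × ℂ => p.2)
      (ContinuousLinearMap.snd ℂ _ ℂ) ((u, 0), 0) := hasFDerivAt_snd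
  have h5 := ((h3.fun_mul h3).fun_sub h2).fun_sub (h4.fun_mul h1.hasFDerivAt)
  have h6 := h5.congr_of_eventuallyEq (f₁ := Γ.totalEq J)
    (Filter.Eventually.of_forall fun p => by rw [totalEq, sq])
  rw [h6.fderiv]
  simp [mul_comm]

/-- A critical zero would be a node over the centre, but there the derivative in the direction of
`ζ` is `-slope`, which does not vanish. -/
lemma fderiv_totalEq_ne_zero (hreg : IsRegularNet Sigma.fst A) (hA : ∀ j, A j ∈ sections n d)
    {J : ∀ i, Fin (n i + 1)} {p : ((∀ i, Fin (n i) → ℂ) × ℂ) × ℂ} (hp : p.2 ∈ Metric.ball (0 : ℂ) 1)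
    (h0 : Γ.totalEq J p = 0) : fderiv ℂ (Γ.totalEq J) p ≠ 0 := by
  intro h
  obtain ⟨hw, hζ, hu⟩ := Γ.node_of_fderiv_totalEq hreg hA hp h0 (fun v => by rw [h, zero_apply])
  have h1 := Γ.fderiv_totalEq_of_node hu (0, 1)
  have hpp : p = ((p.1.1, 0), 0) := Prod.ext (Prod.ext rfl hw) hζ
  rw [← hpp, h, zero_apply] at h1
  exact Γ.slope_ne_zero J _ hu (by simpa using h1)

lemma continuousOn_localFun_γ (J : ∀ i, Fin (n i + 1)) :
    ContinuousOn (fun p : (∀ i, Fin (n i) → ℂ) × ℂ => localFun J (Γ.γ p.2) p.1)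
      (Set.univ ×ˢ Metric.ball (0 : ℂ) 1) := by
  have h1 : ContinuousOn (fun p : (∀ i, Fin (n i) → ℂ) × ℂ => localFun J (discr A) p.1 +
      p.2 * Γ.slope J p) (Set.univ ×ˢ Metric.ball (0 : ℂ) 1) :=
    (((contDiff_localFun J _).continuous.comp continuous_fst).continuousOn).add
      (continuous_snd.continuousOn.mul (Γ.contDiffOn_slope J).continuousOn)
  exact h1.congr fun p hp => Γ.localFun_γ J p.1 p.2 hp.2

/-- The projection of the total space to the disk is proper. -/
lemma isProperMap_of_isEmbedding {N : Type*} [TopologicalSpace N]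
    {ι : N → (lineBundle n d).TotalSpace × ℂ} (hι : Topology.IsEmbedding ι)
    (hrange : Set.range ι = Γ.total) {π : N → unitDisk} (hπ : ∀ x, (π x : ℂ) = (ι x).2) :
    IsProperMap π := by
  have hcont : Continuous π := by
    rw [Topology.IsInducing.subtypeVal.continuous_iff]
    exact (continuous_snd.comp hι.continuous).congr fun x => (hπ x).symm
  rw [isProperMap_iff_isCompact_preimage]
  refine ⟨hcont, fun K hK => ?_⟩
  have hK' : IsCompact (Subtype.val '' K : Set ℂ) := hK.image continuous_subtype_val
  have hKb : (Subtype.val '' K : Set ℂ) ⊆ Metric.ball 0 1 := by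
    rintro _ ⟨ζ, -, rfl⟩
    exact ζ.2
  have h := isCompact_family (d := d) hK' Γ.mem_sections fun J =>
    (Γ.continuousOn_localFun_γ J).mono (Set.prod_mono_right hKb)
  rw [hι.isCompact_iff]
  convert h using 1
  ext p
  constructor
  · rintro ⟨x, hx, rfl⟩
    have hmem : ι x ∈ Γ.total := hrange ▸ Set.mem_range_self x
    exact ⟨⟨π x, hx, hπ x⟩, hmem.2⟩
  · rintro ⟨⟨ζ, hζ, hζp⟩, hp⟩
    obtain ⟨x, rfl⟩ : p ∈ Set.range ι := by
      rw [hrange]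
      exact ⟨hKb ⟨ζ, hζ, hζp⟩, hp⟩
    refine ⟨x, ?_, rfl⟩
    have : π x = ζ := Subtype.ext ((hπ x).trans hζp.symm)
    rwa [Set.mem_preimage, this]

/-- The projection to the disk is proper and its fibres are connected double covers. A branch point
on each fibre comes from the theorem on common zeros, applied to three copies of `γ ζ`. -/
lemma isConnected_total (hn : ∑ i, n i = 3) (hd : ∀ i, 1 ≤ d i) : IsConnected Γ.total := by
  rw [isConnected_iff_connectedSpace]
  let π : Γ.total → unitDisk := fun x => ⟨x.1.2, x.2.1⟩
  have hπ : IsProperMap π := Γ.isProperMap_of_isEmbedding Topology.IsEmbedding.subtypeVal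
    Subtype.range_val fun x => rfl
  have hconn : ∀ ζ : unitDisk, IsConnected (π ⁻¹' {ζ}) := by
    intro ζ
    obtain ⟨z, hz⟩ := exists_common_zero_point hn (d := 2 • d)
      (fun i => (hd i).trans (by simp; omega)) (A := fun _ => Γ.γ ζ) fun _ => Γ.mem_sections ζ
    have h := isConnected_doubleCover (Γ.mem_sections ζ) (hz 0)
    have : ConnectedSpace (doubleCover d (Γ.γ ζ)) := isConnected_iff_connectedSpace.1 h
    let g : doubleCover d (Γ.γ ζ) → Γ.total := fun e => ⟨(e.1, ζ), ζ.2, e.2⟩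
    have hg : Continuous g := (continuous_subtype_val.prodMk continuous_const).subtype_mk _
    have hr : π ⁻¹' {ζ} = Set.range g := by
      ext x
      constructor
      · intro hx
        have hx' : x.1.2 = ζ := congrArg Subtype.val hx
        exact ⟨⟨x.1.1, hx' ▸ x.2.2⟩, Subtype.ext (Prod.ext rfl hx'.symm)⟩
      · rintro ⟨e, rfl⟩
        rfl
    rw [hr]
    exact isConnected_range hg
  exact connectedSpace_of_isClosedMap hπ.isClosedMap
    (fun ζ => (hconn ζ).nonempty) (z₀ := unitDisk.center) (hconn _).isPreconnected
    fun x => Or.inr (hconn _).isPreconnected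

/-- The total space of the smoothing is a connected complex fourfold. -/
theorem exists_total_manifold (hn : ∑ i, n i = 3) (hd : ∀ i, 1 ≤ d i)
    (hreg : IsRegularNet Sigma.fst A) (hA : ∀ j, A j ∈ sections n d) :
    ∃ (T : ComplexManifold 4) (ι : T → (lineBundle n d).TotalSpace × ℂ),
      IsSubmanifoldEmbedding ((𝓘(ℂ, ∀ i, Fin (n i) → ℂ).prod 𝓘(ℂ)).prod 𝓘(ℂ)) Γ.total T ι :=
  exists_submanifold_of_regular_equations _
    (by rw [Module.finrank_prod, finrank_affine_prod hn, Module.finrank_self])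
    (Γ.isConnected_total hn hd) (totalCoord d) (isHolCoord_totalCoord d) Γ.totalEq
    (fun J => by rw [totalCoord_target]; exact Γ.contDiffOn_totalEq J)
    (fun p hp => (exists_mem_affineOpen p.1.proj).imp fun J hJ => mem_totalCoord_source.2 ⟨hJ, hp.1⟩)
    (fun J p hp => Γ.mem_total_iff hp)
    (fun J p hp h0 => Γ.fderiv_totalEq_ne_zero hreg hA (by rw [totalCoord_target] at hp; exact hp.2) h0)

end SmoothingFamily

end MultiProj

/-! ### Holomorphic maps to the disk -/

section Disk

variable {E₁ H₁ M₁ : Type*} [NormedAddCommGroup E₁] [NormedSpace ℂ E₁] [TopologicalSpace H₁]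
  {I₁ : ModelWithCorners ℂ E₁ H₁} [TopologicalSpace M₁] [ChartedSpace H₁ M₁]

lemma contMDiffAt_unitDisk {f : M₁ → unitDisk} {x : M₁}
    (hf : ContMDiffAt I₁ 𝓘(ℂ) ω (fun x => (f x : ℂ)) x) : ContMDiffAt I₁ 𝓘(ℂ) ω f x :=
  contMDiffAt_iff_target.2 ⟨Topology.IsInducing.subtypeVal.continuousAt_iff.2 hf.continuousAt, hf⟩

lemma mfderiv_unitDisk {f : M₁ → unitDisk} {x : M₁} (hf : ContMDiffAt I₁ 𝓘(ℂ) ω f x) :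
    (mfderiv I₁ 𝓘(ℂ) f x : TangentSpace I₁ x →L[ℂ] ℂ) =
      (mfderiv I₁ 𝓘(ℂ) (fun x => (f x : ℂ)) x : TangentSpace I₁ x →L[ℂ] ℂ) := by
  have hf' : ContMDiffAt I₁ 𝓘(ℂ) ω (fun x => (f x : ℂ)) x :=
    (contMDiff_subtype_val (f x)).comp x hf
  rw [(hf.mdifferentiableAt (by simp)).mfderiv, (hf'.mdifferentiableAt (by simp)).mfderiv]
  rfl

lemma isCriticalPt_iff_fderiv {m : ℕ} {T : ComplexManifold m} {π : T → unitDisk} {x : T}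
    (hπ : ContMDiffAt 𝓘(ℂ, Fin m → ℂ) 𝓘(ℂ) ω π x) :
    IsCriticalPt π x ↔
      fderiv ℂ (fun a => (π ((chartAt (Fin m → ℂ) x).symm a) : ℂ)) (chartAt (Fin m → ℂ) x x) = 0 := by
  have hf' : ContMDiffAt 𝓘(ℂ, Fin m → ℂ) 𝓘(ℂ) ω (fun x => (π x : ℂ)) x :=
    (contMDiff_subtype_val (π x)).comp x hπ
  have h2 : (mfderiv 𝓘(ℂ, Fin m → ℂ) 𝓘(ℂ) (fun x => (π x : ℂ)) x :
      TangentSpace 𝓘(ℂ, Fin m → ℂ) x →L[ℂ] ℂ) =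
      fderiv ℂ (fun a => (π ((chartAt (Fin m → ℂ) x).symm a) : ℂ)) (chartAt (Fin m → ℂ) x x) := by
    rw [(hf'.mdifferentiableAt (by simp)).mfderiv, ← fderivWithin_univ, modelWithCornersSelf_coe,
      Set.range_id]
    rfl
  rw [← h2, ← mfderiv_unitDisk hπ]
  exact Iff.rfl

end Disk

/-! ### Calculus at the singular points -/

lemma fderiv_fderiv_mul_apply {E : Type*} [NormedAddCommGroup E] [NormedSpace ℂ E] {f g : E → ℂ} {a : E}
    (hf : ContDiffAt ℂ ω f a) (hg : ContDiffAt ℂ ω g a) (x y : E) :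
    fderiv ℂ (fderiv ℂ fun b => f b * g b) a x y =
      f a * fderiv ℂ (fderiv ℂ g) a x y + fderiv ℂ f a x * fderiv ℂ g a y +
        fderiv ℂ g a x * fderiv ℂ f a y + g a * fderiv ℂ (fderiv ℂ f) a x y := by
  have hev : ∀ {h : E → ℂ}, ContDiffAt ℂ ω h a → ∀ᶠ b in 𝓝 a, DifferentiableAt ℂ h b := fun hh => by
    filter_upwards [hh.eventually (by simp)] with b hb using hb.differentiableAt (by simp)
  have hd : ∀ {h : E → ℂ}, ContDiffAt ℂ ω h a → DifferentiableAt ℂ (fderiv ℂ h) a := fun hh =>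
    (hh.fderiv_right (m := ω) (by simp)).differentiableAt (by simp)
  have h1 : (fderiv ℂ fun b => f b * g b) =ᶠ[𝓝 a] fun b => f b • fderiv ℂ g b + g b • fderiv ℂ f b := by
    filter_upwards [hev hf, hev hg] with b h1 h2 using fderiv_fun_mul h1 h2
  have hf1 := (hf.differentiableAt (by simp)).hasFDerivAt
  have hg1 := (hg.differentiableAt (by simp)).hasFDerivAt
  have h2 := (hf1.fun_smul (hd hg).hasFDerivAt).fun_add (hg1.fun_smul (hd hf).hasFDerivAt)
  rw [h1.fderiv_eq, h2.fderiv]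
  simp
  ring

lemma fderiv_fderiv_add_apply {E : Type*} [NormedAddCommGroup E] [NormedSpace ℂ E] {f g : E → ℂ} {a : E}
    (hf : ContDiffAt ℂ ω f a) (hg : ContDiffAt ℂ ω g a) (x y : E) :
    fderiv ℂ (fderiv ℂ fun b => f b + g b) a x y =
      fderiv ℂ (fderiv ℂ f) a x y + fderiv ℂ (fderiv ℂ g) a x y := by
  have hev : ∀ {h : E → ℂ}, ContDiffAt ℂ ω h a → ∀ᶠ b in 𝓝 a, DifferentiableAt ℂ h b := fun hh => by
    filter_upwards [hh.eventually (by simp)] with b hb using hb.differentiableAt (by simp)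
  have hd : ∀ {h : E → ℂ}, ContDiffAt ℂ ω h a → DifferentiableAt ℂ (fderiv ℂ h) a := fun hh =>
    (hh.fderiv_right (m := ω) (by simp)).differentiableAt (by simp)
  have h1 : (fderiv ℂ fun b => f b + g b) =ᶠ[𝓝 a] fun b => fderiv ℂ f b + fderiv ℂ g b := by
    filter_upwards [hev hf, hev hg] with b h1 h2 using fderiv_fun_add h1 h2
  rw [h1.fderiv_eq, ((hd hf).hasFDerivAt.fun_add (hd hg).hasFDerivAt).fderiv]
  rfl

/-- The Hessian of `p` at a critical zero, if `p K = w² - f₁² + 4 f₀ f₂`. -/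
lemma mul_fderiv_fderiv_of_quadratic {E : Type*} [NormedAddCommGroup E] [NormedSpace ℂ E]
    {p K w : E → ℂ} {f : Fin 3 → E → ℂ} {a : E} (hp : ContDiffAt ℂ ω p a) (hK : ContDiffAt ℂ ω K a)
    (hw : ContDiffAt ℂ ω w a) (hf : ∀ j, ContDiffAt ℂ ω (f j) a)
    (h : (fun b => p b * K b) =ᶠ[𝓝 a] fun b => w b * w b + (-1 * f 1 b * f 1 b + 4 * f 0 b * f 2 b))
    (hp0 : p a = 0) (hdp : ∀ v, fderiv ℂ p a v = 0) (hw0 : w a = 0) (hf0 : ∀ j, f j a = 0) (x y : E) :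
    K a * fderiv ℂ (fderiv ℂ p) a x y = 2 * fderiv ℂ w a x * fderiv ℂ w a y -
      2 * fderiv ℂ (f 1) a x * fderiv ℂ (f 1) a y +
      4 * (fderiv ℂ (f 0) a x * fderiv ℂ (f 2) a y + fderiv ℂ (f 2) a x * fderiv ℂ (f 0) a y) := by
  have hc : ∀ (c : ℂ) (j : Fin 3), ContDiffAt ℂ ω (fun b => c * f j b) a := fun c j =>
    contDiffAt_const.mul (hf j)
  have hdc : ∀ (c : ℂ) (j : Fin 3) (v : E), fderiv ℂ (fun b => c * f j b) a v = c * fderiv ℂ (f j) a v := by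
    intro c j v
    rw [fderiv_const_mul ((hf j).differentiableAt (by simp))]
    rfl
  -- Since `p` and its differential vanish at `a`, only `K` times the Hessian of `p` survives on the
  -- left. On the right only products of first derivatives survive.
  have h2 := fderiv_fderiv_mul_apply hp hK x y
  rw [h.fderiv.fderiv_eq, fderiv_fderiv_add_apply (hw.mul hw) (((hc _ 1).mul (hf 1)).add ((hc _ 0).mul (hf 2))),
    fderiv_fderiv_add_apply ((hc _ 1).mul (hf 1)) ((hc _ 0).mul (hf 2)), fderiv_fderiv_mul_apply hw hw,
    fderiv_fderiv_mul_apply (hc _ 1) (hf 1), fderiv_fderiv_mul_apply (hc _ 0) (hf 2)] at h2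
  simp only [hdc, hdp, hp0, hw0, hf0] at h2
  linear_combination -h2

/-- The quadratic form `w² - f₁² + 4 f₀ f₂` is nondegenerate if `f₀`, `f₁`, `f₂`, `w` are linear
coordinates. -/
lemma eq_zero_of_quadratic_form (f : Fin 3 → (Fin 4 → ℂ) →L[ℂ] ℂ) (w : (Fin 4 → ℂ) →L[ℂ] ℂ)
    (hinj : ∀ v, w v = 0 → (∀ j, f j v = 0) → v = 0) {v₁ : Fin 4 → ℂ}
    (h : ∀ y, 0 = 2 * w v₁ * w y - 2 * f 1 v₁ * f 1 y + 4 * (f 0 v₁ * f 2 y + f 2 v₁ * f 0 y)) :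
    v₁ = 0 := by
  let Q : (Fin 4 → ℂ) →ₗ[ℂ] (Fin 3 → ℂ) × ℂ := LinearMap.prod
    (LinearMap.pi fun j => (f j).toLinearMap) w.toLinearMap
  have hQinj : Function.Injective Q := by
    rw [← LinearMap.ker_eq_bot, LinearMap.ker_eq_bot']
    intro v hv
    obtain ⟨h1, h2⟩ := Prod.ext_iff.1 hv
    exact hinj v h2 fun j => congrFun h1 j
  have hQsurj : Function.Surjective Q :=
    (LinearMap.injective_iff_surjective_of_finrank_eq_finrank (by simp)).1 hQinj
  -- The four functionals are coordinates, so `y` can be chosen with arbitrary values of them, in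
  -- particular the unit vectors.
  have key : ∀ (g : Fin 3 → ℂ) (b : ℂ), 0 = 2 * w v₁ * b - 2 * f 1 v₁ * g 1 +
      4 * (f 0 v₁ * g 2 + f 2 v₁ * g 0) := by
    intro g b
    obtain ⟨y, hy⟩ := hQsurj (g, b)
    obtain ⟨h1, h2⟩ := Prod.ext_iff.1 hy
    have h3 : w y = b := h2
    have h4 : ∀ j, f j y = g j := fun j => congrFun h1 j
    have := h y
    rwa [h3, h4, h4, h4] at this
  have k0 := key ![0, 0, 1] 0
  have k1 := key ![0, 1, 0] 0
  have k2 := key ![1, 0, 0] 0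
  have k3 := key 0 1
  simp at k0 k1 k2 k3
  refine hinj v₁ k3 fun j => ?_
  fin_cases j
  · exact k0
  · exact k1
  · exact k2

/-! ### Critical points of the smoothing. -/

namespace MultiProj

open MvPolynomial

variable {r : ℕ} {n d : Fin r → ℕ} {A : Fin 3 → MvPolynomial (Σ i, Fin (n i + 1)) ℂ}
  {t : MvPolynomial (Σ i, Fin (n i + 1)) ℂ}

namespace SmoothingFamily

variable (Γ : SmoothingFamily d A t) {T : ComplexManifold 4} {ι : T → (lineBundle n d).TotalSpace × ℂ}
  (hι : IsSubmanifoldEmbedding ((𝓘(ℂ, ∀ i, Fin (n i) → ℂ).prod 𝓘(ℂ)).prod 𝓘(ℂ)) Γ.total T ι)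

/-- The projection of the total space to the disk. -/
def toDisk (x : T) : unitDisk := ⟨(ι x).2, (hι.mem x).1⟩

lemma contMDiff_toDisk : ContMDiff 𝓘(ℂ, Fin 4 → ℂ) 𝓘(ℂ) ω (Γ.toDisk hι) := fun x =>
  contMDiffAt_unitDisk ((contMDiff_snd (ι x)).comp x (hι.holomorphic x))

/-- The coordinates `(u, w, ζ)` as functions of the local coordinates of the total space. -/
def param (ι : T → (lineBundle n d).TotalSpace × ℂ) (J : ∀ i, Fin (n i + 1)) (x : T) (a : Fin 4 → ℂ) :
    ((∀ i, Fin (n i) → ℂ) × ℂ) × ℂ := totalCoord d J (ι ((chartAt (Fin 4 → ℂ) x).symm a))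

lemma param_self (J : ∀ i, Fin (n i + 1)) (x : T) :
    param ι J x (chartAt (Fin 4 → ℂ) x x) = totalCoord d J (ι x) := by
  rw [param, ComplexManifold.chart_symm_self]

include hι

lemma mem_source {J : ∀ i, Fin (n i + 1)} {x : T} (hx : (ι x).1.proj ∈ affineOpen J) :
    ι x ∈ (totalCoord d J).source := mem_totalCoord_source.2 ⟨hx, (hι.mem x).1⟩

lemma contMDiffAt_coord {J : ∀ i, Fin (n i + 1)} {x : T} (hx : (ι x).1.proj ∈ affineOpen J) :
    ContMDiffAt 𝓘(ℂ, Fin 4 → ℂ) 𝓘(ℂ, ((∀ i, Fin (n i) → ℂ) × ℂ) × ℂ) ω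
      (fun y => totalCoord d J (ι y)) x :=
  ((isHolCoord_totalCoord d J).contMDiffAt (Γ.mem_source hι hx)).comp x (hι.holomorphic x)

lemma contDiffAt_param {J : ∀ i, Fin (n i + 1)} {x : T} (hx : (ι x).1.proj ∈ affineOpen J) :
    ContDiffAt ℂ ω (param ι J x) (chartAt (Fin 4 → ℂ) x x) :=
  ComplexManifold.contDiffAt_comp_chart_symm (Γ.contMDiffAt_coord hι hx)

lemma injective_fderiv_param {J : ∀ i, Fin (n i + 1)} {x : T} (hx : (ι x).1.proj ∈ affineOpen J) :
    Function.Injective (fderiv ℂ (param ι J x) (chartAt (Fin 4 → ℂ) x x)) :=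
  ComplexManifold.injective_fderiv_comp_chart_symm (Γ.contMDiffAt_coord hι hx)
    (injective_mfderiv_comp (hι.holomorphic x)
      ((isHolCoord_totalCoord d J).contMDiffAt (Γ.mem_source hι hx)) (hι.injective_mfderiv x)
      ((isHolCoord_totalCoord d J).injective_mfderiv (Γ.mem_source hι hx)))

lemma eventually_totalEq_param {J : ∀ i, Fin (n i + 1)} {x : T} (hx : (ι x).1.proj ∈ affineOpen J) :
    ∀ᶠ a in 𝓝 (chartAt (Fin 4 → ℂ) x x), Γ.totalEq J (param ι J x a) = 0 := by
  have h1 : ContinuousAt (fun a => ι ((chartAt (Fin 4 → ℂ) x).symm a)) (chartAt (Fin 4 → ℂ) x x) :=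
    hι.holomorphic.continuous.continuousAt.comp
      (ComplexManifold.contMDiffAt_chart_symm x).continuousAt
  have h2 : (totalCoord d J).source ∈ 𝓝 (ι ((chartAt (Fin 4 → ℂ) x).symm (chartAt (Fin 4 → ℂ) x x))) := by
    rw [ComplexManifold.chart_symm_self]
    exact (totalCoord d J).open_source.mem_nhds (Γ.mem_source hι hx)
  filter_upwards [h1.preimage_mem_nhds h2] with a ha
  exact (Γ.mem_total_iff ha).1 (hι.mem _)

lemma fderiv_totalEq_fderiv_param {J : ∀ i, Fin (n i + 1)} {x : T} (hx : (ι x).1.proj ∈ affineOpen J)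
    (v : Fin 4 → ℂ) : fderiv ℂ (Γ.totalEq J) (totalCoord d J (ι x))
      (fderiv ℂ (param ι J x) (chartAt (Fin 4 → ℂ) x x) v) = 0 := by
  have h1 := ((Γ.contDiffAt_param hι hx).differentiableAt (by simp)).hasFDerivAt
  have h2 : HasFDerivAt (Γ.totalEq J) (fderiv ℂ (Γ.totalEq J) (totalCoord d J (ι x)))
      (param ι J x (chartAt (Fin 4 → ℂ) x x)) := by
    rw [param_self]
    exact (Γ.differentiableAt_totalEq J (hι.mem x).1).hasFDerivAt
  have h3 := (h2.comp _ h1).fderiv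
  have h4 : fderiv ℂ (Γ.totalEq J ∘ param ι J x) (chartAt (Fin 4 → ℂ) x x) = 0 := by
    rw [(show Γ.totalEq J ∘ param ι J x =ᶠ[𝓝 (chartAt (Fin 4 → ℂ) x x)] fun _ => 0 from
      Γ.eventually_totalEq_param hι hx).fderiv_eq, fderiv_fun_const]
    rfl
  rw [h4] at h3
  exact (congrArg (fun L : (Fin 4 → ℂ) →L[ℂ] ℂ => L v) h3).symm

lemma isCriticalPt_iff_param {J : ∀ i, Fin (n i + 1)} {x : T} (hx : (ι x).1.proj ∈ affineOpen J) :
    IsCriticalPt (Γ.toDisk hι) x ↔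
      ∀ v, (fderiv ℂ (param ι J x) (chartAt (Fin 4 → ℂ) x x) v).2 = 0 := by
  rw [isCriticalPt_iff_fderiv (Γ.contMDiff_toDisk hι x)]
  have h1 := ((Γ.contDiffAt_param hι hx).differentiableAt (by simp)).hasFDerivAt.snd
  rw [show fderiv ℂ (fun a => (Γ.toDisk hι ((chartAt (Fin 4 → ℂ) x).symm a) : ℂ))
    (chartAt (Fin 4 → ℂ) x x) = _ from h1.fderiv, ContinuousLinearMap.ext_iff]
  rfl

/-- The tangent space of the total space is the kernel of the differential of its equation. -/
lemma exists_fderiv_param_eq (hn : ∑ i, n i = 3) (hreg : IsRegularNet Sigma.fst A)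
    (hA : ∀ j, A j ∈ sections n d) {J : ∀ i, Fin (n i + 1)} {x : T}
    (hx : (ι x).1.proj ∈ affineOpen J) {q : ((∀ i, Fin (n i) → ℂ) × ℂ) × ℂ}
    (hq : fderiv ℂ (Γ.totalEq J) (totalCoord d J (ι x)) q = 0) :
    ∃ v, fderiv ℂ (param ι J x) (chartAt (Fin 4 → ℂ) x x) v = q := by
  let L : (((∀ i, Fin (n i) → ℂ) × ℂ) × ℂ) →ₗ[ℂ] ℂ :=
    (fderiv ℂ (Γ.totalEq J) (totalCoord d J (ι x))).toLinearMap
  let Q : (Fin 4 → ℂ) →ₗ[ℂ] (((∀ i, Fin (n i) → ℂ) × ℂ) × ℂ) :=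
    (fderiv ℂ (param ι J x) (chartAt (Fin 4 → ℂ) x x)).toLinearMap
  have hL : L ≠ 0 := fun h => Γ.fderiv_totalEq_ne_zero hreg hA (hι.mem x).1
    ((Γ.mem_total_iff (Γ.mem_source hι hx)).1 (hι.mem x))
    (ContinuousLinearMap.ext fun v => LinearMap.congr_fun h v)
  have hle : LinearMap.range Q ≤ LinearMap.ker L := by
    rintro _ ⟨v, rfl⟩
    exact Γ.fderiv_totalEq_fderiv_param hι hx v
  have h1 : Module.finrank ℂ (LinearMap.ker L) = 4 := by
    have h := LinearMap.finrank_range_add_finrank_ker L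
    rw [LinearMap.range_eq_top.2 (LinearMap.surjective hL), finrank_top, Module.finrank_self,
      Module.finrank_prod, finrank_affine_prod hn, Module.finrank_self] at h
    omega
  have h2 : Module.finrank ℂ (LinearMap.range Q) = 4 := by
    rw [LinearMap.finrank_range_of_inj (Γ.injective_fderiv_param hι hx)]
    simp
  -- The image of the parametrisation lies in the kernel of the differential, and both have
  -- dimension `4` in a space of dimension `5`.
  have h3 := Submodule.eq_of_le_of_finrank_eq hle (h2.trans h1.symm)
  have : q ∈ LinearMap.range Q := h3 ▸ hq
  exact this

/-- On the tangent space, the kernel of the differential of the equation, `dζ` vanishes exactly when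
that differential is a multiple of `dζ`. This means it is zero in the directions `(u, w)` of the
fibre, which characterises the nodes. -/
lemma isCriticalPt_iff_local (hn : ∑ i, n i = 3) (hreg : IsRegularNet Sigma.fst A)
    (hA : ∀ j, A j ∈ sections n d) {J : ∀ i, Fin (n i + 1)} {x : T}
    (hx : (ι x).1.proj ∈ affineOpen J) : IsCriticalPt (Γ.toDisk hι) x ↔
      (lineCoord d J (ι x).1).2 = 0 ∧ (ι x).2 = 0 ∧
        ∀ j, localFun J (A j) (affineChart J (ι x).1.proj) = 0 := by
  rw [Γ.isCriticalPt_iff_param hι hx]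
  have h0 := (Γ.mem_total_iff (Γ.mem_source hι hx)).1 (hι.mem x)
  constructor
  · intro h
    refine Γ.node_of_fderiv_totalEq hreg hA (p := totalCoord d J (ι x)) (hι.mem x).1 h0 fun v => ?_
    by_contra hne
    set L := fderiv ℂ (Γ.totalEq J) (totalCoord d J (ι x))
    -- If `L` were nonzero on `(v, 0)`, correcting `(0, 1)` by a multiple of `(v, 0)` would give a
    -- tangent vector with `ζ`-component `1`.
    obtain ⟨v', hv'⟩ := Γ.exists_fderiv_param_eq hι hn hreg hA hx
      (q := (0, 1) - (L (0, 1) / L (v, 0)) • (v, 0)) (by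
        rw [map_sub, map_smul, smul_eq_mul, div_mul_cancel₀ _ hne, sub_self])
    have := h v'
    rw [hv'] at this
    simp at this
  · rintro ⟨hw, hζ, hu⟩ v
    have h1 := Γ.fderiv_totalEq_fderiv_param hι hx v
    have hpp : totalCoord d J (ι x) = ((affineChart J (ι x).1.proj, 0), 0) :=
      Prod.ext (Prod.ext rfl hw) hζ
    rw [hpp, Γ.fderiv_totalEq_of_node hu, neg_eq_zero] at h1
    exact (mul_eq_zero.1 h1).resolve_right (Γ.slope_ne_zero J _ hu)

/-- The critical points are the nodes of the central fibre. -/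
lemma isCriticalPt_iff (hn : ∑ i, n i = 3) (hreg : IsRegularNet Sigma.fst A)
    (hA : ∀ j, A j ∈ sections n d) {x : T} : IsCriticalPt (Γ.toDisk hι) x ↔
      fibreCoord (ι x).1 = 0 ∧ (ι x).2 = 0 ∧ (ι x).1.proj ∈ nodes A := by
  obtain ⟨J, hJ⟩ := exists_mem_affineOpen (ι x).1.proj
  rw [Γ.isCriticalPt_iff_local hι hn hreg hA hJ, mem_nodes_iff hA hJ, ← lineCoord_snd_mul hJ,
    mul_eq_zero, or_iff_left (cornerMonomial_ne_zero d hJ)]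

lemma finite_setOf_isCriticalPt (hn : ∑ i, n i = 3) (hreg : IsRegularNet Sigma.fst A)
    (hA : ∀ j, A j ∈ sections n d) : {x | IsCriticalPt (Γ.toDisk hι) x}.Finite := by
  refine Set.Finite.of_injOn (f := fun x => (ι x).1.proj) (t := nodes A) (fun x hx => ?_)
    (fun x hx y hy hxy => ?_) (finite_nodes hn hreg hA)
  · exact ((Γ.isCriticalPt_iff hι hn hreg hA).1 hx).2.2
  · have h1 := (Γ.isCriticalPt_iff hι hn hreg hA).1 hx
    have h2 := (Γ.isCriticalPt_iff hι hn hreg hA).1 hy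
    exact hι.isEmbedding.injective (Prod.ext (eq_of_fibreCoord_eq hxy (h1.1.trans h2.1.symm))
      (h1.2.1.trans h2.2.1.symm))

omit hι in
lemma doubleCover_γ_zero (hA : ∀ j, A j ∈ sections n d) :
    doubleCover d (Γ.γ 0) = doubleCover d (discr A) := by
  ext e
  obtain ⟨J, hJ⟩ := exists_mem_affineOpen e.proj
  rw [mem_doubleCover_iff_local (Γ.mem_sections 0) hJ,
    mem_doubleCover_iff_local (discr_mem_sections hA) hJ, localFun_γ_zero]

lemma exists_isCriticalPt (hn : ∑ i, n i = 3) (hreg : IsRegularNet Sigma.fst A)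
    (hA : ∀ j, A j ∈ sections n d) {z : MultiProj n} (hz : z ∈ nodes A) :
    ∃ x, IsCriticalPt (Γ.toDisk hι) x := by
  obtain ⟨e, he, hw⟩ := exists_fibreCoord_eq d z 0
  have hmem : (e, (0 : ℂ)) ∈ Γ.total := by
    refine ⟨Metric.mem_ball_self one_pos, ?_⟩
    change e ∈ doubleCover d (Γ.γ 0)
    rw [Γ.doubleCover_γ_zero hA, mem_doubleCover_iff, hw, he]
    have h := fun j => hz j
    simp [discr, h]
  rw [← hι.range_eq] at hmem
  obtain ⟨x, hx⟩ := hmem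
  refine ⟨x, (Γ.isCriticalPt_iff hι hn hreg hA).2 ?_⟩
  rw [hx]
  exact ⟨hw, rfl, he ▸ hz⟩

set_option maxHeartbeats 1000000 in
/-- The critical points are ordinary double points. -/
theorem isOrdinaryDoublePt (hn : ∑ i, n i = 3) (hreg : IsRegularNet Sigma.fst A)
    (hA : ∀ j, A j ∈ sections n d) {x : T} (hcrit : IsCriticalPt (Γ.toDisk hι) x) :
    IsOrdinaryDoublePt (Γ.toDisk hι) x := by
  refine ⟨hcrit, fun v₁ hv₁ => ?_⟩
  obtain ⟨J, hJ⟩ := exists_mem_affineOpen (ι x).1.proj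
  obtain ⟨hw, hζ, hu⟩ := (Γ.isCriticalPt_iff_local hι hn hreg hA hJ).1 hcrit
  have hdζ := (Γ.isCriticalPt_iff_param hι hJ).1 hcrit
  set a₀ := chartAt (Fin 4 → ℂ) x x with ha₀
  have hparam := Γ.contDiffAt_param hι hJ
  have hself := param_self (ι := ι) J x
  set u₀ := affineChart J (ι x).1.proj with hu₀
  have hself' : param ι J x a₀ = ((u₀, 0), 0) := hself.trans (Prod.ext (Prod.ext rfl hw) hζ)
  let p : (Fin 4 → ℂ) → ℂ := fun a => (param ι J x a).2
  let w : (Fin 4 → ℂ) → ℂ := fun a => (param ι J x a).1.2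
  let f : Fin 3 → (Fin 4 → ℂ) → ℂ := fun j a => localFun J (A j) (param ι J x a).1.1
  let K : (Fin 4 → ℂ) → ℂ := fun a => Γ.slope J ((param ι J x a).1.1, (param ι J x a).2)
  have hp : ContDiffAt ℂ ω p a₀ := hparam.snd
  have hwd : ContDiffAt ℂ ω w a₀ := hparam.fst.snd
  have hf : ∀ j, ContDiffAt ℂ ω (f j) a₀ := fun j =>
    (contDiff_localFun J (A j)).contDiffAt.comp a₀ hparam.fst.fst
  have hK : ContDiffAt ℂ ω K a₀ := by
    have h : ContDiffAt ℂ ω (Γ.slope J) ((param ι J x a₀).1.1, (param ι J x a₀).2) :=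
      (Γ.contDiffOn_slope J).contDiffAt ((isOpen_univ.prod Metric.isOpen_ball).mem_nhds
        ⟨trivial, by rw [hself]; exact (hι.mem x).1⟩)
    exact ContDiffAt.comp (g := Γ.slope J) a₀ h (hparam.fst.fst.prodMk hparam.snd)
  have hp0 : p a₀ = 0 := congrArg Prod.snd hself'
  have hw0 : w a₀ = 0 := congrArg (fun q => q.1.2) hself'
  have hf0 : ∀ j, f j a₀ = 0 := fun j => by
    change localFun J (A j) (param ι J x a₀).1.1 = 0
    rw [hself']
    exact hu j
  have hK0 : K a₀ ≠ 0 := by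
    change Γ.slope J ((param ι J x a₀).1.1, (param ι J x a₀).2) ≠ 0
    rw [hself']
    exact Γ.slope_ne_zero J u₀ hu
  have hD := (hparam.differentiableAt (by simp)).hasFDerivAt
  have hdp : ∀ v, fderiv ℂ p a₀ v = 0 := fun v => by
    rw [show fderiv ℂ p a₀ = _ from hD.snd.fderiv]
    exact hdζ v
  have hdw : ∀ v, fderiv ℂ w a₀ v = (fderiv ℂ (param ι J x) a₀ v).1.2 := fun v => by
    rw [show fderiv ℂ w a₀ = _ from hD.fst.snd.fderiv]
    rfl
  have hdf : ∀ j v, fderiv ℂ (f j) a₀ v =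
      fderiv ℂ (localFun J (A j)) u₀ (fderiv ℂ (param ι J x) a₀ v).1.1 := fun j v => by
    have h1 : HasFDerivAt (localFun J (A j)) (fderiv ℂ (localFun J (A j)) u₀) (param ι J x a₀).1.1 := by
      rw [hself']
      exact (differentiableAt_localFun J (A j) u₀).hasFDerivAt
    have h2 : HasFDerivAt (f j) _ a₀ := HasFDerivAt.comp (g := localFun J (A j)) a₀ h1 hD.fst.fst
    rw [h2.fderiv]
    rfl
  -- On the total space `ζ K = w² - B² + 4 A C`, with `K ≠ 0` at the node. The Hessian of `ζ` times
  -- `K` is therefore the Hessian of the right side, and `hv₁` makes it vanish against every `y`.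
  have hess : ∀ y, 0 = 2 * fderiv ℂ w a₀ v₁ * fderiv ℂ w a₀ y -
      2 * fderiv ℂ (f 1) a₀ v₁ * fderiv ℂ (f 1) a₀ y +
      4 * (fderiv ℂ (f 0) a₀ v₁ * fderiv ℂ (f 2) a₀ y + fderiv ℂ (f 2) a₀ v₁ * fderiv ℂ (f 0) a₀ y) := by
    intro y
    rw [← mul_fderiv_fderiv_of_quadratic hp hK hwd hf ?_ hp0 hdp hw0 hf0,
      show fderiv ℂ (fderiv ℂ p) a₀ v₁ y = 0 from hv₁ y, mul_zero]
    filter_upwards [Γ.eventually_totalEq_param hι hJ] with a ha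
    rw [totalEq, localFun_discr] at ha
    simp only [p, K, w, f]
    linear_combination -ha
  refine eq_zero_of_quadratic_form (fun j => fderiv ℂ (f j) a₀) (fderiv ℂ w a₀) (fun v h3 h4 => ?_) hess
  -- The differentials of `w`, `A`, `B`, `C` separate tangent vectors: `dζ` is zero at the node, and
  -- the differentials of `A`, `B`, `C` determine the component along `Z`.
  refine Γ.injective_fderiv_param hι hJ ?_
  rw [map_zero]
  refine Prod.ext (Prod.ext ?_ ?_) (hdζ v)
  · refine (bijective_netDeriv hn hreg hA hu).1 ?_
    rw [Prod.fst_zero, Prod.fst_zero, map_zero]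
    exact funext fun j => (hdf j v).symm.trans (h4 j)
  · exact (hdw v).symm.trans h3

end SmoothingFamily

end MultiProj

/-! ### Flatness -/

namespace unitDisk

lemma eventually_coe_iff {ζ : unitDisk} {p : ℂ → Prop} :
    (∀ᶠ y : unitDisk in 𝓝 ζ, p y) ↔ ∀ᶠ z in 𝓝 (ζ : ℂ), p z := by
  rw [← unitDisk.isOpen.isOpenEmbedding_subtypeVal.map_nhds_eq]
  exact Iff.rfl

lemma contMDiffAt_of_analyticAt {ζ : unitDisk} {F : ℂ → ℂ} (hF : AnalyticAt ℂ F ζ) :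
    ContMDiffAt 𝓘(ℂ) 𝓘(ℂ) ω (fun y : unitDisk => F y) ζ :=
  hF.contDiffAt.contMDiffAt.comp ζ (contMDiff_subtype_val ζ)

lemma exists_analyticAt {ζ : unitDisk} {f : unitDisk → ℂ} (hf : ContMDiffAt 𝓘(ℂ) 𝓘(ℂ) ω f ζ) :
    ∃ F : ℂ → ℂ, AnalyticAt ℂ F ζ ∧ ∀ y : unitDisk, F y = f y := by
  refine ⟨f ∘ (chartAt ℂ ζ).symm, ?_, fun y => ?_⟩
  · have h := (contMDiffAt_iff.1 hf).2
    rw [modelWithCornersSelf_coe, Set.range_id, contDiffWithinAt_univ] at h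
    exact ContDiffAt.analyticAt h
  · have h1 : y ∈ (chartAt ℂ ζ).source := by
      simp [TopologicalSpace.Opens.chartAt_eq, chartAt_self_eq]
    exact congrArg f ((chartAt ℂ ζ).left_inv h1)

/-- The germ at `ζ` of a function analytic at `ζ`. -/
def germ {ζ : unitDisk} {F : ℂ → ℂ} (hF : AnalyticAt ℂ F ζ) : holGerms 𝓘(ℂ) ζ :=
  ⟨((fun y : unitDisk => F y : unitDisk → ℂ) : Filter.Germ (𝓝 ζ) ℂ), _, contMDiffAt_of_analyticAt hF, rfl⟩

lemma exists_eq_germ {ζ : unitDisk} (φ : holGerms 𝓘(ℂ) ζ) :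
    ∃ (F : ℂ → ℂ) (hF : AnalyticAt ℂ F ζ), φ = germ hF := by
  obtain ⟨_, f, hf, rfl⟩ := φ
  obtain ⟨F, hF, h⟩ := exists_analyticAt hf
  refine ⟨F, hF, Subtype.ext ?_⟩
  exact congrArg (fun f : unitDisk → ℂ => (f : Filter.Germ (𝓝 ζ) ℂ)) (funext fun y => (h y).symm)

lemma germ_eq_germ_iff {ζ : unitDisk} {F G : ℂ → ℂ} {hF : AnalyticAt ℂ F ζ} {hG : AnalyticAt ℂ G ζ} :
    germ hF = germ hG ↔ F =ᶠ[𝓝 (ζ : ℂ)] G := by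
  rw [Subtype.ext_iff, germ, germ, Filter.Germ.coe_eq]
  exact eventually_coe_iff (p := fun z => F z = G z)

lemma germ_eq_zero_iff {ζ : unitDisk} {F : ℂ → ℂ} {hF : AnalyticAt ℂ F ζ} :
    germ hF = 0 ↔ F =ᶠ[𝓝 (ζ : ℂ)] 0 := by
  have h : (0 : holGerms 𝓘(ℂ) ζ) = germ (F := fun _ => 0) analyticAt_const := rfl
  rw [h, germ_eq_germ_iff]
  exact Iff.rfl

lemma germ_mul {ζ : unitDisk} {F G : ℂ → ℂ} (hF : AnalyticAt ℂ F ζ) (hG : AnalyticAt ℂ G ζ) :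
    germ hF * germ hG = germ (F := fun z => F z * G z) (hF.mul hG) := rfl

instance (ζ : unitDisk) : Nontrivial (holGerms 𝓘(ℂ) ζ) := by
  refine ⟨⟨0, 1, fun h => ?_⟩⟩
  have h1 : (1 : holGerms 𝓘(ℂ) ζ) = germ (F := fun _ => 1) analyticAt_const := rfl
  rw [eq_comm, h1, germ_eq_zero_iff] at h
  exact one_ne_zero h.eq_of_nhds

instance (ζ : unitDisk) : IsDomain (holGerms 𝓘(ℂ) ζ) := by
  have : NoZeroDivisors (holGerms 𝓘(ℂ) ζ) := ⟨fun {a b} hab => by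
    obtain ⟨F, hF, rfl⟩ := exists_eq_germ a
    obtain ⟨G, hG, rfl⟩ := exists_eq_germ b
    rw [germ_mul, germ_eq_zero_iff] at hab
    rw [germ_eq_zero_iff, germ_eq_zero_iff]
    rcases hF.eventually_eq_zero_or_eventually_ne_zero with h | h
    · exact Or.inl h
    rcases hG.eventually_eq_zero_or_eventually_ne_zero with h' | h'
    · exact Or.inr h'
    obtain ⟨z, h1, h2, h3⟩ := (h.and (h'.and (hab.filter_mono nhdsWithin_le_nhds))).exists
    exact absurd h3 (mul_ne_zero h1 h2)⟩
  exact NoZeroDivisors.to_isDomain _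

lemma germ_dvd_germ {ζ : unitDisk} {F G u v : ℂ → ℂ} (hF : AnalyticAt ℂ F ζ) (hG : AnalyticAt ℂ G ζ)
    (hu : AnalyticAt ℂ u ζ) (hv : AnalyticAt ℂ v ζ) (hu0 : u ζ ≠ 0) {k l : ℕ} (hkl : k ≤ l)
    (hFu : ∀ᶠ z in 𝓝 (ζ : ℂ), F z = (z - ζ) ^ k • u z)
    (hGv : ∀ᶠ z in 𝓝 (ζ : ℂ), G z = (z - ζ) ^ l • v z) : germ hF ∣ germ hG := by
  have hq : AnalyticAt ℂ (fun z : ℂ => (z - ζ) ^ (l - k) * (v z / u z)) ζ :=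
    ((analyticAt_id.sub analyticAt_const).pow _).mul (hv.div hu hu0)
  refine ⟨germ hq, ?_⟩
  rw [germ_mul, germ_eq_germ_iff]
  filter_upwards [hFu, hGv, hu.continuousAt.eventually_ne hu0] with z h1 h2 h3
  rw [h1, h2, smul_eq_mul, smul_eq_mul, ← Nat.sub_add_cancel hkl, pow_add]
  simp only [Nat.add_sub_cancel]
  field_simp

/-- A nonzero germ is a power of `z - ζ` times a unit, so divisibility is the comparison of orders
of vanishing. -/
instance (ζ : unitDisk) : ValuationRing (holGerms 𝓘(ℂ) ζ) := by
  refine ValuationRing.iff_dvd_total.2 ⟨fun a b => ?_⟩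
  obtain ⟨F, hF, rfl⟩ := exists_eq_germ a
  obtain ⟨G, hG, rfl⟩ := exists_eq_germ b
  by_cases hF0 : ∀ᶠ z in 𝓝 (ζ : ℂ), F z = 0
  · rw [germ_eq_zero_iff.2 hF0]
    exact Or.inr (dvd_zero _)
  by_cases hG0 : ∀ᶠ z in 𝓝 (ζ : ℂ), G z = 0
  · rw [germ_eq_zero_iff.2 hG0]
    exact Or.inl (dvd_zero _)
  obtain ⟨k, u, hu, hu0, hFu⟩ := hF.exists_eventuallyEq_pow_smul_nonzero_iff.2 hF0
  obtain ⟨l, v, hv, hv0, hGv⟩ := hG.exists_eventuallyEq_pow_smul_nonzero_iff.2 hG0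
  rcases le_total k l with h | h
  · exact Or.inl (germ_dvd_germ hF hG hu hv hu0 h hFu hGv)
  · exact Or.inr (germ_dvd_germ hG hF hv hu hv0 h hGv hFu)

end unitDisk

lemma ComplexManifold.infinite_of_isOpen {m : ℕ} [NeZero m] (T : ComplexManifold m) {O : Set T}
    (hO : IsOpen O) (hne : O.Nonempty) : O.Infinite := by
  intro hfin
  obtain ⟨y, hy⟩ := hne
  have h1 : IsOpen ({y} : Set T) := by
    have : ({y} : Set T) = O \ (O \ {y}) := by
      ext z
      simp only [Set.mem_singleton_iff, Set.mem_sdiff, not_and, not_not]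
      exact ⟨fun h => ⟨h ▸ hy, fun _ => h⟩, fun h => h.2 h.1⟩
    rw [this]
    exact hO.sdiff (hfin.subset Set.sdiff_subset).isClosed
  have h2 := (chartAt (Fin m → ℂ) y).isOpen_image_of_subset_source h1
    (Set.singleton_subset_iff.2 (mem_chart_source _ y))
  rw [Set.image_singleton] at h2
  have := Module.punctured_nhds_neBot ℂ (Fin m → ℂ) (chartAt (Fin m → ℂ) y y)
  exact not_isOpen_singleton _ h2

/-- A holomorphic function with finitely many critical points is flat. -/
theorem isFlatHol_of_finite {m : ℕ} [NeZero m] {T : ComplexManifold m} {π : T → unitDisk}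
    (hπ : ContMDiff 𝓘(ℂ, Fin m → ℂ) 𝓘(ℂ) ω π) (hfin : {x | IsCriticalPt π x}.Finite) :
    IsFlatHol 𝓘(ℂ, Fin m → ℂ) 𝓘(ℂ) hπ := by
  intro x
  rw [RingHom.Flat]
  algebraize [holGermsMap 𝓘(ℂ, Fin m → ℂ) 𝓘(ℂ) (hπ x)]
  -- Over a valuation ring, which is Bézout, flatness is the absence of torsion.
  rw [Module.Flat.flat_iff_torsion_eq_bot_of_isBezout, eq_bot_iff]
  intro b hb
  obtain ⟨a, ha⟩ := (Submodule.mem_torsion_iff b).1 hb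
  obtain ⟨_, h, hh, rfl⟩ := b
  obtain ⟨F, hF, haF⟩ := unitDisk.exists_eq_germ a.1
  have ha0 : a.1 ≠ 0 := nonZeroDivisors.ne_zero a.2
  have hF0 : ∀ᶠ z in 𝓝[≠] ((π x : unitDisk) : ℂ), F z ≠ 0 := by
    refine hF.eventually_eq_zero_or_eventually_ne_zero.resolve_left fun h0 => ha0 ?_
    rw [haF]
    exact unitDisk.germ_eq_zero_iff.2 h0
  have hprod : ∀ᶠ y in 𝓝 x, F (π y) * h y = 0 := by
    have h1 : a.1 • (⟨(h : Filter.Germ (𝓝 x) ℂ), h, hh, rfl⟩ : holGerms 𝓘(ℂ, Fin m → ℂ) x) = 0 := ha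
    rw [haF, Algebra.smul_def, Subtype.ext_iff] at h1
    exact Filter.Germ.coe_eq.1 h1
  -- A nonzero germ `F` in one variable vanishes at most at its centre, so a torsion element `h` is
  -- supported on the fibre through `x`.
  have hne : ∀ᶠ y in 𝓝 x, π y ≠ π x → h y = 0 := by
    rw [eventually_nhdsWithin_iff, ← unitDisk.eventually_coe_iff] at hF0
    filter_upwards [hprod, (hπ x).continuousAt.eventually hF0] with y h1 h2 h3
    exact (mul_eq_zero.1 h1).resolve_left (h2 fun h4 => h3 (Subtype.ext h4))
  have hcont : ∀ᶠ y in 𝓝 x, ContinuousAt h y := by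
    filter_upwards [(contMDiffAt_iff_contMDiffAt_nhds (by simp)).1 hh] with y hy using hy.continuousAt
  rw [Submodule.mem_bot]
  refine Subtype.ext (Filter.Germ.coe_eq.2 ?_)
  filter_upwards [hcont, hne.eventually_nhds] with y h1 h2
  by_contra h3
  -- If `h y ≠ 0` then `π` is constant near `y`. A whole open set would then consist of critical
  -- points, but a nonempty open set is infinite.
  have h4 : ∀ᶠ z in 𝓝 y, π z = π x := by
    filter_upwards [h2, h1.eventually_ne h3] with z h5 h6
    by_contra h7
    exact h6 (h5 h7)
  obtain ⟨O, hO, hOo, hyO⟩ := eventually_nhds_iff.1 h4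
  refine T.infinite_of_isOpen hOo ⟨y, hyO⟩ (hfin.subset fun z hz => ?_)
  have h8 : π =ᶠ[𝓝 z] fun _ => π x := by
    filter_upwards [hOo.mem_nhds hz] with w hw using hO w hw
  have h9 : HasMFDerivAt 𝓘(ℂ, Fin m → ℂ) 𝓘(ℂ) π z
      (0 : TangentSpace 𝓘(ℂ, Fin m → ℂ) z →L[ℂ] TangentSpace 𝓘(ℂ) (π x)) :=
    (hasMFDerivAt_const (π x) z).congr_of_eventuallyEq h8
  exact h9.mfderiv

/-! ### Projective embeddings -/

namespace ProjSpace

variable {N : ℕ}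

/-- The point with the given homogeneous coordinates; a junk value if all of them vanish. -/
def ofVec (v : Fin (N + 1) → ℂ) : ProjSpace N :=
  open Classical in if h : v ≠ 0 then Projectivization.mk ℂ v h else Projectivization.mk ℂ 1 one_ne_zero

lemma ofVec_eq_mk {v : Fin (N + 1) → ℂ} (hv : v ≠ 0) : ofVec v = Projectivization.mk ℂ v hv :=
  dif_pos hv

lemma ofVec_smul {c : ℂ} (hc : c ≠ 0) {v : Fin (N + 1) → ℂ} (hv : v ≠ 0) : ofVec (c • v) = ofVec v := by
  rw [ofVec_eq_mk hv, ofVec_eq_mk (smul_ne_zero hc hv), Projectivization.mk_eq_mk_iff']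
  exact ⟨c, rfl⟩

lemma ofVec_mem_affineOpen {v : Fin (N + 1) → ℂ} {j : Fin (N + 1)} (hj : v j ≠ 0) :
    ofVec v ∈ affineOpen j := by
  rw [ofVec_eq_mk (fun h => hj (congrFun h j)), mk_mem_affineOpen]
  exact hj

lemma ne_zero_of_ofVec_mem_affineOpen {v : Fin (N + 1) → ℂ} (hv : v ≠ 0) {j : Fin (N + 1)}
    (h : ofVec v ∈ affineOpen j) : v j ≠ 0 := by
  rwa [ofVec_eq_mk hv, mk_mem_affineOpen] at h

lemma ratio_ofVec {v : Fin (N + 1) → ℂ} (hv : v ≠ 0) (j k : Fin (N + 1)) :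
    ratio j k (ofVec v) = v k / v j := by
  rw [ofVec_eq_mk hv, ratio_mk]

lemma eq_ofVec {p : ProjSpace 1} {v : Fin 2 → ℂ} (hv : v ≠ 0) (h : p.rep 0 * v 1 = p.rep 1 * v 0) :
    p = ofVec v := by
  rw [eq_iff_rep, ofVec_eq_mk hv]
  obtain ⟨c, hc⟩ := Projectivization.exists_smul_eq_mk_rep ℂ v hv
  have hrep : ∀ k, (Projectivization.mk ℂ v hv).rep k = c * v k := fun k => by rw [← hc]; rfl
  rw [hrep, hrep]
  linear_combination (c : ℂ) * h

variable {E H M : Type*} [NormedAddCommGroup E] [NormedSpace ℂ E] [TopologicalSpace H]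
  {I : ModelWithCorners ℂ E H} [TopologicalSpace M] [ChartedSpace H M]

lemma contMDiffAt_ofVec {v : M → Fin (N + 1) → ℂ} {x : M} (hv : ∀ k, ContMDiffAt I 𝓘(ℂ) ω (fun y => v y k) x)
    (hx : v x ≠ 0) : ContMDiffAt I 𝓘(ℂ, Fin N → ℂ) ω (fun y => ofVec (v y)) x := by
  obtain ⟨j, hj⟩ := Function.ne_iff.1 hx
  have h1 : ContMDiffAt I 𝓘(ℂ, Fin N → ℂ) ω (fun y => fun k => v y (j.succAbove k) / v y j) x :=
    contMDiffAt_pi_space.2 fun k => (hv _).div₀ (hv j) hj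
  have h2 := (isHolCoord_affineChart j).contMDiffOn_symm.contMDiffAt
    ((affineChart (n := N) j).open_target.mem_nhds (x := fun k => v x (j.succAbove k) / v x j) trivial)
  refine (ContMDiffAt.comp x h2 h1).congr_of_eventuallyEq ?_
  filter_upwards [(hv j).continuousAt.eventually_ne hj] with y hy
  have hy0 : v y ≠ 0 := fun h => hy (congrFun h j)
  refine ((affineChart j).left_inv (ofVec_mem_affineOpen hy)).symm.trans (congrArg (affineChart j).symm ?_)
  exact funext fun k => ratio_ofVec hy0 _ _

lemma contMDiffAt_ratio (j k : Fin (N + 1)) {p : ProjSpace N} (hp : p ∈ affineOpen j) :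
    ContMDiffAt 𝓘(ℂ, Fin N → ℂ) 𝓘(ℂ) ω (ratio j k) p := by
  refine Fin.succAboveCases j ?_ (fun l => ?_) k
  · refine contMDiffAt_const (c := (1 : ℂ)).congr_of_eventuallyEq ?_
    filter_upwards [(isOpen_affineOpen j).mem_nhds hp] with q hq using div_self hq
  · exact contMDiffAt_pi_space.1 ((isHolCoord_affineChart j).contMDiffAt hp) l

end ProjSpace

namespace MultiProj

open MvPolynomial

variable {r : ℕ} {n d : Fin r → ℕ}

/-! ### The projective cone over the Segre-Veronese variety. -/

section Cone

/-- The number of monomials of multidegree `d`. -/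
abbrev coneDim (n d : Fin r → ℕ) : ℕ :=
  Fintype.card (Exponents (Sigma.fst : (Σ i, Fin (n i + 1)) → Fin r) d)

/-- An enumeration of the monomials of multidegree `d` and of one additional index. -/
def coneIndex (n d : Fin r → ℕ) : Option (Exponents (Sigma.fst : (Σ i, Fin (n i + 1)) → Fin r) d) ≃
    Fin (coneDim n d + 1) :=
  Fintype.equivFinOfCardEq Fintype.card_option

/-- The monomials of multidegree `d` and the fibre coordinate: homogeneous coordinates on the total
space of `𝒪(d)`. -/
def coneCoord (e : (lineBundle n d).TotalSpace)
    (k : Fin (coneDim n d + 1)) : ℂ :=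
  ((coneIndex n d).symm k).elim (fibreCoord e) fun c => eval (coords e.proj) (monomial c.1 1)

/-- The homogeneous coordinates on the total space of `𝒪(d)` in a trivialisation. -/
def coneLocal (d : Fin r → ℕ) (J : ∀ i, Fin (n i + 1)) (p : (∀ i, Fin (n i) → ℂ) × ℂ)
    (k : Fin (coneDim n d + 1)) : ℂ :=
  ((coneIndex n d).symm k).elim p.2 fun c => localFun J (monomial c.1 1) p.1

lemma coneCoord_eq {J : ∀ i, Fin (n i + 1)} {e : (lineBundle n d).TotalSpace} (he : e.proj ∈ affineOpen J) :
    coneCoord e = cornerMonomial d J e.proj • coneLocal d J (lineCoord d J e) := by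
  ext k
  rw [Pi.smul_apply, coneCoord, coneLocal]
  cases (coneIndex n d).symm k with
  | none => exact (lineCoord_snd_mul he).symm.trans (mul_comm _ _)
  | some c => exact eval_coords (isWeightedHomogeneous_monomial _ _ _ c.2) he

lemma contDiff_coneLocal (J : ∀ i, Fin (n i + 1)) (k) : ContDiff ℂ ω fun p => coneLocal d J p k := by
  simp only [coneLocal]
  cases (coneIndex n d).symm k with
  | none => exact contDiff_snd
  | some c => exact (contDiff_localFun J _).comp contDiff_fst

/-- The index of the monomial `∏ v_(J i) ^ d i`. -/
def cornerIndex (d : Fin r → ℕ) (J : ∀ i, Fin (n i + 1)) :=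
  coneIndex n d (some ⟨cornerExponent (fun i => ⟨i, J i⟩) d, weight_cornerExponent (fun _ => rfl) d⟩)

/-- A coordinate other than the normalised ones. -/
def affineIndex (J : ∀ i, Fin (n i + 1)) (i : Fin r) (l : Fin (n i)) :
    AffineIndex (Sigma.fst : (Σ i, Fin (n i + 1)) → Fin r) fun i => ⟨i, J i⟩ :=
  ⟨⟨i, (J i).succAbove l⟩, fun h => (J i).succAbove_ne l (eq_of_heq (Sigma.mk.inj h).2).symm⟩

/-- The index of the monomial `∏ v_(J i) ^ d i` with one factor `v_(J i)` replaced by another coordinate. -/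
def linearIndex (hd : ∀ i, 1 ≤ d i) (J : ∀ i, Fin (n i + 1)) (i : Fin r) (l : Fin (n i)) :=
  coneIndex n d (some ⟨linearExponent Sigma.fst (fun i => ⟨i, J i⟩) d (some (affineIndex J i l)),
    weight_linearExponent (fun _ => rfl) hd _⟩)

lemma homog_eq_cornerPoint (J : ∀ i, Fin (n i + 1)) (u : ∀ i, Fin (n i) → ℂ) :
    homog J u = cornerPoint Sigma.fst (fun i => ⟨i, J i⟩) fun k => homog J u k.1 := by
  ext ⟨i, k⟩
  rw [cornerPoint]
  split_ifs with h
  · obtain rfl : J i = k := eq_of_heq (Sigma.mk.inj h).2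
    exact homog_self J u i
  · rfl

lemma coneLocal_cornerIndex (J : ∀ i, Fin (n i + 1)) (p : (∀ i, Fin (n i) → ℂ) × ℂ) :
    coneLocal d J p (cornerIndex d J) = 1 := by
  rw [coneLocal, cornerIndex, Equiv.symm_apply_apply]
  refine Eq.trans ?_ (eval_cornerPoint_corner (β := Sigma.fst) (J := fun i => ⟨i, J i⟩) (fun _ => rfl) d
    fun k => homog J p.1 k.1)
  rw [← homog_eq_cornerPoint]
  rfl

lemma coneLocal_linearIndex (hd : ∀ i, 1 ≤ d i) (J : ∀ i, Fin (n i + 1)) (i : Fin r) (l : Fin (n i))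
    (p : (∀ i, Fin (n i) → ℂ) × ℂ) : coneLocal d J p (linearIndex hd J i l) = p.1 i l := by
  rw [coneLocal, linearIndex, Equiv.symm_apply_apply, ← homog_succAbove J p.1 i l]
  refine Eq.trans ?_ (eval_cornerPoint_linear (β := Sigma.fst) (J := fun i => ⟨i, J i⟩) (fun _ => rfl) d
    (fun k => homog J p.1 k.1) (affineIndex J i l))
  rw [← homog_eq_cornerPoint]
  rfl

lemma coneLocal_none (J : ∀ i, Fin (n i + 1)) (p : (∀ i, Fin (n i) → ℂ) × ℂ) :
    coneLocal d J p (coneIndex n d none) = p.2 := by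
  rw [coneLocal, Equiv.symm_apply_apply]
  rfl

lemma coneLocal_ne_zero (J : ∀ i, Fin (n i + 1)) (p : (∀ i, Fin (n i) → ℂ) × ℂ) : coneLocal d J p ≠ 0 :=
  fun h => one_ne_zero ((coneLocal_cornerIndex J p).symm.trans (congrFun h _))

lemma coneCoord_ne_zero (e : (lineBundle n d).TotalSpace) : coneCoord e ≠ 0 := by
  obtain ⟨J, hJ⟩ := exists_mem_affineOpen e.proj
  rw [coneCoord_eq hJ]
  exact smul_ne_zero (cornerMonomial_ne_zero d hJ) (coneLocal_ne_zero J _)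

/-- The embedding of the total space of `𝒪(d)` into the projective cone over the Segre-Veronese
variety. -/
def toCone (e : (lineBundle n d).TotalSpace) :
    ProjSpace (coneDim n d) :=
  ProjSpace.ofVec (coneCoord e)

lemma toCone_eq {J : ∀ i, Fin (n i + 1)} {e : (lineBundle n d).TotalSpace} (he : e.proj ∈ affineOpen J) :
    toCone e = ProjSpace.ofVec (coneLocal d J (lineCoord d J e)) := by
  rw [toCone, coneCoord_eq he, ProjSpace.ofVec_smul (cornerMonomial_ne_zero d he) (coneLocal_ne_zero J _)]

lemma contMDiff_toCone : ContMDiff (𝓘(ℂ, ∀ i, Fin (n i) → ℂ).prod 𝓘(ℂ)) 𝓘(ℂ, Fin (coneDim n d) → ℂ) ω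
    (toCone : (lineBundle n d).TotalSpace → _) := by
  intro e
  obtain ⟨J, hJ⟩ := exists_mem_affineOpen e.proj
  have hs := mem_lineCoord_source (d := d).2 hJ
  have h1 := ProjSpace.contMDiffAt_ofVec (v := fun e => coneLocal d J (lineCoord d J e))
    (fun k => (contDiff_coneLocal J k).contMDiff.contMDiffAt.comp e ((isHolCoord_lineCoord d J).contMDiffAt hs))
    (coneLocal_ne_zero J _)
  refine h1.congr_of_eventuallyEq ?_
  filter_upwards [(lineCoord d J).open_source.mem_nhds hs] with e' he'
  exact toCone_eq (mem_lineCoord_source.1 he')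

/-- The coordinates of a point of the total space of `𝒪(d)`, recovered from its image in the cone. -/
def ofCone (hd : ∀ i, 1 ≤ d i) (J : ∀ i, Fin (n i + 1))
    (p : ProjSpace (coneDim n d)) :
    (∀ i, Fin (n i) → ℂ) × ℂ :=
  (fun i l => ProjSpace.ratio (cornerIndex d J) (linearIndex hd J i l) p,
    ProjSpace.ratio (cornerIndex d J) (coneIndex n d none) p)

/-- Relative to the corner monomial, the linear monomials are the affine coordinates `u` and the
last coordinate is `w`. The holomorphic left inverse `ofCone` gives both injectivity and immersivity
of the cone map. -/
lemma ofCone_toCone (hd : ∀ i, 1 ≤ d i) {J : ∀ i, Fin (n i + 1)} {e : (lineBundle n d).TotalSpace}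
    (he : e.proj ∈ affineOpen J) : ofCone hd J (toCone e) = lineCoord d J e := by
  rw [toCone_eq he, ofCone]
  simp only [ProjSpace.ratio_ofVec (coneLocal_ne_zero J _), coneLocal_cornerIndex, coneLocal_linearIndex,
    coneLocal_none, div_one]

lemma toCone_mem_affineOpen {J : ∀ i, Fin (n i + 1)} {e : (lineBundle n d).TotalSpace}
    (he : e.proj ∈ affineOpen J) : toCone e ∈ ProjSpace.affineOpen (cornerIndex d J) := by
  rw [toCone_eq he]
  exact ProjSpace.ofVec_mem_affineOpen (by rw [coneLocal_cornerIndex]; exact one_ne_zero)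

lemma contMDiffAt_ofCone (hd : ∀ i, 1 ≤ d i) (J : ∀ i, Fin (n i + 1)) {p}
    (hp : p ∈ ProjSpace.affineOpen (cornerIndex d J)) :
    ContMDiffAt 𝓘(ℂ, Fin (coneDim n d) → ℂ) 𝓘(ℂ, (∀ i, Fin (n i) → ℂ) × ℂ) ω (ofCone hd J) p :=
  ContMDiffAt.prodMk_space
    (contMDiffAt_pi_space.2 fun _ => contMDiffAt_pi_space.2 fun _ => ProjSpace.contMDiffAt_ratio _ _ hp)
    (ProjSpace.contMDiffAt_ratio _ _ hp)

lemma mem_affineOpen_of_toCone (hd : ∀ i, 1 ≤ d i) {J : ∀ i, Fin (n i + 1)} {e : (lineBundle n d).TotalSpace}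
    (he : toCone e ∈ ProjSpace.affineOpen (cornerIndex d J)) : e.proj ∈ affineOpen J := by
  have h1 := ProjSpace.ne_zero_of_ofVec_mem_affineOpen (coneCoord_ne_zero e) he
  rw [coneCoord, cornerIndex, Equiv.symm_apply_apply] at h1
  have h2 : eval (coords e.proj) (monomial (cornerExponent (fun i => ⟨i, J i⟩) d) (1 : ℂ)) ≠ 0 := h1
  rw [monomial_cornerExponent, map_prod] at h2
  intro i
  have h3 := Finset.prod_ne_zero_iff.1 h2 i (Finset.mem_univ i)
  rw [map_pow, eval_X] at h3
  exact (pow_ne_zero_iff (by have := hd i; omega)).1 h3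

lemma injective_toCone (hd : ∀ i, 1 ≤ d i) :
    Function.Injective (toCone : (lineBundle n d).TotalSpace → _) := by
  intro e e' h
  obtain ⟨J, hJ⟩ := exists_mem_affineOpen e.proj
  have hJ' : e'.proj ∈ affineOpen J := mem_affineOpen_of_toCone hd (h ▸ toCone_mem_affineOpen hJ)
  refine (lineCoord d J).injOn (mem_lineCoord_source.2 hJ) (mem_lineCoord_source.2 hJ') ?_
  rw [← ofCone_toCone hd hJ, h, ofCone_toCone hd hJ']

end Cone

namespace SmoothingFamily

variable {A : Fin 3 → MvPolynomial (Σ i, Fin (n i + 1)) ℂ} {t : MvPolynomial (Σ i, Fin (n i + 1)) ℂ}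
  (Γ : SmoothingFamily d A t) {T : ComplexManifold 4} {ι : T → (lineBundle n d).TotalSpace × ℂ}
  (hι : IsSubmanifoldEmbedding ((𝓘(ℂ, ∀ i, Fin (n i) → ℂ).prod 𝓘(ℂ)).prod 𝓘(ℂ)) Γ.total T ι)

/-- The embedding is `(ζ, toCone e)`. It is closed because the projection to the disk is proper, and
it is an immersion because `ofCone` recovers the coordinates `(u, w, ζ)`. -/
theorem isProjectiveMorphism_toDisk (hd : ∀ i, 1 ≤ d i) :
    IsProjectiveMorphism 𝓘(ℂ, Fin 4 → ℂ) 𝓘(ℂ) (Γ.toDisk hι) := by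
  have hfst : ContMDiff 𝓘(ℂ, Fin 4 → ℂ) (𝓘(ℂ, ∀ i, Fin (n i) → ℂ).prod 𝓘(ℂ)) ω fun x => (ι x).1 :=
    contMDiff_fst.comp hι.holomorphic
  have hhol : ContMDiff 𝓘(ℂ, Fin 4 → ℂ) (𝓘(ℂ).prod 𝓘(ℂ, Fin (coneDim n d) → ℂ)) ω
      fun x => (Γ.toDisk hι x, toCone (ι x).1) :=
    (Γ.contMDiff_toDisk hι).prodMk (contMDiff_toCone.comp hfst)
  have hproper : IsProperMap (Γ.toDisk hι) :=
    Γ.isProperMap_of_isEmbedding hι.isEmbedding hι.range_eq fun _ => rfl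
  refine ⟨_, fun x => toCone (ι x).1, hhol, ?_, fun x => ?_⟩
  · refine Topology.IsClosedEmbedding.of_continuous_injective_isClosedMap hhol.continuous ?_
      (isProperMap_of_comp_of_t2 hhol.continuous continuous_fst hproper).isClosedMap
    intro x y hxy
    obtain ⟨h1, h2⟩ := Prod.ext_iff.1 hxy
    exact hι.isEmbedding.injective
      (Prod.ext (injective_toCone hd h2) (congrArg (Subtype.val : unitDisk → ℂ) h1))
  · obtain ⟨J, hJ⟩ := exists_mem_affineOpen (ι x).1.proj
    refine injective_mfderiv_of_comp (I₃ := 𝓘(ℂ, ((∀ i, Fin (n i) → ℂ) × ℂ) × ℂ))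
      (h := fun q => (ofCone hd J q.2, (q.1 : ℂ))) (φ := fun y => totalCoord d J (ι y)) (hhol x) ?_ ?_ ?_
    · exact ContMDiffAt.prodMk_space
        (ContMDiffAt.comp (g := ofCone hd J) (f := Prod.snd) (Γ.toDisk hι x, toCone (ι x).1)
          (contMDiffAt_ofCone hd J (toCone_mem_affineOpen hJ)) contMDiffAt_snd)
        (ContMDiffAt.comp (g := Subtype.val) (f := Prod.fst) (Γ.toDisk hι x, toCone (ι x).1)
          (contMDiff_subtype_val _) contMDiffAt_fst)
    · filter_upwards [hι.holomorphic.continuous.continuousAt.preimage_mem_nhds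
        ((totalCoord d J).open_source.mem_nhds (Γ.mem_source hι hJ))] with y hy
      rw [ofCone_toCone hd (mem_totalCoord_source.1 hy).1]
      rfl
    · exact injective_mfderiv_comp (hι.holomorphic x)
        ((isHolCoord_totalCoord d J).contMDiffAt (Γ.mem_source hι hJ)) (hι.injective_mfderiv x)
        ((isHolCoord_totalCoord d J).injective_mfderiv (Γ.mem_source hι hJ))

end SmoothingFamily

end MultiProj

namespace MultiProj

open MvPolynomial

variable {r : ℕ} {n d : Fin r → ℕ} {A : Fin 3 → MvPolynomial (Σ i, Fin (n i + 1)) ℂ}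
  {t : MvPolynomial (Σ i, Fin (n i + 1)) ℂ}

lemma IsResolved.fibreCoord_eq_zero {p : MultiProj n × ProjSpace 1} {e : (lineBundle n d).TotalSpace}
    (h : IsResolved A p e) (hp : e.proj ∈ nodes A) : fibreCoord e = 0 := by
  have h1 := mem_doubleCover_iff.1 h.mem_doubleCover
  have h2 := fun j => hp j
  simpa [discr, h2] using h1

/-! ### The general fibre -/

namespace SmoothingFamily

variable (Γ : SmoothingFamily d A t) {T : ComplexManifold 4} {ι : T → (lineBundle n d).TotalSpace × ℂ}
  (hι : IsSubmanifoldEmbedding ((𝓘(ℂ, ∀ i, Fin (n i) → ℂ).prod 𝓘(ℂ)).prod 𝓘(ℂ)) Γ.total T ι)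

/-- The fibre over `Γ.c` is the double cover branched along `γ c = t`. As `X` is compact, the
injective holomorphic map onto this fibre is a closed embedding. -/
theorem exists_fibre_embedding {X : ComplexManifold 3} {κ : X → (lineBundle n d).TotalSpace}
    (ht : t ∈ sections n (2 • d))
    (hκ : IsSubmanifoldEmbedding (𝓘(ℂ, ∀ i, Fin (n i) → ℂ).prod 𝓘(ℂ)) (doubleCover d t) X κ) :
    ∃ (c : unitDisk) (j : X → T), c ≠ unitDisk.center ∧
      IsClosedHolEmbedding 𝓘(ℂ, Fin 3 → ℂ) 𝓘(ℂ, Fin 4 → ℂ) j ∧ Set.range j = Γ.toDisk hι ⁻¹' {c} := by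
  have hmem : ∀ x, ∃ y, ι y = (κ x, Γ.c) := fun x => by
    have : (κ x, Γ.c) ∈ Set.range ι := by
      rw [hι.range_eq]
      exact ⟨Γ.c_mem, by rw [Γ.γ_c]; exact hκ.mem x⟩
    exact this
  choose j hj using hmem
  have hj1 : ∀ x, (ι (j x)).1 = κ x := fun x => by rw [hj]
  have hhol : ContMDiff 𝓘(ℂ, Fin 3 → ℂ) 𝓘(ℂ, Fin 4 → ℂ) ω j := fun x => by
    refine hι.contMDiffAt_of_comp ?_
    simp only [hj]
    exact (hκ.holomorphic x).prodMk contMDiffAt_const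
  have hcomp : CompactSpace X := hκ.compactSpace (isCompact_doubleCover ht)
  have hinj : Function.Injective j := fun x y h => hκ.isEmbedding.injective (by rw [← hj1, h, hj1])
  refine ⟨⟨Γ.c, Γ.c_mem⟩, j, fun h => Γ.c_ne_zero (congrArg Subtype.val h),
    ⟨hhol, hhol.continuous.isClosedEmbedding hinj, fun x => ?_⟩, ?_⟩
  · refine injective_mfderiv_of_comp (h := fun y => (ι y).1) (φ := κ) (hhol x)
      (contMDiffAt_fst.comp _ (hι.holomorphic _)) (Filter.Eventually.of_forall hj1) (hκ.injective_mfderiv x)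
  · ext y
    constructor
    · rintro ⟨x, rfl⟩
      exact Subtype.ext (congrArg Prod.snd (hj x))
    · intro hy
      have h2 : (ι y).2 = Γ.c := congrArg Subtype.val hy
      have h1 : (ι y).1 ∈ doubleCover d t := by
        rw [← Γ.γ_c, ← h2]
        exact (hι.mem y).2
      rw [← hκ.range_eq] at h1
      obtain ⟨x, hx⟩ := h1
      exact ⟨x, hι.isEmbedding.injective ((hj x).trans (Prod.ext hx h2.symm))⟩

/-! ### The small resolution -/

include hι in
lemma contMDiff_proj_total : ContMDiff 𝓘(ℂ, Fin 4 → ℂ) 𝓘(ℂ, ∀ i, Fin (n i) → ℂ) ω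
    fun x : T => (ι x).1.proj :=
  (Bundle.contMDiff_proj _).comp (contMDiff_fst.comp hι.holomorphic)

section Resolution

variable {Y : ComplexManifold 3} {ρ : Y → MultiProj n × ProjSpace 1}
  (hρ : IsSubmanifoldEmbedding (𝓘(ℂ, ∀ i, Fin (n i) → ℂ).prod 𝓘(ℂ, Fin 1 → ℂ))
    (zeroLocusProd (binaryQuadratic A)) Y ρ) {ψ : Y → T}
  (hres : ∀ y, IsResolved A (ρ y) (ι (ψ y)).1) (hψ0 : ∀ y, (ι (ψ y)).2 = 0)

include hρ hι hres hψ0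

lemma contMDiff_resolution (hA : ∀ j, A j ∈ sections n d) :
    ContMDiff 𝓘(ℂ, Fin 3 → ℂ) 𝓘(ℂ, Fin 4 → ℂ) ω ψ := fun y => by
  refine hι.contMDiffAt_of_comp ?_
  have h : (fun y => ι (ψ y)) = fun y => ((ι (ψ y)).1, 0) := funext fun y => Prod.ext rfl (hψ0 y)
  rw [h]
  exact (contMDiff_of_isResolved hA hρ.holomorphic hres y).prodMk contMDiffAt_const

/-- One extra factor `ℙ¹` suffices: `ψ y` determines the point of `Z`, and with the point of `ℙ¹`
this recovers `ρ y`. Closedness comes from the compactness of `Y`. -/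
lemma isProjectiveMorphism_resolution (hA : ∀ j, A j ∈ sections n d) :
    IsProjectiveMorphism 𝓘(ℂ, Fin 3 → ℂ) 𝓘(ℂ, Fin 4 → ℂ) ψ := by
  have hψ := Γ.contMDiff_resolution hι hρ hres hψ0 hA
  have hcomp : CompactSpace Y := hρ.compactSpace (isClosed_zeroLocusProd hA).isCompact
  have hhol : ContMDiff 𝓘(ℂ, Fin 3 → ℂ) (𝓘(ℂ, Fin 4 → ℂ).prod 𝓘(ℂ, Fin 1 → ℂ)) ω
      fun y => (ψ y, (ρ y).2) := hψ.prodMk (contMDiff_snd.comp hρ.holomorphic)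
  refine ⟨1, fun y => (ρ y).2, hhol, hhol.continuous.isClosedEmbedding fun y y' h => ?_, fun y => ?_⟩
  · obtain ⟨h1, h2⟩ := Prod.ext_iff.1 h
    refine hρ.isEmbedding.injective (Prod.ext ?_ h2)
    rw [← (hres y).proj_eq, ← (hres y').proj_eq, show ψ y = ψ y' from h1]
  · refine injective_mfderiv_of_comp (I₃ := 𝓘(ℂ, ∀ i, Fin (n i) → ℂ).prod 𝓘(ℂ, Fin 1 → ℂ))
      (h := fun q => ((ι q.1).1.proj, q.2)) (φ := ρ) (hhol y)
      (((Γ.contMDiff_proj_total hι).comp contMDiff_fst).prodMk contMDiff_snd _)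
      (Filter.Eventually.of_forall fun y' => Prod.ext (hres y').proj_eq rfl) (hρ.injective_mfderiv y)

lemma range_resolution (hA : ∀ j, A j ∈ sections n d) :
    Set.range ψ = Γ.toDisk hι ⁻¹' {unitDisk.center} := by
  ext x
  constructor
  · rintro ⟨y, rfl⟩
    exact Subtype.ext (hψ0 y)
  · intro hx
    have h2 : (ι x).2 = 0 := congrArg Subtype.val hx
    have h1 : (ι x).1 ∈ doubleCover d (discr A) := by
      rw [← Γ.doubleCover_γ_zero hA, ← h2]
      exact (hι.mem x).2
    obtain ⟨p, hp⟩ := exists_isResolved_of_mem_doubleCover h1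
    have hp' := hp.mem_zeroLocusProd
    rw [← hρ.range_eq] at hp'
    obtain ⟨y, rfl⟩ := hp'
    exact ⟨y, hι.isEmbedding.injective (Prod.ext (hp.unique (hres y)) ((hψ0 y).trans h2.symm))⟩

omit hρ in
lemma isCriticalPt_resolution_iff (hn : ∑ i, n i = 3) (hreg : IsRegularNet Sigma.fst A)
    (hA : ∀ j, A j ∈ sections n d) (y : Y) :
    IsCriticalPt (Γ.toDisk hι) (ψ y) ↔ (ρ y).1 ∈ nodes A := by
  rw [Γ.isCriticalPt_iff hι hn hreg hA, (hres y).proj_eq]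
  refine ⟨fun h => h.2.2, fun h => ⟨(hres y).fibreCoord_eq_zero ?_, hψ0 y, h⟩⟩
  rwa [(hres y).proj_eq]

/-- Away from the nodes, the point of `ℙ¹` is a holomorphic function of the point of the double cover. -/
lemma exists_local_inverse (hA : ∀ j, A j ∈ sections n d) {y : Y} (hy : (ρ y).1 ∉ nodes A) :
    ∃ h : T → ProjSpace 1, ContMDiffAt 𝓘(ℂ, Fin 4 → ℂ) 𝓘(ℂ, Fin 1 → ℂ) ω h (ψ y) ∧
      ∀ᶠ y' in 𝓝 y, h (ψ y') = (ρ y').2 := by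
  obtain ⟨J, hJ⟩ := exists_mem_affineOpen (ι (ψ y)).1.proj
  have hψ := Γ.contMDiff_resolution hι hρ hres hψ0 hA
  have hcoord := Γ.contMDiffAt_coord hι hJ
  have hev : ∀ᶠ y' in 𝓝 y, (ι (ψ y')).1.proj ∈ affineOpen J :=
    ((Γ.contMDiff_proj_total hι).comp hψ).continuous.continuousAt.preimage_mem_nhds
      ((isOpen_affineOpen J).mem_nhds hJ)
  let w : T → ℂ := fun x => (totalCoord d J (ι x)).1.2
  let f : Fin 3 → T → ℂ := fun j x => localFun J (A j) (totalCoord d J (ι x)).1.1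
  have hw : ContMDiffAt 𝓘(ℂ, Fin 4 → ℂ) 𝓘(ℂ) ω w (ψ y) :=
    ContMDiffAt.comp (g := fun p : ((∀ i, Fin (n i) → ℂ) × ℂ) × ℂ => p.1.2) (ψ y)
      (show ContDiff ℂ ω _ by fun_prop).contMDiff.contMDiffAt hcoord
  have hf : ∀ j, ContMDiffAt 𝓘(ℂ, Fin 4 → ℂ) 𝓘(ℂ) ω (f j) (ψ y) := fun j =>
    ContMDiffAt.comp (g := fun p : ((∀ i, Fin (n i) → ℂ) × ℂ) × ℂ => localFun J (A j) p.1.1) (ψ y)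
      (((contDiff_localFun J (A j)).comp (by fun_prop)).contMDiff.contMDiffAt) hcoord
  have key : ∀ y', (ι (ψ y')).1.proj ∈ affineOpen J →
      w (ψ y') * (ρ y').2.rep 1 = 2 * f 0 (ψ y') * (ρ y').2.rep 0 + f 1 (ψ y') * (ρ y').2.rep 1 ∧
      w (ψ y') * (ρ y').2.rep 0 = -(f 1 (ψ y') * (ρ y').2.rep 0 + 2 * f 2 (ψ y') * (ρ y').2.rep 1) := by
    intro y' hy'
    have hm := cornerMonomial_ne_zero d hy'
    have h0 := (hres y').eq₀
    have h1 := (hres y').eq₁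
    rw [← (hres y').proj_eq, ← lineCoord_snd_mul hy'] at h0 h1
    simp only [eval_coords (hA _) hy'] at h0 h1
    constructor <;> refine mul_left_cancel₀ hm ?_ <;> simp only [w, f, totalCoord_apply, lineCoord_fst]
    · linear_combination h0
    · linear_combination h1
  -- Where it is nonzero, each of `[w - B : 2 A]` and `[-2 C : w + B]` is the point of `ℙ¹`. Both
  -- vanish only at a node.
  by_cases hv : ![w (ψ y) - f 1 (ψ y), 2 * f 0 (ψ y)] = 0
  · have hv' : ![-2 * f 2 (ψ y), w (ψ y) + f 1 (ψ y)] ≠ 0 := by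
      intro hv'
      refine hy ?_
      have a0 := congrFun hv 0
      have a1 := congrFun hv 1
      have a2 := congrFun hv' 0
      have a3 := congrFun hv' 1
      simp at a0 a1 a2 a3
      have hJ' : (ρ y).1 ∈ affineOpen J := by rwa [← (hres y).proj_eq]
      rw [mem_nodes_iff hA hJ', ← (hres y).proj_eq]
      intro j
      change f j (ψ y) = 0
      fin_cases j
      · exact a1
      · change f 1 (ψ y) = 0
        linear_combination a3 / 2 - a0 / 2
      · exact a2
    have hcd : ∀ k, ContMDiffAt 𝓘(ℂ, Fin 4 → ℂ) 𝓘(ℂ) ω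
        (fun x => (![-2 * f 2 x, w x + f 1 x] : Fin 2 → ℂ) k) (ψ y) := by
      intro k
      fin_cases k
      · exact contMDiffAt_const.mul (hf 2)
      · exact hw.add (hf 1)
    refine ⟨fun x => ProjSpace.ofVec ![-2 * f 2 x, w x + f 1 x], ProjSpace.contMDiffAt_ofVec hcd hv', ?_⟩
    have hne : ∀ᶠ y' in 𝓝 y, ![-2 * f 2 (ψ y'), w (ψ y') + f 1 (ψ y')] ≠ 0 := by
      have hc : ContinuousAt (fun y' => ![-2 * f 2 (ψ y'), w (ψ y') + f 1 (ψ y')]) y :=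
        continuousAt_pi.2 fun k => (hcd k).continuousAt.comp (f := ψ) hψ.continuous.continuousAt
      exact hc.eventually_ne hv'
    filter_upwards [hev, hne] with y' h1 h2
    refine (ProjSpace.eq_ofVec h2 ?_).symm
    simp
    linear_combination (key y' h1).2
  · have hcd : ∀ k, ContMDiffAt 𝓘(ℂ, Fin 4 → ℂ) 𝓘(ℂ) ω
        (fun x => (![w x - f 1 x, 2 * f 0 x] : Fin 2 → ℂ) k) (ψ y) := by
      intro k
      fin_cases k
      · exact hw.sub (hf 1)
      · exact contMDiffAt_const.mul (hf 0)
    refine ⟨fun x => ProjSpace.ofVec ![w x - f 1 x, 2 * f 0 x], ProjSpace.contMDiffAt_ofVec hcd hv, ?_⟩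
    have hne : ∀ᶠ y' in 𝓝 y, ![w (ψ y') - f 1 (ψ y'), 2 * f 0 (ψ y')] ≠ 0 := by
      have hc : ContinuousAt (fun y' => ![w (ψ y') - f 1 (ψ y'), 2 * f 0 (ψ y')]) y :=
        continuousAt_pi.2 fun k => (hcd k).continuousAt.comp (f := ψ) hψ.continuous.continuousAt
      exact hc.eventually_ne hv
    filter_upwards [hev, hne] with y' h1 h2
    refine (ProjSpace.eq_ofVec h2 ?_).symm
    simp
    linear_combination -(key y' h1).1

lemma injective_mfderiv_resolution (hA : ∀ j, A j ∈ sections n d) {y : Y} (hy : (ρ y).1 ∉ nodes A) :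
    Function.Injective (mfderiv 𝓘(ℂ, Fin 3 → ℂ) 𝓘(ℂ, Fin 4 → ℂ) ψ y) := by
  obtain ⟨h, hh, hhy⟩ := Γ.exists_local_inverse hι hρ hres hψ0 hA hy
  refine injective_mfderiv_of_comp (I₃ := 𝓘(ℂ, ∀ i, Fin (n i) → ℂ).prod 𝓘(ℂ, Fin 1 → ℂ))
    (h := fun x => ((ι x).1.proj, h x)) (φ := ρ) (Γ.contMDiff_resolution hι hρ hres hψ0 hA y)
    ((Γ.contMDiff_proj_total hι _).prodMk hh) ?_ (hρ.injective_mfderiv y)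
  filter_upwards [hhy] with y' hy'
  exact Prod.ext (hres y').proj_eq hy'

end Resolution

end SmoothingFamily

lemma eventually_eq_of_mem_finite {X Z : Type*} [TopologicalSpace X] [TopologicalSpace Z] [T1Space Z]
    {f : X → Z} {x : X} (hf : ContinuousAt f x) {S : Set Z} (hS : S.Finite) (h : ∀ᶠ y in 𝓝 x, f y ∈ S) :
    ∀ᶠ y in 𝓝 x, f y = f x := by
  have h1 : ∀ᶠ z in 𝓝 (f x), z ∉ S \ {f x} :=
    (hS.subset Set.sdiff_subset).isClosed.isOpen_compl.mem_nhds fun h => h.2 rfl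
  filter_upwards [h, hf.eventually h1] with y h2 h3
  by_contra h4
  exact h3 ⟨h2, h4⟩

/-- A subset of a submanifold of `Z × ℙ¹` that lies over finitely many points of `Z` has dimension at
most one. -/
lemma hasDimLT_two {m : ℕ} {Y : ComplexManifold m} {ρ : Y → MultiProj n × ProjSpace 1}
    {S₀ : Set (MultiProj n × ProjSpace 1)}
    (hρ : IsSubmanifoldEmbedding (𝓘(ℂ, ∀ i, Fin (n i) → ℂ).prod 𝓘(ℂ, Fin 1 → ℂ)) S₀ Y ρ)
    {S : Set (MultiProj n)} (hS : S.Finite) : HasDimLT 2 {y | (ρ y).1 ∈ S} := by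
  intro g hg hgS hinj
  have hF : ContMDiffAt 𝓘(ℂ, Fin 2 → ℂ) (𝓘(ℂ, ∀ i, Fin (n i) → ℂ).prod 𝓘(ℂ, Fin 1 → ℂ)) ω
      (fun u => ρ (g u)) 0 := (hρ.holomorphic (g 0)).comp 0 hg
  have hFi := injective_mfderiv_comp hg (hρ.holomorphic (g 0)) hinj (hρ.injective_mfderiv (g 0))
  -- A continuous germ into a finite set is constant, so an immersed surface germ would immerse in
  -- the single factor `ℙ¹`, of dimension one.
  have hconst : ∀ᶠ u in 𝓝 0, (ρ (g u)).1 = (ρ (g 0)).1 :=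
    eventually_eq_of_mem_finite (continuousAt_fst.comp hF.continuousAt) hS hgS
  have h2 : ContMDiffAt 𝓘(ℂ, Fin 2 → ℂ) 𝓘(ℂ, Fin 1 → ℂ) ω (fun u => (ρ (g u)).2) 0 :=
    contMDiffAt_snd.comp 0 hF
  have h3 := injective_mfderiv_of_comp (h := fun q : ProjSpace 1 => ((ρ (g 0)).1, q))
    (φ := fun u => ρ (g u)) h2 (contMDiffAt_const.prodMk contMDiffAt_id)
    (by filter_upwards [hconst] with u hu using Prod.ext hu.symm rfl) hFi
  let L : (Fin 2 → ℂ) →ₗ[ℂ] (Fin 1 → ℂ) :=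
    (mfderiv 𝓘(ℂ, Fin 2 → ℂ) 𝓘(ℂ, Fin 1 → ℂ) (fun u => (ρ (g u)).2) 0).toLinearMap
  have h4 := LinearMap.finrank_le_finrank_of_injective (f := L) h3
  simp at h4

namespace SmoothingFamily

variable (Γ : SmoothingFamily d A t) {T : ComplexManifold 4} {ι : T → (lineBundle n d).TotalSpace × ℂ}
  (hι : IsSubmanifoldEmbedding ((𝓘(ℂ, ∀ i, Fin (n i) → ℂ).prod 𝓘(ℂ)).prod 𝓘(ℂ)) Γ.total T ι)

theorem exists_isSmallResolution (hn : ∑ i, n i = 3) (hreg : IsRegularNet Sigma.fst A)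
    (hA : ∀ j, A j ∈ sections n d) {Y : ComplexManifold 3} {ρ : Y → MultiProj n × ProjSpace 1}
    (hρ : IsSubmanifoldEmbedding (𝓘(ℂ, ∀ i, Fin (n i) → ℂ).prod 𝓘(ℂ, Fin 1 → ℂ))
      (zeroLocusProd (binaryQuadratic A)) Y ρ) :
    ∃ ψ : Y → T, IsSmallResolution (Γ.toDisk hι) ψ := by
  have hex : ∀ y, ∃ x, IsResolved A (ρ y) (ι x).1 ∧ (ι x).2 = 0 := fun y => by
    obtain ⟨e, he⟩ := exists_isResolved d (hρ.mem y)
    have : (e, (0 : ℂ)) ∈ Set.range ι := by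
      rw [hι.range_eq]
      refine ⟨Metric.mem_ball_self one_pos, ?_⟩
      rw [Γ.doubleCover_γ_zero hA]
      exact he.mem_doubleCover
    obtain ⟨x, hx⟩ := this
    exact ⟨x, by rw [hx]; exact he, by rw [hx]⟩
  choose ψ hres hψ0 using hex
  have hcrit := Γ.isCriticalPt_resolution_iff hι hres hψ0 hn hreg hA
  refine ⟨ψ, Γ.contMDiff_resolution hι hρ hres hψ0 hA, Γ.isProjectiveMorphism_resolution hι hρ hres hψ0 hA,
    Γ.range_resolution hι hρ hres hψ0 hA, fun y y' h hyy' => ?_, fun y h => ?_, ?_⟩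
  · rw [hcrit] at h
    exact hρ.isEmbedding.injective ((hres y).eq_of_not_mem_nodes (hyy' ▸ hres y') h)
  · rw [hcrit] at h
    exact Γ.injective_mfderiv_resolution hι hρ hres hψ0 hA h
  · simp only [hcrit]
    exact hasDimLT_two hρ (finite_nodes hn hreg hA)

end SmoothingFamily

/-- The smoothing and the small resolution of the nodal double cover form a conifold transition. -/
theorem SmoothingFamily.conifoldTransition (Γ : SmoothingFamily d A t) (hn : ∑ i, n i = 3) (hd : ∀ i, 1 ≤ d i) (hreg : IsRegularNet Sigma.fst A)
    (hA : ∀ j, A j ∈ sections n d) (ht : t ∈ sections n (2 • d)) {z₀ : MultiProj n} (hz₀ : z₀ ∈ nodes A)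
    {X : ComplexManifold 3} {κ : X → (lineBundle n d).TotalSpace}
    (hκ : IsSubmanifoldEmbedding (𝓘(ℂ, ∀ i, Fin (n i) → ℂ).prod 𝓘(ℂ)) (doubleCover d t) X κ)
    {Y : ComplexManifold 3} {ρ : Y → MultiProj n × ProjSpace 1}
    (hρ : IsSubmanifoldEmbedding (𝓘(ℂ, ∀ i, Fin (n i) → ℂ).prod 𝓘(ℂ, Fin 1 → ℂ))
      (zeroLocusProd (binaryQuadratic A)) Y ρ) : ConifoldTransition X Y := by
  obtain ⟨T, ι, hι⟩ := Γ.exists_total_manifold hn hd hreg hA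
  have hfin := Γ.finite_setOf_isCriticalPt hι hn hreg hA
  have hcenter : ∀ x, IsCriticalPt (Γ.toDisk hι) x → Γ.toDisk hι x = unitDisk.center := fun x hx =>
    Subtype.ext ((Γ.isCriticalPt_iff hι hn hreg hA).1 hx).2.1
  obtain ⟨x₀, hx₀⟩ := Γ.exists_isCriticalPt hι hn hreg hA hz₀
  exact ⟨T, Γ.toDisk hι, Γ.contMDiff_toDisk hι, Γ.isProjectiveMorphism_toDisk hι hd,
    isFlatHol_of_finite _ hfin, fun x hx hc => hx (hcenter x hc), hfin.subset fun x hx => hx.2,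
    ⟨x₀, hcenter x₀ hx₀, hx₀⟩, fun x _ hx => Γ.isOrdinaryDoublePt hι hn hreg hA hx,
    Γ.exists_fibre_embedding hι ht hκ, Γ.exists_isSmallResolution hι hn hreg hA hρ⟩

end MultiProj

/-! ### Assembly of the theorem. -/

lemma IsDoubleSolidPair.sum_eq_three {r : ℕ} {n d : Fin r → ℕ} (h : IsDoubleSolidPair r n d) :
    ∑ i, n i = 3 := by
  cases h <;> rfl

lemma IsDoubleSolidPair.one_le {r : ℕ} {n d : Fin r → ℕ} (h : IsDoubleSolidPair r n d) (i : Fin r) :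
    1 ≤ d i := by
  cases h with
  | projThree a ha =>
    fin_cases i
    change 1 ≤ a
    omega
  | projOneTwo b hb =>
    fin_cases i
    · exact le_rfl
    · change 1 ≤ b
      omega
  | projOneOneOne => fin_cases i <;> exact le_rfl

theorem proposition4p3 (r : ℕ) (n d : Fin r → ℕ) (h : IsDoubleSolidPair r n d) :
    ∃ (U : Set (MultiProj.sectionsProd n d 2)) (V : Set (MultiProj.sections n (2 • d))),
      IsZariskiOpen U ∧ U.Nonempty ∧ IsZariskiOpen V ∧ V.Nonempty ∧
      ∀ s ∈ U, ∀ t ∈ V,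
        MultiProj.IsSmoothDivisorProd (s : MvPolynomial ((Σ i, Fin (n i + 1)) ⊕ Fin 2) ℂ) ∧
        MultiProj.IsSmoothDivisor (t : MvPolynomial (Σ i, Fin (n i + 1)) ℂ) ∧
        ∃ (Y X : ComplexManifold 3) (ι : Y → MultiProj n × ProjSpace 1)
          (κ : X → (MultiProj.lineBundle n d).TotalSpace),
          IsClosedHolEmbedding 𝓘(ℂ, Fin 3 → ℂ)
            (𝓘(ℂ, ∀ i, Fin (n i) → ℂ).prod 𝓘(ℂ, Fin 1 → ℂ)) ι ∧
          Set.range ι = MultiProj.zeroLocusProd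
            (s : MvPolynomial ((Σ i, Fin (n i + 1)) ⊕ Fin 2) ℂ) ∧
          IsClosedHolEmbedding 𝓘(ℂ, Fin 3 → ℂ)
            (𝓘(ℂ, ∀ i, Fin (n i) → ℂ).prod 𝓘(ℂ)) κ ∧
          Set.range κ = MultiProj.doubleCover d
            (t : MvPolynomial (Σ i, Fin (n i + 1)) ℂ) ∧
          ConifoldTransition X Y := by
  have hn := h.sum_eq_three
  have hd := h.one_le
  have hd2 : ∀ i, 1 ≤ (2 • d) i := fun i => (hd i).trans (by simp; omega)
  have hr : Nonempty (Fin r) := by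
    by_contra hr
    rw [not_nonempty_iff] at hr
    simp at hn
  have hβ : Function.Surjective (Sigma.fst : (Σ i, Fin (n i + 1)) → Fin r) := fun i => ⟨⟨i, 0⟩, rfl⟩
  obtain ⟨G₁, hG₁, hnet⟩ := exists_regularNet_polynomial hβ hd (MultiProj.sectionsProd n d 2)
    (MultiProj.mem_sectionsProd_iff 2)
  obtain ⟨G₂, hG₂, hsm⟩ := exists_smooth_divisor_polynomial hβ hd2
  refine ⟨{s | evalDual G₁ s ≠ 0}, {t | evalDual G₂ t ≠ 0}, isZariskiOpen_ne_zero G₁, hG₁,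
    isZariskiOpen_ne_zero G₂, hG₂, fun s hs t ht => ?_⟩
  have hreg := hnet s hs
  have hs' := (MultiProj.mem_sectionsProd_iff 2 s.1).1 s.2
  have hA := isWeightedHomogeneous_quadCoeff hs'
  have hsA := eq_binaryQuadratic hs'
  -- The node `z₀` makes the central fibre singular and is used for the connectedness of `Y`. The
  -- branch point `z₁` gives the connectedness of `X`.
  obtain ⟨z₀, hz₀⟩ := MultiProj.exists_common_zero_point hn hd hA
  obtain ⟨z₁, hz₁⟩ := MultiProj.exists_common_zero_point hn hd2 (A := fun _ => t.1) fun _ => t.2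
  obtain ⟨Γ⟩ := MultiProj.exists_smoothingFamily hn hA hreg hsm ht
  obtain ⟨Y, ι, hι⟩ := MultiProj.exists_resolution_manifold hn hreg hA hz₀
  obtain ⟨X, κ, hκ⟩ := MultiProj.exists_doubleCover_manifold hn t.2
    (fun J u h0 => MultiProj.fderiv_localFun_ne_zero t.2 (hsm t ht) h0) (hz₁ 0)
  refine ⟨fun p _ => ?_, fun z _ => hsm t ht _ (MultiProj.blockNonzero_coords z), Y, X, ι, κ,
    hι.isClosedHolEmbedding (MultiProj.isClosed_zeroLocusProd hA), ?_,
    hκ.isClosedHolEmbedding (MultiProj.isCompact_doubleCover t.2).isClosed, hκ.range_eq,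
    Γ.conifoldTransition hn hd hreg hA t.2 hz₀ hκ hι⟩
  · rw [hsA]
    exact hreg.smooth _ (MultiProj.blockNonzero_coords p.1) _ p.2.rep_nonzero
  · rw [hι.range_eq, ← hsA]
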